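/- **Setting.** Let $\Gamma$ be a finite simply-laced diagram, i.e. a finite simple graph with vertex set $V$, in which every vertex has at least one neighbour. Let $A=A_\Gamma$ be its zig-zag algebra: the path algebra over $\mathbb{C}$ of the double quiver of $\Gamma$ (constant paths $e_i$, one arrow $(i|j)$ for each ordered pair of adjacent vertices, product by concatenation) modulo the relations $(i|j)(j|k)=0$ for $i\neq k$, $(i|j)(j|i)=(i|k)(k|i)=:x_i$ for all neighbours $j,k$ of $i$, and the vanishing of all paths of length three (a consequence of the other relations except on components with exactly two vertices). Grade $A$ by path length; for a graded module $M$ put $M\langle n\rangle_k=M_{k-n}$. Let $P_i=Ae_i$ and $Q_i=e_iA$. Let $\mathcal{C}_\Gamma$ be the homotopy category of bounded complexes of finitely generated projective graded left $A$-modules (with maps of degree $0$), and let $K_0(\mathcal{C}_\Gamma)$ be its Grothendieck group as a triangulated category, a $\mathbb{Z}[T^{\pm1}]$-module through $T[X]=[X\langle 1\rangle]$. Let $\Sigma_i$ be the complex of graded bimodules $P_i\otimes_{\mathbb{C}}Q_i\xrightarrow{f}A$ and $\Sigma_i^{-1}$ the complex $A\xrightarrow{g}P_i\otimes_{\mathbb{C}}Q_i\langle-2\rangle$,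 with $A$ in homological degree $0$ in both, where $f(e_i\otimes e_i)=e_i$ and $g(1)=x_i\otimes e_i+\sum_{j\sim i}(j|i)\otimes(i|j)+e_i\otimes x_i$. Let $\mathbf{B}(\Gamma)$ be the Artin–Tits group of $\Gamma$, with generators $\sigma_i$ and relations $\sigma_i\sigma_j\sigma_i=\sigma_j\sigma_i\sigma_j$ for $i,j$ adjacent, $\sigma_i\sigma_j=\sigma_j\sigma_i$ otherwise. For a sign $\varepsilon\in\{1,-1\}$, let $V_q(\Gamma)$ be the $\mathbb{C}(q)$-vector space with basis $(\alpha_i)_{i\in V}$ and with the pairing $\langle\alpha_i,\alpha_i\rangle=1+q^2$, $\langle\alpha_i,\alpha_j\rangle=\varepsilon q$ if $i,j$ are adjacent, and $\langle\alpha_i,\alpha_j\rangle=0$ otherwise; the Burau representation of $\mathbf{B}(\Gamma)$ on $V_q(\Gamma)$ is given by $\sigma_i(\alpha_j)=\alpha_j-\langle\alpha_i,\alpha_j\rangle\alpha_i$. Regard $\mathbb{C}(q)$ as a $\mathbb{Z}[T^{\pm1}]$-algebra by $T\mapsto\varepsilon q$. **Corollary (the Khovanov–Seidel representation decategorifies to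 the Burau representation).** There is an action of $\mathbf{B}(\Gamma)$ on $K_0(\mathcal{C}_\Gamma)$ by $\mathbb{Z}[T^{\pm1}]$-linear automorphisms such that $$\sigma_i[X]=[\Sigma_i\otimes_A X],\qquad \sigma_i^{-1}[X]=[\Sigma_i^{-1}\otimes_A X]$$ for every $i\in V$ and every $X\in\mathcal{C}_\Gamma$. Moreover, for each sign $\varepsilon$, there is an isomorphism of $\mathbb{C}(q)$-vector spaces $$\mathbb{C}(q)\otimes_{\mathbb{Z}[T^{\pm1}]}K_0(\mathcal{C}_\Gamma)\;\cong\;V_q(\Gamma)$$ which sends $1\otimes[P_i]$ to $\alpha_i$ for every $i$ and which is $\mathbf{B}(\Gamma)$-equivariant for the (scalar-extended) action above and the Burau representation. In particular it sends $1\otimes[\Sigma_i\otimes_A P_j]$ to $\alpha_j-\langle\alpha_i,\alpha_j\rangle\alpha_i$ for all $i,j$. -/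

import Mathlib

open scoped TensorProduct LaurentPolynomial
open CategoryTheory Limits

universe u

namespace KhovanovSeidel

/-! ### Gradings -/

section Gradings

variable {M : Type*} [AddCommGroup M] [Module ℂ M]

lemma isInternal_of_projections (gr : ℤ → Submodule ℂ M) (δ : ℤ → M →ₗ[ℂ] M)
    (hδ : ∀ k, ∀ m ∈ gr k, ∀ n, δ n m = if n = k then m else 0) (hs : ⨆ k, gr k = ⊤) :
    DirectSum.IsInternal gr := by
  rw [DirectSum.isInternal_submodule_iff_iSupIndep_and_iSup_eq_top]
  refine ⟨?_, hs⟩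
  intro k
  rw [Submodule.disjoint_def]
  intro x hx hx'
  have h1 : δ k x = x := by rw [hδ k x hx]; simp
  have h2 : ⨆ (j : ℤ) (_ : j ≠ k), gr j ≤ LinearMap.ker (δ k) := by
    refine iSup₂_le fun j hj y hy => ?_
    rw [LinearMap.mem_ker, hδ j y hy, if_neg hj.symm]
  rw [← h1]
  exact h2 hx'

lemma bijective_of_isInternal {gr : ℤ → Submodule ℂ M} (h : DirectSum.IsInternal gr) :
    Function.Bijective (DirectSum.coeLinearMap gr) := h

/-- The decomposition of a graded vector space into its homogeneous components. -/
noncomputable def components {gr : ℤ → Submodule ℂ M} (h : DirectSum.IsInternal gr) :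
    M ≃ₗ[ℂ] DirectSum ℤ fun k => gr k :=
  (LinearEquiv.ofBijective (DirectSum.coeLinearMap gr) (bijective_of_isInternal h)).symm

lemma components_of_mem {gr : ℤ → Submodule ℂ M} (h : DirectSum.IsInternal gr) {k : ℤ} {m : M}
    (hm : m ∈ gr k) :
    components h m = DirectSum.lof ℂ ℤ (fun k => gr k) k ⟨m, hm⟩ := by
  rw [components, LinearEquiv.symm_apply_eq, LinearEquiv.ofBijective_apply]
  exact (DirectSum.coeLinearMap_lof gr k ⟨m, hm⟩).symm

/-- The projection onto the component of degree `n`. -/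
noncomputable def proj (gr : ℤ → Submodule ℂ M) (h : DirectSum.IsInternal gr) (n : ℤ) :
    M →ₗ[ℂ] M :=
  (gr n).subtype ∘ₗ DirectSum.component ℂ ℤ (fun k => gr k) n ∘ₗ
    (components h).toLinearMap

lemma proj_of_mem (gr : ℤ → Submodule ℂ M) (h : DirectSum.IsInternal gr) {k : ℤ} {m : M}
    (hm : m ∈ gr k) (n : ℤ) : proj gr h n m = if n = k then m else 0 := by
  simp only [proj, LinearMap.comp_apply, LinearEquiv.coe_coe, components_of_mem h hm]
  split_ifs with hnk
  · subst hnk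
    simp [DirectSum.component.lof_self]
  · simp [DirectSum.component.of, Ne.symm hnk]

lemma proj_mem (gr : ℤ → Submodule ℂ M) (h : DirectSum.IsInternal gr) (n : ℤ) (m : M) :
    proj gr h n m ∈ gr n := by
  simp [proj]

lemma iSup_eq_top_of_isInternal {gr : ℤ → Submodule ℂ M} (h : DirectSum.IsInternal gr) :
    ⨆ k, gr k = ⊤ :=
  ((DirectSum.isInternal_submodule_iff_iSupIndep_and_iSup_eq_top gr).1 h).2

lemma isInternal_reindex {gr : ℤ → Submodule ℂ M} (h : DirectSum.IsInternal gr) (n : ℤ) :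
    DirectSum.IsInternal fun k => gr (k - n) := by
  refine isInternal_of_projections _ (fun k => proj gr h (k - n)) (fun k m hm j => ?_) ?_
  · rw [proj_of_mem gr h hm]
    simp
  · rw [← iSup_eq_top_of_isInternal h]
    exact (Equiv.subRight n).iSup_comp (g := gr)

lemma isInternal_prod {N : Type*} [AddCommGroup N] [Module ℂ N] {gr : ℤ → Submodule ℂ M}
    (h : DirectSum.IsInternal gr) {gr' : ℤ → Submodule ℂ N} (h' : DirectSum.IsInternal gr') :
    DirectSum.IsInternal fun k => (gr k).prod (gr' k) := by
  refine isInternal_of_projections _ (fun k => (proj gr h k).prodMap (proj gr' h' k))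
    (fun k m hm j => ?_) ?_
  · simp only [LinearMap.prodMap_apply, proj_of_mem gr h hm.1, proj_of_mem gr' h' hm.2]
    split_ifs <;> rfl
  · have h1 : ∀ m : M, (m, (0 : N)) ∈ ⨆ k, (gr k).prod (gr' k) := fun m => by
      have : ⨆ k, gr k ≤ (⨆ k, (gr k).prod (gr' k)).comap (LinearMap.inl ℂ M N) :=
        iSup_le fun k x hx => Submodule.mem_iSup_of_mem k ⟨hx, (gr' k).zero_mem⟩
      exact this (by rw [iSup_eq_top_of_isInternal h]; trivial)
    have h2 : ∀ n : N, ((0 : M), n) ∈ ⨆ k, (gr k).prod (gr' k) := fun n => by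
      have : ⨆ k, gr' k ≤ (⨆ k, (gr k).prod (gr' k)).comap (LinearMap.inr ℂ M N) :=
        iSup_le fun k x hx => Submodule.mem_iSup_of_mem k ⟨(gr k).zero_mem, hx⟩
      exact this (by rw [iSup_eq_top_of_isInternal h']; trivial)
    rw [eq_top_iff]
    rintro ⟨m, n⟩ -
    simpa using Submodule.add_mem _ (h1 m) (h2 n)

/-- The part of degree `n` of a quotient `N` of `B ⊗ M`: it is spanned by the images of the `b ⊗ m`
with `deg b + deg m = n`. -/
def tensorGr {B N : Type*} [AddCommGroup B] [Module ℂ B] [AddCommGroup N] [Module ℂ N]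
    (grB : ℤ → Submodule ℂ B) (grM : ℤ → Submodule ℂ M) (π : B ⊗[ℂ] M →ₗ[ℂ] N) (n : ℤ) :
    Submodule ℂ N :=
  Submodule.span ℂ {x | ∃ k l : ℤ, k + l = n ∧ ∃ b ∈ grB k, ∃ m ∈ grM l, x = π (b ⊗ₜ[ℂ] m)}

/-- The linear map sending `b ⊗ m`, with `b` of degree `k`, to `b ⊗ mₙ₋ₖ`. -/
noncomputable def tensorProj {B : Type*} [AddCommGroup B] [Module ℂ B]
    {grB : ℤ → Submodule ℂ B} (hB : DirectSum.IsInternal grB)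
    {grM : ℤ → Submodule ℂ M} (hM : DirectSum.IsInternal grM) (n : ℤ) :
    B ⊗[ℂ] M →ₗ[ℂ] B ⊗[ℂ] M :=
  TensorProduct.lift
    (DirectSum.toModule ℂ ℤ (M →ₗ[ℂ] B ⊗[ℂ] M)
      (fun k => ((TensorProduct.mk ℂ B M).compl₂ (proj grM hM (n - k))) ∘ₗ (grB k).subtype) ∘ₗ
      (components hB).toLinearMap)

lemma tensorProj_tmul {B : Type*} [AddCommGroup B] [Module ℂ B]
    {grB : ℤ → Submodule ℂ B} (hB : DirectSum.IsInternal grB)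
    {grM : ℤ → Submodule ℂ M} (hM : DirectSum.IsInternal grM) (n : ℤ) {k : ℤ} {b : B}
    (hb : b ∈ grB k) (m : M) :
    tensorProj hB hM n (b ⊗ₜ m) = b ⊗ₜ proj grM hM (n - k) m := by
  simp [tensorProj, components_of_mem hB hb]

lemma isInternal_tensorGr {B N : Type*} [AddCommGroup B] [Module ℂ B] [AddCommGroup N] [Module ℂ N]
    {grB : ℤ → Submodule ℂ B} (hB : DirectSum.IsInternal grB)
    {grM : ℤ → Submodule ℂ M} (hM : DirectSum.IsInternal grM)
    (π : B ⊗[ℂ] M →ₗ[ℂ] N) (hπ : Function.Surjective π)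
    (hker : ∀ n t, π t = 0 → π (tensorProj hB hM n t) = 0) :
    DirectSum.IsInternal (tensorGr grB grM π) := by
  have hex : ∀ n, ∃ d : N →ₗ[ℂ] N, ∀ t, d (π t) = π (tensorProj hB hM n t) := fun n => by
    let e := π.quotKerEquivOfSurjective hπ
    refine ⟨(LinearMap.ker π).liftQ (π ∘ₗ tensorProj hB hM n) (fun t ht => hker n t ht) ∘ₗ
      e.symm.toLinearMap, fun t => ?_⟩
    have : e.symm (π t) = Submodule.Quotient.mk t := by
      rw [LinearEquiv.symm_apply_eq]
      simp [e]
    rw [LinearMap.comp_apply, LinearEquiv.coe_coe, this]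
    rfl
  choose d hd using hex
  refine isInternal_of_projections _ d (fun n x hx j => ?_) ?_
  · induction hx using Submodule.span_induction with
    | mem x hx =>
      obtain ⟨k, l, rfl, b, hb, m, hm, rfl⟩ := hx
      rw [hd, tensorProj_tmul hB hM j hb, proj_of_mem grM hM hm]
      by_cases h : j = k + l
      · rw [if_pos h, if_pos (by omega)]
      · rw [if_neg h, if_neg (by omega)]; simp
    | zero => simp
    | add x y _ _ hx hy => rw [map_add, hx, hy]; split_ifs <;> simp
    | smul c x _ hx => rw [map_smul, hx]; split_ifs <;> simp
  · rw [eq_top_iff]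
    intro x _
    obtain ⟨t, rfl⟩ := hπ x
    induction t using TensorProduct.induction_on with
    | zero => simp
    | add x y hx hy => rw [map_add]; exact Submodule.add_mem _ (hx trivial) (hy trivial)
    | tmul b m =>
      have hb : b ∈ ⨆ k, grB k := by rw [iSup_eq_top_of_isInternal hB]; trivial
      have hm : m ∈ ⨆ k, grM k := by rw [iSup_eq_top_of_isInternal hM]; trivial
      induction hb using Submodule.iSup_induction' with
      | zero => simp
      | add x y _ _ hx hy =>
        rw [TensorProduct.add_tmul, map_add]
        exact Submodule.add_mem _ (hx trivial) (hy trivial)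
      | mem k b hb =>
        induction hm using Submodule.iSup_induction' with
        | zero => simp
        | add x y _ _ hx hy =>
          rw [TensorProduct.tmul_add, map_add]
          exact Submodule.add_mem _ (hx trivial) (hy trivial)
        | mem l m hm =>
          exact Submodule.mem_iSup_of_mem (k + l)
            (Submodule.subset_span ⟨k, l, rfl, b, hb, m, hm, rfl⟩)

end Gradings

/-! ### Graded modules and graded bimodules -/

section GradedModules

variable {A : Type u} [Ring A] [Algebra ℂ A]

/-- A `ℤ`-graded left module over the `ℂ`-algebra `A` with grading `𝒜`. -/
structure GrMod (𝒜 : ℤ → Submodule ℂ A) where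
  carrier : Type u
  [addCommGroup : AddCommGroup carrier]
  [moduleC : Module ℂ carrier]
  [module : Module A carrier]
  [isScalarTower : IsScalarTower ℂ A carrier]
  /-- the homogeneous components -/
  gr : ℤ → Submodule ℂ carrier
  isInternal : DirectSum.IsInternal gr
  smul_mem : ∀ {k l : ℤ} {a : A} {m : carrier}, a ∈ 𝒜 k → m ∈ gr l → a • m ∈ gr (k + l)

/-- A `ℤ`-graded `(A, A)`-bimodule; the right action is a left action of `Aᵐᵒᵖ`. -/
structure GrBimod (𝒜 : ℤ → Submodule ℂ A) where
  carrier : Type u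
  [addCommGroup : AddCommGroup carrier]
  [moduleC : Module ℂ carrier]
  [module : Module A carrier]
  [moduleOp : Module Aᵐᵒᵖ carrier]
  [isScalarTower : IsScalarTower ℂ A carrier]
  [isScalarTowerOp : IsScalarTower ℂ Aᵐᵒᵖ carrier]
  [smulCommClass : SMulCommClass A Aᵐᵒᵖ carrier]
  /-- the homogeneous components -/
  gr : ℤ → Submodule ℂ carrier
  isInternal : DirectSum.IsInternal gr
  smul_mem : ∀ {k l : ℤ} {a : A} {m : carrier}, a ∈ 𝒜 k → m ∈ gr l → a • m ∈ gr (k + l)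
  op_smul_mem : ∀ {k l : ℤ} {a : A} {m : carrier}, m ∈ gr k → a ∈ 𝒜 l →
    MulOpposite.op a • m ∈ gr (k + l)

attribute [instance] GrMod.addCommGroup GrMod.moduleC GrMod.module GrMod.isScalarTower
  GrBimod.addCommGroup GrBimod.moduleC GrBimod.module GrBimod.moduleOp GrBimod.isScalarTower
  GrBimod.isScalarTowerOp GrBimod.smulCommClass

variable {𝒜 : ℤ → Submodule ℂ A}

namespace GrMod

/-- Morphisms of graded modules: the `A`-linear maps that preserve the degree. -/
def homs (M N : GrMod 𝒜) : AddSubgroup (M.carrier →ₗ[A] N.carrier) where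
  carrier := {f | ∀ k, ∀ m ∈ M.gr k, f m ∈ N.gr k}
  zero_mem' := fun k _ _ => (N.gr k).zero_mem
  add_mem' := fun hf hg k m hm => (N.gr k).add_mem (hf k m hm) (hg k m hm)
  neg_mem' := fun hf k m hm => (N.gr k).neg_mem (hf k m hm)

instance : Category (GrMod 𝒜) where
  Hom M N := homs M N
  id M := ⟨LinearMap.id, fun _ _ hm => hm⟩
  comp f g := ⟨g.1 ∘ₗ f.1, fun k m hm => g.2 k _ (f.2 k m hm)⟩

/-- The linear map underlying a morphism of graded modules. -/
def Hom.lin {M N : GrMod 𝒜} (f : M ⟶ N) : M.carrier →ₗ[A] N.carrier := f.1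

/-- A degree-preserving linear map as a morphism. -/
def ofLin {M N : GrMod 𝒜} (f : M.carrier →ₗ[A] N.carrier)
    (hf : ∀ k, ∀ m ∈ M.gr k, f m ∈ N.gr k) : M ⟶ N := ⟨f, hf⟩

lemma Hom.map_mem {M N : GrMod 𝒜} (f : M ⟶ N) {k : ℤ} {m : M.carrier} (hm : m ∈ M.gr k) :
    Hom.lin f m ∈ N.gr k := f.2 k m hm

@[ext]
lemma hom_ext {M N : GrMod 𝒜} {f g : M ⟶ N} (h : Hom.lin f = Hom.lin g) : f = g := Subtype.ext h

@[simp] lemma lin_ofLin {M N : GrMod 𝒜} (f : M.carrier →ₗ[A] N.carrier)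
    (hf : ∀ k, ∀ m ∈ M.gr k, f m ∈ N.gr k) : Hom.lin (ofLin f hf) = f := rfl

@[simp] lemma lin_id (M : GrMod 𝒜) : Hom.lin (𝟙 M) = LinearMap.id := rfl

@[simp] lemma lin_comp {M N K : GrMod 𝒜} (f : M ⟶ N) (g : N ⟶ K) :
    Hom.lin (f ≫ g) = Hom.lin g ∘ₗ Hom.lin f := rfl

instance : Preadditive (GrMod 𝒜) where
  homGroup M N := inferInstanceAs (AddCommGroup (homs M N))
  add_comp := by
    intro M N K f f' g
    refine hom_ext (LinearMap.ext fun m => ?_)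
    exact map_add (Hom.lin g) _ _
  comp_add := by
    intro M N K f g g'
    exact hom_ext (LinearMap.ext fun m => rfl)

@[simp] lemma lin_add {M N : GrMod 𝒜} (f g : M ⟶ N) :
    Hom.lin (f + g) = Hom.lin f + Hom.lin g := rfl

@[simp] lemma lin_zero {M N : GrMod 𝒜} : Hom.lin (0 : M ⟶ N) = 0 := rfl

/-- The zero module. -/
def zero : GrMod 𝒜 where
  carrier := PUnit
  gr := fun _ => ⊤
  isInternal := isInternal_of_projections _ (fun _ => 0) (fun _ _ _ _ => Subsingleton.elim _ _)
    (Subsingleton.elim _ _)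
  smul_mem := fun _ _ => trivial

lemma isZero_iff (M : GrMod 𝒜) : IsZero M ↔ Subsingleton M.carrier := by
  rw [IsZero.iff_id_eq_zero]
  constructor
  · intro h
    refine ⟨fun x y => ?_⟩
    have h' : ∀ x : M.carrier, x = 0 := fun x =>
      congrArg (fun f : M.carrier →ₗ[A] M.carrier => f x) (congrArg Hom.lin h)
    rw [h' x, h' y]
  · intro h
    exact hom_ext (LinearMap.ext fun m => Subsingleton.elim _ _)

instance : HasZeroObject (GrMod 𝒜) :=
  ⟨⟨zero, (isZero_iff _).2 (inferInstanceAs (Subsingleton PUnit))⟩⟩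

/-- The direct sum of two graded modules. -/
abbrev prod (M N : GrMod 𝒜) : GrMod 𝒜 where
  carrier := M.carrier × N.carrier
  gr := fun k => (M.gr k).prod (N.gr k)
  isInternal := isInternal_prod M.isInternal N.isInternal
  smul_mem := fun ha hm => ⟨M.smul_mem ha hm.1, N.smul_mem ha hm.2⟩

/-- The direct sum of two graded modules, with its inclusions and projections. -/
def prodBicone (M N : GrMod 𝒜) : BinaryBicone M N where
  pt := prod M N
  fst := ofLin (M := prod M N) (LinearMap.fst A M.carrier N.carrier) fun _ _ hm => hm.1
  snd := ofLin (M := prod M N) (LinearMap.snd A M.carrier N.carrier) fun _ _ hm => hm.2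
  inl := ofLin (N := prod M N) (LinearMap.inl A M.carrier N.carrier)
    fun k _ hm => ⟨hm, (N.gr k).zero_mem⟩
  inr := ofLin (N := prod M N) (LinearMap.inr A M.carrier N.carrier)
    fun k _ hm => ⟨(M.gr k).zero_mem, hm⟩
  inl_fst := hom_ext (LinearMap.ext fun _ => rfl)
  inl_snd := hom_ext (LinearMap.ext fun _ => rfl)
  inr_fst := hom_ext (LinearMap.ext fun _ => rfl)
  inr_snd := hom_ext (LinearMap.ext fun _ => rfl)

lemma prodBicone_total (M N : GrMod 𝒜) :
    (prodBicone M N).fst ≫ (prodBicone M N).inl + (prodBicone M N).snd ≫ (prodBicone M N).inr =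
      𝟙 (prodBicone M N).pt := by
  refine hom_ext (LinearMap.ext fun m => ?_)
  exact Prod.ext (add_zero m.1) (zero_add m.2)

instance : HasBinaryBiproducts (GrMod 𝒜) :=
  ⟨fun M N => hasBinaryBiproduct_of_total (prodBicone M N) (prodBicone_total M N)⟩

/-- The graded module `M⟨n⟩`, with `M⟨n⟩ₖ = Mₖ₋ₙ`. -/
abbrev shift (n : ℤ) (M : GrMod 𝒜) : GrMod 𝒜 where
  carrier := M.carrier
  gr := fun k => M.gr (k - n)
  isInternal := isInternal_reindex M.isInternal n
  smul_mem := fun ha hm => by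
    rw [add_sub_assoc]
    exact M.smul_mem ha hm

/-- The functor `M ↦ M⟨n⟩`. -/
def shiftFunctor (n : ℤ) : GrMod 𝒜 ⥤ GrMod 𝒜 where
  obj M := shift n M
  map {M N} f := ofLin (M := shift n M) (N := shift n N) (Hom.lin (M := M) (N := N) f)
    fun _ _ hm => Hom.map_mem (M := M) (N := N) f hm

instance (n : ℤ) : (shiftFunctor (𝒜 := 𝒜) n).Additive where
  map_add := by intros; rfl

/-- Finitely generated projective graded modules. A graded module is projective in the category
of graded modules if and only if the underlying module is projective. -/
def fgProj : ObjectProperty (GrMod 𝒜) :=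
  fun M => Module.Finite A M.carrier ∧ Module.Projective A M.carrier

lemma fgProj_of_iso {M N : GrMod 𝒜} (e : M ≅ N) (h : fgProj M) : fgProj N := by
  have h1 : Hom.lin e.hom ∘ₗ Hom.lin e.inv = LinearMap.id := congrArg Hom.lin e.inv_hom_id
  have := h.1
  have := h.2
  exact ⟨Module.Finite.of_surjective (Hom.lin e.hom)
    (fun x => ⟨Hom.lin e.inv x, LinearMap.congr_fun h1 x⟩),
    Module.Projective.of_split (Hom.lin e.inv) (Hom.lin e.hom) h1⟩

lemma fgProj_biprod {M N : GrMod 𝒜} (hM : fgProj M) (hN : fgProj N) : fgProj (M ⊞ N) := by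
  have : fgProj (prod M N) := by
    have := hM.1
    have := hM.2
    have := hN.1
    have := hN.2
    exact ⟨inferInstanceAs (Module.Finite A (M.carrier × N.carrier)),
      inferInstanceAs (Module.Projective A (M.carrier × N.carrier))⟩
  exact fgProj_of_iso (biprod.uniqueUpToIso M N
    (isBinaryBilimitOfTotal (prodBicone M N) (prodBicone_total M N))) this

lemma fgProj_of_isZero {M : GrMod 𝒜} (h : IsZero M) : fgProj M := by
  have := (isZero_iff M).1 h
  exact ⟨inferInstance, inferInstance⟩

end GrMod

end GradedModules

/-! ### The tensor product of a bimodule and a module over `A` -/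

section Tensor

variable {A : Type u} [Ring A] [Algebra ℂ A] {𝒜 : ℤ → Submodule ℂ A}

namespace GrBimod

/-- The relations `b a ⊗ m = b ⊗ a m`. -/
def balancing (B : GrBimod 𝒜) (M : GrMod 𝒜) : Submodule A (B.carrier ⊗[ℂ] M.carrier) :=
  Submodule.span A {t | ∃ (b : B.carrier) (a : A) (m : M.carrier),
    t = (MulOpposite.op a • b) ⊗ₜ[ℂ] m - b ⊗ₜ[ℂ] (a • m)}

/-- The vector space underlying `B ⊗_A M`. -/
abbrev Tensor (B : GrBimod 𝒜) (M : GrMod 𝒜) : Type u :=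
  (B.carrier ⊗[ℂ] M.carrier) ⧸ B.balancing M

/-- The quotient map `B ⊗_ℂ M → B ⊗_A M`. -/
def toTensor (B : GrBimod 𝒜) (M : GrMod 𝒜) : B.carrier ⊗[ℂ] M.carrier →ₗ[A] B.Tensor M :=
  (B.balancing M).mkQ

lemma toTensor_surjective (B : GrBimod 𝒜) (M : GrMod 𝒜) :
    Function.Surjective (B.toTensor M) := Submodule.mkQ_surjective _

lemma toTensor_op_smul (B : GrBimod 𝒜) (M : GrMod 𝒜) (b : B.carrier) (a : A) (m : M.carrier) :
    B.toTensor M ((MulOpposite.op a • b) ⊗ₜ m) = B.toTensor M (b ⊗ₜ (a • m)) := by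
  rw [← sub_eq_zero, ← map_sub, toTensor, Submodule.mkQ_apply, Submodule.Quotient.mk_eq_zero]
  exact Submodule.subset_span ⟨b, a, m, rfl⟩

/-- Two `A`-linear maps out of `B ⊗_A M` agree when they agree on the `b ⊗ m`. -/
lemma tensor_hom_ext {B : GrBimod 𝒜} {M : GrMod 𝒜} {N : Type*} [AddCommGroup N] [Module A N]
    {f g : B.Tensor M →ₗ[A] N}
    (h : ∀ b m, f (B.toTensor M (b ⊗ₜ m)) = g (B.toTensor M (b ⊗ₜ m))) : f = g := by
  refine LinearMap.ext fun x => ?_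
  obtain ⟨t, rfl⟩ := B.toTensor_surjective M x
  induction t using TensorProduct.induction_on with
  | zero => simp
  | tmul b m => exact h b m
  | add x y hx hy => rw [map_add, map_add, map_add, hx, hy]

/-- The map out of `B ⊗_A M` induced by an `A`-balanced map. -/
def tensorLift {B : GrBimod 𝒜} {M : GrMod 𝒜} {N : Type*} [AddCommGroup N] [Module A N]
    (f : B.carrier ⊗[ℂ] M.carrier →ₗ[A] N)
    (hf : ∀ (b : B.carrier) (a : A) (m : M.carrier), f ((MulOpposite.op a • b) ⊗ₜ m) = f (b ⊗ₜ (a • m))) : B.Tensor M →ₗ[A] N :=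
  (B.balancing M).liftQ f <| Submodule.span_le.2 <| by
    rintro _ ⟨b, a, m, rfl⟩
    simp [hf b a m]

@[simp]
lemma tensorLift_toTensor {B : GrBimod 𝒜} {M : GrMod 𝒜} {N : Type*} [AddCommGroup N] [Module A N]
    (f : B.carrier ⊗[ℂ] M.carrier →ₗ[A] N)
    (hf : ∀ (b : B.carrier) (a : A) (m : M.carrier), f ((MulOpposite.op a • b) ⊗ₜ m) = f (b ⊗ₜ (a • m)))
    (t : B.carrier ⊗[ℂ] M.carrier) : tensorLift f hf (B.toTensor M t) = f t := rfl

lemma tensorProj_smul (B : GrBimod 𝒜) (M : GrMod 𝒜) {k : ℤ} {a : A} (ha : a ∈ 𝒜 k) (n : ℤ)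
    (t : B.carrier ⊗[ℂ] M.carrier) :
    tensorProj B.isInternal M.isInternal n (a • t) =
      a • tensorProj B.isInternal M.isInternal (n - k) t := by
  induction t using TensorProduct.induction_on with
  | zero => simp
  | add x y hx hy => rw [smul_add, map_add, map_add, smul_add, hx, hy]
  | tmul b m =>
    have hb : b ∈ ⨆ k, B.gr k := by rw [iSup_eq_top_of_isInternal B.isInternal]; trivial
    induction hb using Submodule.iSup_induction' with
    | zero => simp
    | add x y _ _ hx hy =>
      rw [TensorProduct.add_tmul, smul_add, map_add, map_add, smul_add, hx, hy]
    | mem l b hb =>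
      rw [TensorProduct.smul_tmul', tensorProj_tmul _ _ _ (B.smul_mem ha hb),
        tensorProj_tmul _ _ _ hb, TensorProduct.smul_tmul', sub_sub]

lemma proj_smul (M : GrMod 𝒜) {k : ℤ} {a : A} (ha : a ∈ 𝒜 k) (n : ℤ) (m : M.carrier) :
    proj M.gr M.isInternal n (a • m) = a • proj M.gr M.isInternal (n - k) m := by
  have hm : m ∈ ⨆ k, M.gr k := by rw [iSup_eq_top_of_isInternal M.isInternal]; trivial
  induction hm using Submodule.iSup_induction' with
  | zero => simp
  | add x y _ _ hx hy => rw [smul_add, map_add, map_add, smul_add, hx, hy]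
  | mem l m hm =>
    rw [proj_of_mem _ _ (M.smul_mem ha hm), proj_of_mem _ _ hm]
    by_cases h : n = k + l
    · rw [if_pos h, if_pos (by omega)]
    · rw [if_neg h, if_neg (by omega), smul_zero]

lemma toTensor_tensorProj [GradedAlgebra 𝒜] (B : GrBimod 𝒜) (M : GrMod 𝒜) (n : ℤ)
    (t : B.carrier ⊗[ℂ] M.carrier) (ht : B.toTensor M t = 0) :
    B.toTensor M (tensorProj B.isInternal M.isInternal n t) = 0 := by
  have hA : ∀ a : A, a ∈ ⨆ k, 𝒜 k := fun a => by
    rw [iSup_eq_top_of_isInternal (DirectSum.Decomposition.isInternal 𝒜)]; trivial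
  have ht' : t ∈ B.balancing M := by
    rwa [toTensor, Submodule.mkQ_apply, Submodule.Quotient.mk_eq_zero] at ht
  clear ht
  unfold balancing at ht'
  induction ht' using Submodule.span_induction generalizing n with
  | zero => simp
  | add x y _ _ hx hy => rw [map_add, map_add, hx, hy, add_zero]
  | smul a t _ hx =>
    induction hA a using Submodule.iSup_induction' with
    | zero => simp
    | add x y _ _ hx hy => rw [add_smul, map_add, map_add, hx, hy, add_zero]
    | mem k a ha => rw [tensorProj_smul B M ha, map_smul, hx, smul_zero]
  | mem t ht =>
    obtain ⟨b, a, m, rfl⟩ := ht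
    rw [map_sub, map_sub, sub_eq_zero]
    have hb : b ∈ ⨆ k, B.gr k := by rw [iSup_eq_top_of_isInternal B.isInternal]; trivial
    induction hb using Submodule.iSup_induction' with
    | zero => simp
    | add x y _ _ hx hy =>
      rw [smul_add, TensorProduct.add_tmul, map_add, map_add, hx, hy, TensorProduct.add_tmul,
        map_add, map_add]
    | mem l b hb =>
      induction hA a using Submodule.iSup_induction' with
      | zero => simp
      | add x y _ _ hx hy =>
        rw [MulOpposite.op_add, add_smul, TensorProduct.add_tmul, map_add, map_add, hx, hy,
          add_smul, TensorProduct.tmul_add, map_add, map_add]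
      | mem k a ha =>
        rw [tensorProj_tmul _ _ _ (B.op_smul_mem hb ha), tensorProj_tmul _ _ _ hb,
          proj_smul M ha, toTensor_op_smul, sub_sub]

/-- The graded module `B ⊗_A M`. Its part of degree `n` is spanned by the `b ⊗ m` with
`deg b + deg m = n`. -/
abbrev tensorObj [GradedAlgebra 𝒜] (B : GrBimod 𝒜) (M : GrMod 𝒜) : GrMod 𝒜 where
  carrier := B.Tensor M
  gr := tensorGr B.gr M.gr ((B.toTensor M).restrictScalars ℂ)
  isInternal := isInternal_tensorGr B.isInternal M.isInternal _ (B.toTensor_surjective M)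
    (B.toTensor_tensorProj M)
  smul_mem := by
    intro k l a x ha hx
    unfold tensorGr at hx
    induction hx using Submodule.span_induction with
    | zero => rw [smul_zero]; exact Submodule.zero_mem _
    | add x y _ _ hx hy => rw [smul_add]; exact Submodule.add_mem _ hx hy
    | smul c x _ hx => rw [smul_comm]; exact Submodule.smul_mem _ c hx
    | mem x hx =>
      obtain ⟨i, j, rfl, b, hb, m, hm, rfl⟩ := hx
      exact Submodule.subset_span ⟨k + i, j, by ring, a • b, B.smul_mem ha hb, m, hm, rfl⟩

/-- A map of graded bimodules (of degree zero). -/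
@[ext]
structure Hom (B B' : GrBimod 𝒜) where
  lin : B.carrier →ₗ[A] B'.carrier
  map_op_smul : ∀ (a : A) (b : B.carrier), lin (MulOpposite.op a • b) = MulOpposite.op a • lin b
  map_mem : ∀ k, ∀ b ∈ B.gr k, lin b ∈ B'.gr k

/-- The linear map `φ ⊗ f : B ⊗_A M → B' ⊗_A M'`. -/
def tensorMapLin {B B' : GrBimod 𝒜} {M M' : GrMod 𝒜} (φ : Hom B B') (f : M ⟶ M') :
    B.Tensor M →ₗ[A] B'.Tensor M' :=
  tensorLift (B'.toTensor M' ∘ₗ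
    TensorProduct.AlgebraTensorModule.map φ.lin ((GrMod.Hom.lin f).restrictScalars ℂ))
    fun b a m => by simp [φ.map_op_smul, toTensor_op_smul]

@[simp]
lemma tensorMapLin_tmul {B B' : GrBimod 𝒜} {M M' : GrMod 𝒜} (φ : Hom B B') (f : M ⟶ M')
    (b : B.carrier) (m : M.carrier) : tensorMapLin φ f (B.toTensor M (b ⊗ₜ m)) =
      B'.toTensor M' (φ.lin b ⊗ₜ GrMod.Hom.lin f m) := rfl

variable [GradedAlgebra 𝒜]

/-- The morphism of graded modules `φ ⊗ f : B ⊗_A M → B' ⊗_A M'`. -/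
def tensorMap {B B' : GrBimod 𝒜} {M M' : GrMod 𝒜} (φ : Hom B B') (f : M ⟶ M') :
    B.tensorObj M ⟶ B'.tensorObj M' :=
  GrMod.ofLin (M := B.tensorObj M) (N := B'.tensorObj M') (tensorMapLin φ f) fun k x hx => by
    change x ∈ tensorGr _ _ _ _ at hx
    change tensorMapLin φ f x ∈ tensorGr _ _ _ _
    unfold tensorGr at hx
    induction hx using Submodule.span_induction with
    | zero => rw [map_zero]; exact Submodule.zero_mem _
    | add x y _ _ hx hy => rw [map_add]; exact Submodule.add_mem _ hx hy
    | smul c x _ hx =>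
      rw [LinearMap.map_smul_of_tower]; exact Submodule.smul_mem _ c hx
    | mem x hx =>
      obtain ⟨i, j, rfl, b, hb, m, hm, rfl⟩ := hx
      exact Submodule.subset_span ⟨i, j, rfl, φ.lin b, φ.map_mem i b hb, GrMod.Hom.lin f m,
        GrMod.Hom.map_mem f hm, rfl⟩

@[simp] lemma lin_tensorMap {B B' : GrBimod 𝒜} {M M' : GrMod 𝒜} (φ : Hom B B') (f : M ⟶ M') :
    GrMod.Hom.lin (tensorMap φ f) = tensorMapLin φ f := rfl

/-- The identity of a bimodule. -/
def Hom.id (B : GrBimod 𝒜) : Hom B B := ⟨LinearMap.id, fun _ _ => rfl, fun _ _ hb => hb⟩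

/-- The functor `B ⊗_A -` on graded modules. -/
def tensor (B : GrBimod 𝒜) : GrMod 𝒜 ⥤ GrMod 𝒜 where
  obj M := B.tensorObj M
  map f := tensorMap (Hom.id B) f
  map_id M := GrMod.hom_ext <|
    tensor_hom_ext (f := tensorMapLin (Hom.id B) (𝟙 M)) (g := LinearMap.id) fun _ _ => rfl
  map_comp f g := GrMod.hom_ext <|
    tensor_hom_ext (f := tensorMapLin (Hom.id B) (f ≫ g))
      (g := tensorMapLin (Hom.id B) g ∘ₗ tensorMapLin (Hom.id B) f) fun _ _ => rfl

instance (B : GrBimod 𝒜) : B.tensor.Additive where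
  map_add {M N f g} := GrMod.hom_ext <|
    tensor_hom_ext (f := tensorMapLin (Hom.id B) (f + g))
      (g := tensorMapLin (Hom.id B) f + tensorMapLin (Hom.id B) g) fun b m => by
        simp [TensorProduct.tmul_add]

/-- The natural transformation `B ⊗_A - → B' ⊗_A -` induced by a map of graded bimodules. -/
def tensorNat {B B' : GrBimod 𝒜} (φ : Hom B B') : B.tensor ⟶ B'.tensor where
  app M := tensorMap φ (𝟙 M)
  naturality M N f := GrMod.hom_ext <|
    tensor_hom_ext (f := tensorMapLin φ (𝟙 N) ∘ₗ tensorMapLin (Hom.id B) f)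
      (g := tensorMapLin (Hom.id B') f ∘ₗ tensorMapLin φ (𝟙 M)) fun _ _ => rfl

/-- The bimodule `B⟨n⟩`, with `B⟨n⟩ₖ = Bₖ₋ₙ`. -/
abbrev shift (n : ℤ) (B : GrBimod 𝒜) : GrBimod 𝒜 where
  carrier := B.carrier
  gr := fun k => B.gr (k - n)
  isInternal := isInternal_reindex B.isInternal n
  smul_mem := fun ha hm => by
    rw [add_sub_assoc]
    exact B.smul_mem ha hm
  op_smul_mem := fun hm ha => by
    rw [add_sub_right_comm]
    exact B.op_smul_mem hm ha

/-- The regular bimodule `A`. -/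
abbrev regular (𝒜 : ℤ → Submodule ℂ A) [GradedAlgebra 𝒜] : GrBimod 𝒜 where
  carrier := A
  gr := 𝒜
  isInternal := DirectSum.Decomposition.isInternal 𝒜
  smul_mem := fun ha hm => SetLike.mul_mem_graded ha hm
  op_smul_mem := fun hm ha => SetLike.mul_mem_graded hm ha

/-- If `B` is finitely generated and projective as a left module, then `B ⊗_A -` preserves finitely
generated projective modules. -/
lemma fgProj_tensor (B : GrBimod 𝒜) [Module.Finite A B.carrier] [Module.Projective A B.carrier]
    {M : GrMod 𝒜} (hM : GrMod.fgProj M) : GrMod.fgProj (B.tensor.obj M) := by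
  have := hM.1
  have := hM.2
  obtain ⟨n, p, s, -, -, hps⟩ := Module.Finite.exists_comp_eq_id_of_projective A M.carrier
  have hps' : ∀ m, p (s m) = m := fun m => LinearMap.congr_fun hps m
  let q : (Fin n → B.carrier) →ₗ[A] B.Tensor M := ∑ i : Fin n,
    (B.toTensor M ∘ₗ (TensorProduct.AlgebraTensorModule.mk ℂ A B.carrier M.carrier).flip
      (p (Pi.single i 1))) ∘ₗ LinearMap.proj i
  let r : B.Tensor M →ₗ[A] (Fin n → B.carrier) := tensorLift
    (TensorProduct.AlgebraTensorModule.lift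
      { toFun := fun b =>
          { toFun := fun m i => MulOpposite.op (s m i) • b
            map_add' := fun m m' => by
              funext i
              simp [add_smul]
            map_smul' := fun c m => by
              funext i
              have : s (c • m) = c • s m := LinearMap.map_smul_of_tower s c m
              simp [this, smul_assoc] }
        map_add' := fun b b' => by
          ext m i
          simp
        map_smul' := fun a b => by
          ext m i
          exact (smul_comm a (MulOpposite.op (s m i)) b).symm }) fun b a m => by
            funext i
            simp [mul_smul]
  have hqr : q ∘ₗ r = LinearMap.id := tensor_hom_ext fun b m => by
    have h1 : r (B.toTensor M (b ⊗ₜ m)) = fun i => MulOpposite.op (s m i) • b := rfl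
    have h2 : m = ∑ i, s m i • p (Pi.single i 1) := by
      conv_lhs => rw [← hps' m, pi_eq_sum_univ' (s m)]
      simp [map_sum]
    rw [LinearMap.comp_apply, h1, LinearMap.id_apply]
    conv_rhs => rw [h2]
    simp [q, toTensor_op_smul, TensorProduct.tmul_sum]
  have h3 : Module.Finite A (B.Tensor M) :=
    Module.Finite.of_surjective q fun x => ⟨r x, LinearMap.congr_fun hqr x⟩
  have : Module.Projective A (Fin n → B.carrier) :=
    Module.Projective.of_equiv (DirectSum.linearEquivFunOnFintype A (Fin n) fun _ => B.carrier)
  have h4 : Module.Projective A (B.Tensor M) := Module.Projective.of_split r q hqr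
  exact ⟨h3, h4⟩

end GrBimod

end Tensor

/-! ### Cones of natural transformations on the homotopy category -/

section Cones

open CochainComplex CochainComplex.HomComplex

variable {C : Type*} [Category C] [Preadditive C] [HasBinaryBiproducts C]
  {F G : C ⥤ C} [F.Additive] [G.Additive] (η : F ⟶ G)

/-- The functor on complexes sending `X` to the total complex of `F(X) → G(X)`, where `G(X)` is
placed in degree `0` and `F(X)` in degree `-1`, that is, to the mapping cone. -/
noncomputable def coneComplex : CochainComplex C ℤ ⥤ CochainComplex C ℤ where
  obj X := mappingCone ((NatTrans.mapHomologicalComplex η (ComplexShape.up ℤ)).app X)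
  map f := mappingCone.map _ _ ((F.mapHomologicalComplex _).map f)
    ((G.mapHomologicalComplex _).map f)
    ((NatTrans.mapHomologicalComplex η (ComplexShape.up ℤ)).naturality f).symm
  map_id X := by
    simp only [CategoryTheory.Functor.map_id]
    exact mappingCone.map_id _
  map_comp f g := by
    simp only [CategoryTheory.Functor.map_comp]
    exact mappingCone.map_comp _ _ _ _ _ _ _ _ _

/-- Compatible homotopies induce a homotopy between maps of mapping cones. -/
noncomputable def coneMapHomotopy {K₁ L₁ K₂ L₂ : CochainComplex C ℤ} {φ₁ : K₁ ⟶ L₁} {φ₂ : K₂ ⟶ L₂}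
    {a a' : K₁ ⟶ K₂} {b b' : L₁ ⟶ L₂} (comm : φ₁ ≫ b = a ≫ φ₂) (comm' : φ₁ ≫ b' = a' ≫ φ₂)
    (α : Cochain K₁ K₂ (-1)) (hα : Cochain.ofHom a = δ (-1) 0 α + Cochain.ofHom a')
    (β : Cochain L₁ L₂ (-1)) (hβ : Cochain.ofHom b = δ (-1) 0 β + Cochain.ofHom b')
    (h : (Cochain.ofHom φ₁).comp β (zero_add (-1)) = α.comp (Cochain.ofHom φ₂) (add_zero (-1))) :
    Homotopy (mappingCone.map φ₁ φ₂ a b comm) (mappingCone.map φ₁ φ₂ a' b' comm') := by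
  refine mappingCone.descHomotopy _ _ _
    (-(α.comp (mappingCone.inl φ₂) (by omega)))
    (β.comp (Cochain.ofHom (mappingCone.inr φ₂)) (add_zero _)) ?_ ?_
  · rw [δ_neg, δ_comp α (mappingCone.inl φ₂) (by omega) 0 0 (-1) (by omega) (by omega) (by omega),
      mappingCone.δ_inl]
    have hα' : δ (-1) 0 α = Cochain.ofHom a - Cochain.ofHom a' := by rw [hα, add_sub_cancel_right]
    have h1 : (Cochain.ofHom φ₁).comp (β.comp (Cochain.ofHom (mappingCone.inr φ₂)) (add_zero _))
        (zero_add (-1)) = α.comp (Cochain.ofHom (φ₂ ≫ mappingCone.inr φ₂)) (add_zero (-1)) := by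
      rw [← Cochain.comp_assoc_of_third_is_zero_cochain, h, Cochain.ofHom_comp,
        Cochain.comp_assoc_of_third_is_zero_cochain]
    rw [h1, hα']
    simp [mappingCone.map, Cochain.sub_comp]
  · simp [mappingCone.map, hβ, Cochain.ofHom_comp, Cochain.add_comp]

/-- The functor `coneComplex η` preserves homotopies. -/
noncomputable def coneComplexHomotopy {X Y : CochainComplex C ℤ} {f g : X ⟶ Y}
    (h : Homotopy f g) : Homotopy ((coneComplex η).map f) ((coneComplex η).map g) :=
  coneMapHomotopy ((NatTrans.mapHomologicalComplex η (ComplexShape.up ℤ)).naturality f).symm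
    ((NatTrans.mapHomologicalComplex η (ComplexShape.up ℤ)).naturality g).symm
    (Cochain.equivHomotopy _ _ (F.mapHomotopy h)).1 (Cochain.equivHomotopy _ _ (F.mapHomotopy h)).2
    (Cochain.equivHomotopy _ _ (G.mapHomotopy h)).1 (Cochain.equivHomotopy _ _ (G.mapHomotopy h)).2
    (by
      ext p q hpq
      rw [Cochain.zero_cochain_comp_v, Cochain.comp_zero_cochain_v, Cochain.ofHom_v, Cochain.ofHom_v]
      exact (η.naturality (h.hom p q)).symm)

/-- The functor on the homotopy category induced by `coneComplex η`. -/
noncomputable def coneFunctor :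
    HomotopyCategory C (ComplexShape.up ℤ) ⥤ HomotopyCategory C (ComplexShape.up ℤ) :=
  CategoryTheory.Quotient.lift _ (coneComplex η ⋙ HomotopyCategory.quotient _ _)
    fun _ _ _ _ ⟨h⟩ => HomotopyCategory.eq_of_homotopy _ _ (coneComplexHomotopy η h)

end Cones

/-! ### The Grothendieck group of a triangulated category -/

section K0

open Pretriangulated ZeroObject

variable (C : Type*) [Category C] [HasZeroObject C] [HasShift C ℤ] [Preadditive C]
  [∀ n : ℤ, (CategoryTheory.shiftFunctor C n).Additive] [Pretriangulated C]

/-- The relations `[Y] = [X] + [Z]`, for every distinguished triangle `X → Y → Z → X[1]`. -/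
def k0Relations : AddSubgroup (FreeAbelianGroup C) :=
  AddSubgroup.closure {x | ∃ T ∈ distTriang C, x = FreeAbelianGroup.of T.obj₂ -
    FreeAbelianGroup.of T.obj₁ - FreeAbelianGroup.of T.obj₃}

/-- The Grothendieck group of a triangulated category. -/
def K0 : Type _ := FreeAbelianGroup C ⧸ k0Relations C

instance : AddCommGroup (K0 C) := inferInstanceAs (AddCommGroup (_ ⧸ k0Relations C))

variable {C}

/-- The class of an object in the Grothendieck group. -/
def K0.of (X : C) : K0 C := QuotientAddGroup.mk (FreeAbelianGroup.of X)

lemma K0.of_triangle (T : Triangle C) (hT : T ∈ distTriang C) :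
    K0.of T.obj₂ = K0.of T.obj₁ + K0.of T.obj₃ := by
  rw [← sub_eq_zero, ← sub_sub]
  exact (QuotientAddGroup.eq_zero_iff _).2 (AddSubgroup.subset_closure ⟨T, hT, rfl⟩)

lemma K0.hom_ext {B : Type*} [AddCommGroup B] {f g : K0 C →+ B}
    (h : ∀ X : C, f (K0.of X) = g (K0.of X)) : f = g :=
  QuotientAddGroup.addMonoidHom_ext _ (FreeAbelianGroup.lift_ext _ _ h)

/-- Additive functions on objects extend to the Grothendieck group. -/
def K0.lift {B : Type*} [AddCommGroup B] (f : C → B)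
    (hf : ∀ T ∈ distTriang C, f T.obj₂ = f T.obj₁ + f T.obj₃) : K0 C →+ B :=
  QuotientAddGroup.lift _ (FreeAbelianGroup.lift f) <| (AddSubgroup.closure_le _).2 <| by
    rintro _ ⟨T, hT, rfl⟩
    simp [hf T hT]

@[simp]
lemma K0.lift_of {B : Type*} [AddCommGroup B] (f : C → B)
    (hf : ∀ T ∈ distTriang C, f T.obj₂ = f T.obj₁ + f T.obj₃) (X : C) :
    K0.lift f hf (K0.of X) = f X :=
  FreeAbelianGroup.lift_apply_of _ _

lemma K0.of_iso {X Y : C} (e : X ≅ Y) : K0.of X = K0.of Y := by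
  have h0 : K0.of (0 : C) = 0 := by
    have := K0.of_triangle _ (contractible_distinguished (0 : C))
    simpa using this
  have := K0.of_triangle (Triangle.mk e.hom (0 : Y ⟶ 0) 0)
    (isomorphic_distinguished _ (contractible_distinguished X) _
      (Triangle.isoMk _ _ (Iso.refl _) e.symm (Iso.refl _) 
        (e.hom_inv_id.trans (Category.comp_id _).symm) (zero_comp.trans comp_zero.symm)
        (zero_comp.trans comp_zero.symm)))
  simpa [h0] using this.symm

/-- A triangulated functor acts on the Grothendieck groups. -/
def K0.map (F : C ⥤ C) [F.CommShift ℤ] [F.IsTriangulated] : K0 C →+ K0 C :=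
  K0.lift (fun X => K0.of (F.obj X)) fun T hT => K0.of_triangle _ (F.map_distinguished T hT)

lemma K0.map_of (F : C ⥤ C) [F.CommShift ℤ] [F.IsTriangulated] (X : C) :
    K0.map F (K0.of X) = K0.of (F.obj X) := K0.lift_of _ _ _

end K0

/-! ### Bounded complexes of finitely generated projective graded modules -/

section Perfect

open ZeroObject

variable {A : Type u} [Ring A] [Algebra ℂ A] (𝒜 : ℤ → Submodule ℂ A)

/-- Bounded complexes of finitely generated projective graded modules. -/
def boundedProjComplexes : ObjectProperty (CochainComplex (GrMod 𝒜) ℤ) :=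
  fun X => (∃ a b : ℤ, ∀ n, n < a ∨ b < n → IsZero (X.X n)) ∧ ∀ n, GrMod.fgProj (X.X n)

/-- The same property for objects of the homotopy category. -/
def boundedProj : ObjectProperty (HomotopyCategory (GrMod 𝒜) (ComplexShape.up ℤ)) :=
  fun X => boundedProjComplexes 𝒜 X.as

variable {𝒜}

lemma boundedProjComplexes_shift {X : CochainComplex (GrMod 𝒜) ℤ}
    (h : boundedProjComplexes 𝒜 X) (n : ℤ) :
    boundedProjComplexes 𝒜 ((CategoryTheory.shiftFunctor _ n).obj X) := by
  obtain ⟨⟨a, b, hab⟩, hX⟩ := h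
  exact ⟨⟨a - n, b - n, fun k hk => hab (k + n) (by omega)⟩, fun k => hX (k + n)⟩

lemma boundedProjComplexes_mappingCone {X Y : CochainComplex (GrMod 𝒜) ℤ} (f : X ⟶ Y)
    (hX : boundedProjComplexes 𝒜 X) (hY : boundedProjComplexes 𝒜 Y) :
    boundedProjComplexes 𝒜 (CochainComplex.mappingCone f) := by
  obtain ⟨⟨a, b, hab⟩, hX⟩ := hX
  obtain ⟨⟨c, d, hcd⟩, hY⟩ := hY
  refine ⟨⟨min (a - 1) c, max b d, fun n hn => ?_⟩, fun n => ?_⟩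
  · rw [CochainComplex.mappingCone.isZero_X_iff]
    exact ⟨hab _ (by omega), hcd _ (by omega)⟩
  · exact GrMod.fgProj_of_iso (HomologicalComplex.homotopyCofiber.XIsoBiprod f n (n + 1) rfl).symm
      (GrMod.fgProj_biprod (hX _) (hY _))

lemma boundedProj_iff (X : CochainComplex (GrMod 𝒜) ℤ) :
    boundedProj 𝒜 ((HomotopyCategory.quotient _ _).obj X) ↔ boundedProjComplexes 𝒜 X := Iff.rfl

instance : (boundedProj 𝒜).ContainsZero where
  exists_zero := ⟨(HomotopyCategory.quotient _ _).obj 0,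
    Functor.map_isZero _ (isZero_zero _),
    ⟨0, 0, fun n _ => (HomologicalComplex.eval _ _ n).map_isZero (isZero_zero _)⟩,
    fun n => GrMod.fgProj_of_isZero ((HomologicalComplex.eval _ _ n).map_isZero (isZero_zero _))⟩

instance : (boundedProj 𝒜).IsStableUnderShift ℤ where
  isStableUnderShiftBy n :=
    { le_shift := fun X hX => by
        obtain ⟨X, rfl⟩ := X.quotient_obj_surjective
        rw [ObjectProperty.prop_shift_iff, HomotopyCategory.shift_quotient_obj]
        exact boundedProjComplexes_shift hX n }

instance : (boundedProj 𝒜).IsTriangulatedClosed₃ where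
  ext₃' T hT h₁ h₂ := by
    obtain ⟨f : T.obj₁.as ⟶ T.obj₂.as, hf⟩ :=
      (HomotopyCategory.quotient _ _).map_surjective T.mor₁
    refine ⟨_, ?_,
      ⟨Pretriangulated.Triangle.π₃.mapIso (Pretriangulated.isoTriangleOfIso₁₂ T _ hT
        (HomotopyCategory.mappingCone_triangleh_distinguished f)
        (Iso.refl _) (Iso.refl _) ?_)⟩⟩
    · exact boundedProjComplexes_mappingCone f h₁ h₂
    · exact (Category.comp_id _).trans (hf.symm.trans (Category.id_comp _).symm)

instance : (boundedProj 𝒜).IsTriangulated where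
  toIsTriangulatedClosed₂ := .of_isTriangulatedClosed₃

variable (𝒜) in
/-- The homotopy category of bounded complexes of finitely generated projective graded left
modules; it is a full triangulated subcategory of the homotopy category of graded modules. -/
abbrev ProjHomotopyCategory := (boundedProj 𝒜).FullSubcategory

/-- A finitely generated projective graded module, seen as a complex concentrated in degree zero. -/
noncomputable def ProjHomotopyCategory.single (M : GrMod 𝒜) (hM : GrMod.fgProj M) :
    ProjHomotopyCategory 𝒜 where
  obj := (HomotopyCategory.quotient _ _).obj
    ((HomologicalComplex.single (GrMod 𝒜) (ComplexShape.up ℤ) 0).obj M)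
  property := by
    have h0 : ∀ n : ℤ, n ≠ 0 →
        IsZero (((HomologicalComplex.single (GrMod 𝒜) (ComplexShape.up ℤ) 0).obj M).X n) :=
      fun n hn => HomologicalComplex.isZero_single_obj_X _ _ _ _ hn
    refine ⟨⟨0, 0, fun n hn => h0 n (by omega)⟩, fun n => ?_⟩
    by_cases hn : n = 0
    · subst hn
      exact GrMod.fgProj_of_iso (HomologicalComplex.singleObjXSelf _ _ _).symm hM
    · exact GrMod.fgProj_of_isZero (h0 n hn)

/-- The functor `X ↦ X⟨n⟩` on complexes. -/
noncomputable def gradingShift (n : ℤ) : ProjHomotopyCategory 𝒜 ⥤ ProjHomotopyCategory 𝒜 :=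
  (boundedProj 𝒜).lift
    ((boundedProj 𝒜).ι ⋙ (GrMod.shiftFunctor n).mapHomotopyCategory (ComplexShape.up ℤ))
    fun X => by
      obtain ⟨⟨a, b, hab⟩, hX⟩ := X.property
      exact ⟨⟨a, b, fun k hk => (GrMod.shiftFunctor n).map_isZero (hab k hk)⟩, fun k => hX k⟩

noncomputable instance (n : ℤ) : (gradingShift (𝒜 := 𝒜) n).CommShift ℤ := by
  unfold gradingShift; infer_instance

instance (n : ℤ) : (gradingShift (𝒜 := 𝒜) n).IsTriangulated := by
  unfold gradingShift; infer_instance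

section TwoTerm

variable [GradedAlgebra 𝒜] {B B' : GrBimod 𝒜} (φ : GrBimod.Hom B B')
  [Module.Finite A B.carrier] [Module.Projective A B.carrier]
  [Module.Finite A B'.carrier] [Module.Projective A B'.carrier]

lemma boundedProj_cone {X : HomotopyCategory (GrMod 𝒜) (ComplexShape.up ℤ)}
    (hX : boundedProj 𝒜 X) : boundedProj 𝒜 ((coneFunctor (GrBimod.tensorNat φ)).obj X) := by
  obtain ⟨⟨a, b, hab⟩, hX⟩ := hX
  exact boundedProjComplexes_mappingCone _
    ⟨⟨a, b, fun k hk => B.tensor.map_isZero (hab k hk)⟩, fun k => B.fgProj_tensor (hX k)⟩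
    ⟨⟨a, b, fun k hk => B'.tensor.map_isZero (hab k hk)⟩, fun k => B'.fgProj_tensor (hX k)⟩

/-- Tensor product over `A` with the complex of bimodules `B → B'`, where `B'` is placed in
homological degree `0`: the total complex of `B ⊗_A X → B' ⊗_A X` is the mapping cone. -/
noncomputable def tensorComplexRight : ProjHomotopyCategory 𝒜 ⥤ ProjHomotopyCategory 𝒜 :=
  (boundedProj 𝒜).lift ((boundedProj 𝒜).ι ⋙ coneFunctor (GrBimod.tensorNat φ))
    fun X => boundedProj_cone φ X.property

/-- Tensor product over `A` with the complex of bimodules `B → B'`, where `B` is placed in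
homological degree `0`: the mapping cone is shifted by one. -/
noncomputable def tensorComplexLeft : ProjHomotopyCategory 𝒜 ⥤ ProjHomotopyCategory 𝒜 :=
  tensorComplexRight φ ⋙ CategoryTheory.shiftFunctor (ProjHomotopyCategory 𝒜) (-1 : ℤ)

end TwoTerm

end Perfect

/-! ### The action of `ℤ[T;T⁻¹]` on the Grothendieck group -/

section LaurentAction

variable {A : Type u} [Ring A] [Algebra ℂ A] {𝒜 : ℤ → Submodule ℂ A}

/-- `M⟨0⟩ ≅ M`. -/
def GrMod.shiftZeroIso : GrMod.shiftFunctor (𝒜 := 𝒜) 0 ≅ 𝟭 (GrMod 𝒜) :=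
  NatIso.ofComponents (fun M =>
    { hom := GrMod.ofLin (M := GrMod.shift 0 M) (N := M) LinearMap.id
        fun k m hm => (congrArg (fun j => m ∈ M.gr j) (sub_zero k)).mp hm
      inv := GrMod.ofLin (M := M) (N := GrMod.shift 0 M) LinearMap.id
        fun k m hm => (congrArg (fun j => m ∈ M.gr j) (sub_zero k)).mpr hm
      hom_inv_id := GrMod.hom_ext (LinearMap.ext fun _ => rfl)
      inv_hom_id := GrMod.hom_ext (LinearMap.ext fun _ => rfl) })
    fun _ => GrMod.hom_ext (LinearMap.ext fun _ => rfl)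

/-- `M⟨n⟩⟨m⟩ ≅ M⟨m + n⟩`. -/
def GrMod.shiftAddIso (m n : ℤ) : GrMod.shiftFunctor (𝒜 := 𝒜) (m + n) ≅
    GrMod.shiftFunctor n ⋙ GrMod.shiftFunctor m :=
  NatIso.ofComponents (fun M =>
    { hom := GrMod.ofLin (M := GrMod.shift (m + n) M) (N := GrMod.shift m (GrMod.shift n M))
        LinearMap.id fun k x hx => (congrArg (fun j => x ∈ M.gr j) (sub_sub k m n)).mpr hx
      inv := GrMod.ofLin (M := GrMod.shift m (GrMod.shift n M)) (N := GrMod.shift (m + n) M)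
        LinearMap.id fun k x hx => (congrArg (fun j => x ∈ M.gr j) (sub_sub k m n)).mp hx
      hom_inv_id := GrMod.hom_ext (LinearMap.ext fun _ => rfl)
      inv_hom_id := GrMod.hom_ext (LinearMap.ext fun _ => rfl) })
    fun _ => GrMod.hom_ext (LinearMap.ext fun _ => rfl)

lemma k0_gradingShift_zero (X : ProjHomotopyCategory 𝒜) :
    K0.of ((gradingShift 0).obj X) = K0.of X :=
  K0.of_iso ((boundedProj 𝒜).fullyFaithfulι.preimageIso ((HomotopyCategory.quotient _ _).mapIso
    ((NatIso.mapHomologicalComplex GrMod.shiftZeroIso (ComplexShape.up ℤ)).app X.obj.as ≪≫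
      (Functor.mapHomologicalComplexIdIso (GrMod 𝒜) (ComplexShape.up ℤ)).app X.obj.as)))

lemma k0_gradingShift_add (m n : ℤ) (X : ProjHomotopyCategory 𝒜) :
    K0.of ((gradingShift (m + n)).obj X) = K0.of ((gradingShift m).obj ((gradingShift n).obj X)) :=
  K0.of_iso ((boundedProj 𝒜).fullyFaithfulι.preimageIso ((HomotopyCategory.quotient _ _).mapIso
    ((NatIso.mapHomologicalComplex (GrMod.shiftAddIso m n) (ComplexShape.up ℤ)).app X.obj.as)))

/-- The action of `ℤ` on the Grothendieck group by `n · [X] = [X⟨n⟩]`. -/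
noncomputable def k0Shift :
    Multiplicative ℤ →* AddMonoid.End (K0 (ProjHomotopyCategory 𝒜)) where
  toFun n := K0.map (gradingShift n.toAdd)
  map_one' := K0.hom_ext fun X => k0_gradingShift_zero X
  map_mul' m n := K0.hom_ext fun X => k0_gradingShift_add m.toAdd n.toAdd X

/-- The Grothendieck group is a module over `ℤ[T;T⁻¹]`, with `Tⁿ • [X] = [X⟨n⟩]`. -/
noncomputable instance : Module ℤ[T;T⁻¹] (K0 (ProjHomotopyCategory 𝒜)) :=
  Module.compHom _ (AddMonoidAlgebra.lift ℤ (AddMonoid.End (K0 (ProjHomotopyCategory 𝒜))) ℤ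
    k0Shift).toRingHom

lemma T_smul_of (n : ℤ) (X : ProjHomotopyCategory 𝒜) :
    (LaurentPolynomial.T n : ℤ[T;T⁻¹]) • K0.of X = K0.of ((gradingShift n).obj X) := by
  change (AddMonoidAlgebra.lift ℤ (AddMonoid.End (K0 (ProjHomotopyCategory 𝒜))) ℤ
    k0Shift) (LaurentPolynomial.T n) (K0.of X) = _
  rw [LaurentPolynomial.T, AddMonoidAlgebra.lift_single, one_smul]
  exact K0.map_of (gradingShift n) X

end LaurentAction

/-! ### The zig-zag algebra -/

section ZigZagAlgebra

variable {V : Type u} (Γ : SimpleGraph V)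

/-- The generators of the path algebra of the double quiver of `Γ`: the constant paths at the
vertices, and one arrow `i → j` for every ordered pair of adjacent vertices. -/
inductive QuiverGen : Type u
  | vertex (i : V) : QuiverGen
  | arrow (i j : V) (h : Γ.Adj i j) : QuiverGen

variable [Fintype V]

open QuiverGen FreeAlgebra in
/-- The relations of the zig-zag algebra. The first five are those of the path algebra, where the
product of paths is concatenation; the last three say that `i → j → k` vanishes for `i ≠ k`, that
all the loops `i → j → i` agree, and that paths of length three vanish. The last relation follows
from the other ones except on a connected component with exactly two vertices. -/
inductive ZigZagRel : FreeAlgebra ℂ (QuiverGen Γ) → FreeAlgebra ℂ (QuiverGen Γ) → Prop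
  | vertex_mul_self (i : V) : ZigZagRel (ι ℂ (vertex i) * ι ℂ (vertex i)) (ι ℂ (vertex i))
  | vertex_mul_vertex (i j : V) (hij : i ≠ j) : ZigZagRel (ι ℂ (vertex i) * ι ℂ (vertex j)) 0
  | sum_vertex : ZigZagRel (∑ i : V, ι ℂ (vertex i)) 1
  | vertex_mul_arrow (i j : V) (h : Γ.Adj i j) :
      ZigZagRel (ι ℂ (vertex i) * ι ℂ (arrow i j h)) (ι ℂ (arrow i j h))
  | arrow_mul_vertex (i j : V) (h : Γ.Adj i j) :
      ZigZagRel (ι ℂ (arrow i j h) * ι ℂ (vertex j)) (ι ℂ (arrow i j h))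
  | straight (i j k : V) (h : Γ.Adj i j) (h' : Γ.Adj j k) (hik : i ≠ k) :
      ZigZagRel (ι ℂ (arrow i j h) * ι ℂ (arrow j k h')) 0
  | loop (i j k : V) (h : Γ.Adj i j) (h' : Γ.Adj i k) :
      ZigZagRel (ι ℂ (arrow i j h) * ι ℂ (arrow j i h.symm))
        (ι ℂ (arrow i k h') * ι ℂ (arrow k i h'.symm))
  | length_three (i j k l : V) (h : Γ.Adj i j) (h' : Γ.Adj j k) (h'' : Γ.Adj k l) :
      ZigZagRel (ι ℂ (arrow i j h) * ι ℂ (arrow j k h') * ι ℂ (arrow k l h'')) 0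

/-- The zig-zag algebra `A_Γ`. -/
def ZigZag : Type u := RingQuot (ZigZagRel Γ)

noncomputable instance : Ring (ZigZag Γ) := inferInstanceAs (Ring (RingQuot (ZigZagRel Γ)))

noncomputable instance : Algebra ℂ (ZigZag Γ) :=
  inferInstanceAs (Algebra ℂ (RingQuot (ZigZagRel Γ)))

namespace ZigZag

/-- The quotient map. -/
noncomputable def mk : FreeAlgebra ℂ (QuiverGen Γ) →ₐ[ℂ] ZigZag Γ :=
  RingQuot.mkAlgHom ℂ (ZigZagRel Γ)

/-- The idempotent `eᵢ`, that is, the constant path at `i`. -/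
noncomputable def e (i : V) : ZigZag Γ := mk Γ (FreeAlgebra.ι ℂ (QuiverGen.vertex i))

/-- The path `(i|j)` of length one. -/
noncomputable def a (i j : V) (h : Γ.Adj i j) : ZigZag Γ :=
  mk Γ (FreeAlgebra.ι ℂ (QuiverGen.arrow i j h))

open Classical in
/-- The loop `xᵢ = (i|j)(j|i)` at `i`, for any neighbour `j` of `i`. -/
noncomputable def x (i : V) : ZigZag Γ :=
  if h : ∃ j, Γ.Adj i j then a Γ i h.choose h.choose_spec * a Γ h.choose i h.choose_spec.symm else 0

lemma mk_rel {p q : FreeAlgebra ℂ (QuiverGen Γ)} (h : ZigZagRel Γ p q) : mk Γ p = mk Γ q :=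
  RingQuot.mkAlgHom_rel ℂ h

lemma e_mul_self (i : V) : e Γ i * e Γ i = e Γ i := by
  simpa [e] using mk_rel Γ (.vertex_mul_self i)

lemma e_mul_e {i j : V} (h : i ≠ j) : e Γ i * e Γ j = 0 := by
  simpa [e] using mk_rel Γ (.vertex_mul_vertex i j h)

lemma sum_e : ∑ i, e Γ i = 1 := by
  simpa [e] using mk_rel Γ .sum_vertex

lemma e_mul_a (i j : V) (h : Γ.Adj i j) : e Γ i * a Γ i j h = a Γ i j h := by
  simpa [e, a] using mk_rel Γ (.vertex_mul_arrow i j h)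

lemma a_mul_e (i j : V) (h : Γ.Adj i j) : a Γ i j h * e Γ j = a Γ i j h := by
  simpa [e, a] using mk_rel Γ (.arrow_mul_vertex i j h)

lemma e_mul_a_of_ne {i j k : V} (h : Γ.Adj i j) (hk : k ≠ i) : e Γ k * a Γ i j h = 0 := by
  rw [← e_mul_a, ← mul_assoc, e_mul_e Γ hk, zero_mul]

lemma a_mul_e_of_ne {i j k : V} (h : Γ.Adj i j) (hk : j ≠ k) : a Γ i j h * e Γ k = 0 := by
  rw [← a_mul_e, mul_assoc, e_mul_e Γ hk, mul_zero]

lemma a_mul_a_of_ne {i j k l : V} (h : Γ.Adj i j) (h' : Γ.Adj k l) (hjk : j ≠ k) :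
    a Γ i j h * a Γ k l h' = 0 := by
  rw [← a_mul_e, mul_assoc, e_mul_a_of_ne Γ h' hjk, mul_zero]

lemma a_mul_a_of_ne' {i j k : V} (h : Γ.Adj i j) (h' : Γ.Adj j k) (hik : i ≠ k) :
    a Γ i j h * a Γ j k h' = 0 := by
  simpa [a] using mk_rel Γ (.straight i j k h h' hik)

lemma a_mul_a (i j : V) (h : Γ.Adj i j) : a Γ i j h * a Γ j i h.symm = x Γ i := by
  have hex : ∃ j, Γ.Adj i j := ⟨j, h⟩
  rw [x, dif_pos hex]
  simpa [a] using mk_rel Γ (.loop i j _ h hex.choose_spec)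

lemma a_mul_a_mul_a {i j k l m n : V} (h : Γ.Adj i j) (h' : Γ.Adj k l) (h'' : Γ.Adj m n) :
    a Γ i j h * a Γ k l h' * a Γ m n h'' = 0 := by
  by_cases hjk : j = k
  · subst hjk
    by_cases hlm : l = m
    · subst hlm
      simpa [a] using mk_rel Γ (.length_three i j l n h h' h'')
    · rw [mul_assoc, a_mul_a_of_ne Γ h' h'' hlm, mul_zero]
  · rw [a_mul_a_of_ne Γ h h' hjk, zero_mul]

lemma a_mul_x {i j k : V} (h : Γ.Adj i j) : a Γ i j h * x Γ k = 0 := by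
  unfold x
  split_ifs with hk
  · rw [← mul_assoc, a_mul_a_mul_a]
  · rw [mul_zero]

lemma x_mul_a {i j k : V} (h : Γ.Adj i j) : x Γ k * a Γ i j h = 0 := by
  unfold x
  split_ifs with hk
  · rw [a_mul_a_mul_a]
  · rw [zero_mul]

lemma e_mul_x (i : V) : e Γ i * x Γ i = x Γ i := by
  unfold x
  split_ifs with hi
  · rw [← mul_assoc, e_mul_a]
  · rw [mul_zero]

lemma x_mul_e (i : V) : x Γ i * e Γ i = x Γ i := by
  unfold x
  split_ifs with hi
  · rw [mul_assoc, a_mul_e]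
  · rw [zero_mul]

variable {Γ} in
lemma induction {P : ZigZag Γ → Prop} (he : ∀ i, P (e Γ i)) (ha : ∀ i j h, P (a Γ i j h))
    (hc : ∀ c : ℂ, P (algebraMap ℂ _ c)) (hadd : ∀ y z, P y → P z → P (y + z))
    (hmul : ∀ y z, P y → P z → P (y * z)) (y : ZigZag Γ) : P y := by
  obtain ⟨y, rfl⟩ := RingQuot.mkAlgHom_surjective ℂ (ZigZagRel Γ) y
  change P (mk Γ y)
  induction y using FreeAlgebra.induction with
  | grade0 c => rw [AlgHom.commutes]; exact hc c
  | grade1 g => cases g with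
    | vertex i => exact he i
    | arrow i j h => exact ha i j h
  | mul y z hy hz => rw [map_mul]; exact hmul _ _ hy hz
  | add y z hy hz => rw [map_add]; exact hadd _ _ hy hz

/-! The grading by path length. -/

/-- The paths of length `n` (and zero, for sequences of arrows that do not compose). -/
noncomputable def paths : ℕ → Set (ZigZag Γ)
  | 0 => Set.range (e Γ)
  | n + 1 => {y | ∃ (i j : V) (h : Γ.Adj i j), ∃ p ∈ paths n, y = a Γ i j h * p}

/-- The part of degree `k` of the zig-zag algebra is spanned by the paths of length `k`. -/
noncomputable def grading (k : ℤ) : Submodule ℂ (ZigZag Γ) :=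
  Submodule.span ℂ {y | ∃ n : ℕ, (n : ℤ) = k ∧ y ∈ paths Γ n}

variable {Γ}

lemma e_mem (i : V) : e Γ i ∈ grading Γ 0 := Submodule.subset_span ⟨0, rfl, i, rfl⟩

lemma a_mem (i j : V) (h : Γ.Adj i j) : a Γ i j h ∈ grading Γ 1 :=
  Submodule.subset_span ⟨1, rfl, i, j, h, e Γ j, ⟨j, rfl⟩, (a_mul_e Γ i j h).symm⟩

lemma paths_mul {m n : ℕ} {p q : ZigZag Γ} (hp : p ∈ paths Γ m) (hq : q ∈ paths Γ n) :
    p * q ∈ paths Γ (m + n) ∨ p * q = 0 := by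
  induction m generalizing p with
  | zero =>
    obtain ⟨i, rfl⟩ := hp
    rw [zero_add]
    cases n with
    | zero =>
      obtain ⟨j, rfl⟩ := hq
      by_cases hij : i = j
      · subst hij
        exact .inl ⟨i, (e_mul_self Γ i).symm⟩
      · exact .inr (e_mul_e Γ hij)
    | succ n =>
      obtain ⟨j, k, h, q, hq, rfl⟩ := hq
      by_cases hij : i = j
      · subst hij
        exact .inl ⟨i, k, h, q, hq, by rw [← mul_assoc, e_mul_a]⟩
      · exact .inr (by rw [← mul_assoc, e_mul_a_of_ne Γ h hij, zero_mul])
  | succ m ih =>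
    obtain ⟨i, j, h, p, hp, rfl⟩ := hp
    rw [mul_assoc, Nat.succ_add]
    rcases ih hp with h' | h'
    · exact .inl ⟨i, j, h, p * q, h', rfl⟩
    · exact .inr (by rw [h', mul_zero])

instance : SetLike.GradedMonoid (grading Γ) where
  one_mem := by
    rw [← sum_e]
    exact Submodule.sum_mem _ fun i _ => e_mem i
  mul_mem := by
    intro k l y z hy hz
    have : grading Γ k * grading Γ l ≤ grading Γ (k + l) := by
      unfold grading
      rw [Submodule.span_mul_span]
      refine Submodule.span_le.2 ?_
      rintro _ ⟨p, ⟨m, rfl, hp⟩, q, ⟨n, rfl, hq⟩, rfl⟩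
      rcases paths_mul hp hq with h | h
      · exact Submodule.subset_span ⟨m + n, by push_cast; rfl, h⟩
      · change p * q ∈ _
        rw [h]
        exact Submodule.zero_mem _
    exact this (Submodule.mul_mem_mul hy hz)

set_option linter.unusedSimpArgs false in
open QuiverGen in
/-- The homomorphism multiplying a path of length `n` by `Tⁿ`. -/
noncomputable def degreeHom : ZigZag Γ →ₐ[ℂ] AddMonoidAlgebra (ZigZag Γ) ℤ :=
  RingQuot.liftAlgHom ℂ ⟨FreeAlgebra.lift ℂ fun
    | vertex i => AddMonoidAlgebra.single 0 (e Γ i)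
    | arrow i j h => AddMonoidAlgebra.single 1 (a Γ i j h), by
      intro p q h
      cases h with
      | vertex_mul_self i =>
        simp only [map_mul, map_zero, FreeAlgebra.lift_ι_apply, AddMonoidAlgebra.single_mul_single,
          AddMonoidAlgebra.single_zero, zero_add, add_zero, e_mul_self]
      | vertex_mul_vertex i j h =>
        simp only [map_mul, map_zero, FreeAlgebra.lift_ι_apply, AddMonoidAlgebra.single_mul_single,
          AddMonoidAlgebra.single_zero, zero_add, add_zero, e_mul_e Γ h]
      | sum_vertex =>
        simp only [map_sum, FreeAlgebra.lift_ι_apply, map_one, AddMonoidAlgebra.one_def]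
        rw [← sum_e]
        exact (map_sum (AddMonoidAlgebra.singleAddHom (0 : ℤ)) _ _).symm
      | vertex_mul_arrow i j h =>
        simp only [map_mul, map_zero, FreeAlgebra.lift_ι_apply, AddMonoidAlgebra.single_mul_single,
          AddMonoidAlgebra.single_zero, zero_add, add_zero, e_mul_a]
      | arrow_mul_vertex i j h =>
        simp only [map_mul, map_zero, FreeAlgebra.lift_ι_apply, AddMonoidAlgebra.single_mul_single,
          AddMonoidAlgebra.single_zero, zero_add, add_zero, a_mul_e]
      | straight i j k h h' hik =>
        simp only [map_mul, map_zero, FreeAlgebra.lift_ι_apply, AddMonoidAlgebra.single_mul_single,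
          AddMonoidAlgebra.single_zero, zero_add, add_zero, a_mul_a_of_ne' Γ h h' hik]
      | loop i j k h h' =>
        simp only [map_mul, map_zero, FreeAlgebra.lift_ι_apply, AddMonoidAlgebra.single_mul_single,
          AddMonoidAlgebra.single_zero, zero_add, add_zero, a_mul_a]
      | length_three i j k l h h' h'' =>
        simp only [map_mul, map_zero, FreeAlgebra.lift_ι_apply, AddMonoidAlgebra.single_mul_single,
          AddMonoidAlgebra.single_zero, zero_add, add_zero, a_mul_a_mul_a]⟩

lemma degreeHom_e (i : V) : degreeHom (e Γ i) = AddMonoidAlgebra.single 0 (e Γ i) := by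
  rw [degreeHom, e, mk]
  exact (RingQuot.liftAlgHom_mkAlgHom_apply _ _ _ _).trans (FreeAlgebra.lift_ι_apply _ _)

lemma degreeHom_a (i j : V) (h : Γ.Adj i j) :
    degreeHom (a Γ i j h) = AddMonoidAlgebra.single 1 (a Γ i j h) := by
  rw [degreeHom, a, mk]
  exact (RingQuot.liftAlgHom_mkAlgHom_apply _ _ _ _).trans (FreeAlgebra.lift_ι_apply _ _)

lemma degreeHom_of_mem {k : ℤ} {y : ZigZag Γ} (hy : y ∈ grading Γ k) :
    degreeHom y = AddMonoidAlgebra.single k y := by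
  unfold grading at hy
  induction hy using Submodule.span_induction with
  | zero => simp
  | add y z _ _ hy hz => rw [map_add, hy, hz]; simp
  | smul c y _ hy => rw [map_smul, hy, AddMonoidAlgebra.smul_single]
  | mem y hy =>
    obtain ⟨n, rfl, hy⟩ := hy
    induction n generalizing y with
    | zero =>
      obtain ⟨i, rfl⟩ := hy
      exact degreeHom_e i
    | succ n ih =>
      obtain ⟨i, j, h, p, hp, rfl⟩ := hy
      rw [map_mul, degreeHom_a, ih p hp, AddMonoidAlgebra.single_mul_single]
      congr 1
      push_cast
      ring

lemma isInternal_grading : DirectSum.IsInternal (grading Γ) := by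
  refine isInternal_of_projections _
    (fun n => { toFun := fun y => (degreeHom y).coeff n, map_add' := fun y z => by simp,
                map_smul' := fun c y => by simp })
    (fun k y hy n => ?_) ?_
  · change (degreeHom y).coeff n = _
    rw [degreeHom_of_mem hy, AddMonoidAlgebra.coeff_single, Finsupp.single_apply]
    simp only [eq_comm]
  · rw [eq_top_iff]
    intro y hy0
    clear hy0
    have hmul : ∀ k, ∀ y ∈ grading Γ k, ∀ z ∈ ⨆ k, grading Γ k, y * z ∈ ⨆ k, grading Γ k := by
      intro k y hy z hz
      induction hz using Submodule.iSup_induction' with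
      | zero => simp
      | add z w _ _ hz hw => rw [mul_add]; exact Submodule.add_mem _ hz hw
      | mem l z hz => exact Submodule.mem_iSup_of_mem (k + l) (SetLike.mul_mem_graded hy hz)
    induction y using ZigZag.induction with
    | he i => exact Submodule.mem_iSup_of_mem 0 (e_mem i)
    | ha i j h => exact Submodule.mem_iSup_of_mem 1 (a_mem i j h)
    | hc c =>
      rw [Algebra.algebraMap_eq_smul_one]
      exact Submodule.smul_mem _ _ (Submodule.mem_iSup_of_mem 0 (SetLike.GradedOne.one_mem))
    | hadd y z hy hz => exact Submodule.add_mem _ hy hz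
    | hmul y z hy hz =>
      induction hy using Submodule.iSup_induction' with
      | zero => simp
      | add y w _ _ hy hw => rw [add_mul]; exact Submodule.add_mem _ hy hw
      | mem k y hy => exact hmul k y hy z hz

noncomputable instance : GradedAlgebra (grading Γ) where
  toDecomposition := isInternal_grading.chooseDecomposition

lemma paths_finite (n : ℕ) : (paths Γ n).Finite := by
  classical
  induction n with
  | zero => exact Set.finite_range _
  | succ n ih =>
    refine ((Set.finite_range fun ij : V × V => if h : Γ.Adj ij.1 ij.2 then a Γ ij.1 ij.2 h
      else 0).mul ih).subset ?_
    rintro _ ⟨i, j, h, p, hp, rfl⟩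
    exact Set.mul_mem_mul ⟨(i, j), dif_pos h⟩ hp

lemma paths_eq_zero {n : ℕ} {y : ZigZag Γ} (hy : y ∈ paths Γ (n + 3)) : y = 0 := by
  obtain ⟨i, j, h, _, ⟨k, l, h', _, ⟨m, o, h'', p, hp, rfl⟩, rfl⟩, rfl⟩ := hy
  rw [← mul_assoc, ← mul_assoc, a_mul_a_mul_a, zero_mul]

instance : Module.Finite ℂ (ZigZag Γ) := by
  refine ⟨Submodule.fg_def.2 ⟨paths Γ 0 ∪ paths Γ 1 ∪ paths Γ 2,
    ((paths_finite 0).union (paths_finite 1)).union (paths_finite 2), ?_⟩⟩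
  rw [eq_top_iff, ← iSup_eq_top_of_isInternal isInternal_grading]
  refine iSup_le fun k => Submodule.span_le.2 ?_
  rintro y ⟨n, -, hy⟩
  match n, hy with
  | 0, hy => exact Submodule.subset_span (.inl (.inl hy))
  | 1, hy => exact Submodule.subset_span (.inl (.inr hy))
  | 2, hy => exact Submodule.subset_span (.inr hy)
  | n + 3, hy => rw [paths_eq_zero hy]; exact Submodule.zero_mem _

end ZigZag

end ZigZagAlgebra

/-! ### The projective modules, the complexes `Σᵢ` and `Σᵢ⁻¹` and their action -/

section SphericalTwists

lemma exists_sum_proj {M : Type*} [AddCommGroup M] [Module ℂ M] {gr : ℤ → Submodule ℂ M}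
    (h : DirectSum.IsInternal gr) (m : M) :
    ∃ s : Finset ℤ, ∀ t, s ⊆ t → ∑ n ∈ t, proj gr h n m = m := by
  have hm : m ∈ ⨆ k, gr k := by rw [iSup_eq_top_of_isInternal h]; trivial
  induction hm using Submodule.iSup_induction' with
  | zero => exact ⟨∅, fun t _ => by simp⟩
  | mem k m hm => exact ⟨{k}, fun t ht => by
      simp only [proj_of_mem gr h hm, Finset.sum_ite_eq']
      rw [if_pos (ht (Finset.mem_singleton_self k))]⟩
  | add x y _ _ hx hy =>
    obtain ⟨s, hs⟩ := hx
    obtain ⟨s', hs'⟩ := hy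
    exact ⟨s ∪ s', fun t ht => by
      simp only [map_add, Finset.sum_add_distrib, hs t (Finset.union_subset_left ht),
        hs' t (Finset.union_subset_right ht)]⟩

lemma isInternal_comap {M N : Type*} [AddCommGroup M] [Module ℂ M] [AddCommGroup N] [Module ℂ N]
    {gr : ℤ → Submodule ℂ M} (h : DirectSum.IsInternal gr) (f : N →ₗ[ℂ] M)
    (hf : Function.Injective f) (hp : ∀ n y, ∃ z, f z = proj gr h n (f y)) :
    DirectSum.IsInternal fun k => (gr k).comap f := by
  have hex : ∀ n, ∃ d : N →ₗ[ℂ] N, ∀ y, f (d y) = proj gr h n (f y) := fun n => by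
    refine ⟨(LinearEquiv.ofInjective f hf).symm.toLinearMap ∘ₗ
      (proj gr h n ∘ₗ f).codRestrict (LinearMap.range f) fun y => hp n y, fun y => ?_⟩
    have := congrArg Subtype.val ((LinearEquiv.ofInjective f hf).apply_symm_apply
      ((proj gr h n ∘ₗ f).codRestrict (LinearMap.range f) (fun y => hp n y) y))
    exact this
  choose d hd using hex
  refine isInternal_of_projections _ d (fun k y hy n => hf ?_) ?_
  · rw [hd, proj_of_mem gr h hy]
    split_ifs <;> simp
  · rw [eq_top_iff]
    intro y _
    obtain ⟨s, hs⟩ := exists_sum_proj h (f y)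
    have : ∑ n ∈ s, d n y = y := hf (by rw [map_sum, ← hs s subset_rfl]; simp only [hd])
    rw [← this]
    refine Submodule.sum_mem _ fun n _ => Submodule.mem_iSup_of_mem n ?_
    rw [Submodule.mem_comap, hd]
    exact proj_mem gr h n _

variable {V : Type u} [Fintype V] (Γ : SimpleGraph V)

namespace ZigZag

/-- The left module `Pᵢ = A eᵢ`. -/
noncomputable abbrev P (i : V) : Submodule (ZigZag Γ) (ZigZag Γ) := Submodule.span _ {e Γ i}

/-- The right module `Qᵢ = eᵢ A`. -/
noncomputable abbrev Q (i : V) : Submodule (ZigZag Γ)ᵐᵒᵖ (ZigZag Γ) := Submodule.span _ {e Γ i}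

variable {Γ}

lemma mem_P {i : V} {y : ZigZag Γ} : y ∈ P Γ i ↔ y * e Γ i = y := by
  rw [Submodule.mem_span_singleton]
  constructor
  · rintro ⟨z, rfl⟩
    rw [smul_eq_mul, mul_assoc, e_mul_self]
  · intro h
    exact ⟨y, h⟩

lemma mem_Q {i : V} {y : ZigZag Γ} : y ∈ Q Γ i ↔ e Γ i * y = y := by
  rw [Submodule.mem_span_singleton]
  constructor
  · rintro ⟨z, rfl⟩
    rw [← MulOpposite.op_unop z, op_smul_eq_mul, ← mul_assoc, e_mul_self]
  · intro h
    exact ⟨MulOpposite.op y, h⟩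

lemma proj_mul_e (i : V) (n : ℤ) (y : ZigZag Γ) :
    proj (grading Γ) isInternal_grading n (y * e Γ i) =
      proj (grading Γ) isInternal_grading n y * e Γ i := by
  have hy : y ∈ ⨆ k, grading Γ k := by rw [iSup_eq_top_of_isInternal isInternal_grading]; trivial
  induction hy using Submodule.iSup_induction' with
  | zero => simp
  | add y z _ _ hy hz => rw [add_mul, map_add, map_add, add_mul, hy, hz]
  | mem k y hy =>
    have h := SetLike.mul_mem_graded hy (e_mem (Γ := Γ) i)
    rw [add_zero] at h
    rw [proj_of_mem _ _ h, proj_of_mem _ _ hy]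
    split_ifs <;> simp

lemma proj_e_mul (i : V) (n : ℤ) (y : ZigZag Γ) :
    proj (grading Γ) isInternal_grading n (e Γ i * y) =
      e Γ i * proj (grading Γ) isInternal_grading n y := by
  have hy : y ∈ ⨆ k, grading Γ k := by rw [iSup_eq_top_of_isInternal isInternal_grading]; trivial
  induction hy using Submodule.iSup_induction' with
  | zero => simp
  | add y z _ _ hy hz => rw [mul_add, map_add, map_add, mul_add, hy, hz]
  | mem k y hy =>
    have h := SetLike.mul_mem_graded (e_mem (Γ := Γ) i) hy
    rw [zero_add] at h
    rw [proj_of_mem _ _ h, proj_of_mem _ _ hy]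
    split_ifs <;> simp

variable (Γ)

/-- The grading of `Pᵢ` induced by that of `A`. -/
noncomputable def gradingP (i : V) (k : ℤ) : Submodule ℂ (P Γ i) :=
  (grading Γ k).comap ((P Γ i).subtype.restrictScalars ℂ)

/-- The grading of `Qᵢ` induced by that of `A`. -/
noncomputable def gradingQ (i : V) (k : ℤ) : Submodule ℂ (Q Γ i) :=
  (grading Γ k).comap ((Q Γ i).subtype.restrictScalars ℂ)

lemma isInternal_gradingP (i : V) : DirectSum.IsInternal (gradingP Γ i) :=
  isInternal_comap isInternal_grading ((P Γ i).subtype.restrictScalars ℂ) Subtype.val_injective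
    fun n y => ⟨⟨proj (grading Γ) isInternal_grading n y.1, mem_P.2 (by
      rw [← proj_mul_e, mem_P.1 y.2])⟩, rfl⟩

lemma isInternal_gradingQ (i : V) : DirectSum.IsInternal (gradingQ Γ i) :=
  isInternal_comap isInternal_grading ((Q Γ i).subtype.restrictScalars ℂ) Subtype.val_injective
    fun n y => ⟨⟨proj (grading Γ) isInternal_grading n y.1, mem_Q.2 (by
      rw [← proj_e_mul, mem_Q.1 y.2])⟩, rfl⟩

/-- `Pᵢ` as a graded module. -/
noncomputable abbrev projModule (i : V) : GrMod (grading Γ) where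
  carrier := P Γ i
  gr := gradingP Γ i
  isInternal := isInternal_gradingP Γ i
  smul_mem := fun ha hm => SetLike.mul_mem_graded ha hm

instance (i : V) : Module.Finite (ZigZag Γ) (P Γ i) :=
  Module.Finite.span_singleton _ _

instance (i : V) : Module.Projective (ZigZag Γ) (P Γ i) :=
  Module.Projective.of_split (P Γ i).subtype
    (LinearMap.toSpanSingleton (ZigZag Γ) (P Γ i) ⟨e Γ i, Submodule.mem_span_singleton_self _⟩)
    (LinearMap.ext fun y => Subtype.ext (mem_P.1 y.2))

instance (i : V) : Module.Finite ℂ (Q Γ i) :=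
  inferInstanceAs (Module.Finite ℂ ((Q Γ i).restrictScalars ℂ))

/-- The right action of `A` on `Pᵢ ⊗_ℂ Qᵢ`, through the second factor. -/
noncomputable instance rightModulePQ (i : V) : Module (ZigZag Γ)ᵐᵒᵖ (P Γ i ⊗[ℂ] Q Γ i) :=
  Module.compHom _ ((Module.End.lTensorAlgHom ℂ (Q Γ i) (P Γ i)).comp
    (Algebra.lsmul ℂ ℂ (Q Γ i) : (ZigZag Γ)ᵐᵒᵖ →ₐ[ℂ] Module.End ℂ (Q Γ i))).toRingHom

lemma op_smul_tmul (i : V) (y : ZigZag Γ) (p : P Γ i) (q : Q Γ i) :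
    MulOpposite.op y • (p ⊗ₜ[ℂ] q) = p ⊗ₜ[ℂ] (MulOpposite.op y • q) := rfl

instance (i : V) : IsScalarTower ℂ (ZigZag Γ)ᵐᵒᵖ (P Γ i ⊗[ℂ] Q Γ i) :=
  ⟨fun c y t => by
    induction t using TensorProduct.induction_on with
    | zero => simp
    | add s t hs ht => rw [smul_add, hs, ht, smul_add, smul_add]
    | tmul p q =>
      obtain ⟨y, rfl⟩ := MulOpposite.op_surjective y
      rw [← MulOpposite.op_smul, op_smul_tmul, op_smul_tmul, MulOpposite.op_smul, smul_assoc,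
        TensorProduct.tmul_smul]⟩

instance (i : V) : SMulCommClass (ZigZag Γ) (ZigZag Γ)ᵐᵒᵖ (P Γ i ⊗[ℂ] Q Γ i) :=
  ⟨fun y z t => by
    induction t using TensorProduct.induction_on with
    | zero => simp
    | add s t hs ht => simp only [smul_add, hs, ht]
    | tmul p q =>
      obtain ⟨z, rfl⟩ := MulOpposite.op_surjective z
      rw [op_smul_tmul, TensorProduct.smul_tmul', TensorProduct.smul_tmul', op_smul_tmul]⟩

/-- The graded bimodule `Pᵢ ⊗_ℂ Qᵢ`. -/
noncomputable abbrev PQ (i : V) : GrBimod (grading Γ) :=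
  { carrier := P Γ i ⊗[ℂ] Q Γ i
    gr := tensorGr (gradingP Γ i) (gradingQ Γ i) LinearMap.id
    isInternal := isInternal_tensorGr (isInternal_gradingP Γ i) (isInternal_gradingQ Γ i) _
      Function.surjective_id fun n t ht => by
        rw [LinearMap.id_apply] at ht
        rw [ht, map_zero, map_zero]
    smul_mem := by
      intro k l y t hy ht
      unfold tensorGr at ht
      induction ht using Submodule.span_induction with
      | zero => rw [smul_zero]; exact Submodule.zero_mem _
      | add s t _ _ hs ht => rw [smul_add]; exact Submodule.add_mem _ hs ht
      | smul c t _ ht => rw [smul_comm]; exact Submodule.smul_mem _ c ht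
      | mem t ht =>
        obtain ⟨m, n, rfl, p, hp, q, hq, rfl⟩ := ht
        exact Submodule.subset_span ⟨k + m, n, by ring, y • p,
          SetLike.mul_mem_graded hy hp, q, hq, rfl⟩
    op_smul_mem := by
      intro k l y t ht hy
      unfold tensorGr at ht
      induction ht using Submodule.span_induction with
      | zero => rw [smul_zero]; exact Submodule.zero_mem _
      | add s t _ _ hs ht => rw [smul_add]; exact Submodule.add_mem _ hs ht
      | smul c t _ ht =>
        have : MulOpposite.op y • c • t = c • MulOpposite.op y • t :=
          ((Module.End.lTensorAlgHom ℂ (Q Γ i) (P Γ i)) (Algebra.lsmul ℂ ℂ (Q Γ i)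
            (MulOpposite.op y))).map_smul c t
        rw [this]; exact Submodule.smul_mem _ c ht
      | mem t ht =>
        obtain ⟨m, n, rfl, p, hp, q, hq, rfl⟩ := ht
        exact Submodule.subset_span ⟨m, n + l, by ring, p, hp, MulOpposite.op y • q,
          SetLike.mul_mem_graded (show q.1 ∈ grading Γ n from hq) hy, rfl⟩ }

instance (i : V) : Module.Finite (ZigZag Γ) (PQ Γ i).carrier :=
  Module.Finite.of_surjective (TensorProduct.AlgebraTensorModule.map
    (LinearMap.toSpanSingleton (ZigZag Γ) (P Γ i) ⟨e Γ i, Submodule.mem_span_singleton_self _⟩)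
    (LinearMap.id : Q Γ i →ₗ[ℂ] Q Γ i))
    (TensorProduct.map_surjective (g := (LinearMap.toSpanSingleton (ZigZag Γ) (P Γ i)
      ⟨e Γ i, Submodule.mem_span_singleton_self _⟩).restrictScalars ℂ)
      (fun y => ⟨y.1, Subtype.ext (mem_P.1 y.2)⟩) Function.surjective_id)

instance (i : V) : Module.Projective (ZigZag Γ) (PQ Γ i).carrier :=
  inferInstanceAs (Module.Projective (ZigZag Γ) (P Γ i ⊗[ℂ] Q Γ i))

/-- The map `f : Pᵢ ⊗_ℂ Qᵢ → A`, `p ⊗ q ↦ p q`; it is the bimodule map with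
`f(eᵢ ⊗ eᵢ) = eᵢ`. -/
noncomputable def f (i : V) : GrBimod.Hom (PQ Γ i) (GrBimod.regular (grading Γ)) where
  lin := TensorProduct.AlgebraTensorModule.lift
    { toFun := fun p =>
        { toFun := fun q => p.1 * q.1
          map_add' := fun q q' => mul_add _ _ _
          map_smul' := fun c q => mul_smul_comm c p.1 q.1 }
      map_add' := fun p p' => LinearMap.ext fun q => add_mul _ _ _
      map_smul' := fun y p => LinearMap.ext fun q => mul_assoc _ _ _ }
  map_op_smul y t := by
    induction t using TensorProduct.induction_on with
    | zero => simp
    | add s t hs ht => simp only [smul_add, map_add, hs, ht]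
    | tmul p q => exact (mul_assoc p.1 q.1 y).symm
  map_mem k t ht := by
    change t ∈ tensorGr _ _ _ _ at ht
    unfold tensorGr at ht
    induction ht using Submodule.span_induction with
    | zero => rw [map_zero]; exact Submodule.zero_mem _
    | add s t _ _ hs ht => rw [map_add]; exact Submodule.add_mem _ hs ht
    | smul c t _ ht => rw [LinearMap.map_smul_of_tower]; exact Submodule.smul_mem _ c ht
    | mem t ht =>
      obtain ⟨m, n, rfl, p, hp, q, hq, rfl⟩ := ht
      exact SetLike.mul_mem_graded hp hq

lemma e_mem_P (i : V) : e Γ i ∈ P Γ i := mem_P.2 (e_mul_self Γ i)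

lemma e_mem_Q (i : V) : e Γ i ∈ Q Γ i := mem_Q.2 (e_mul_self Γ i)

lemma x_mem_P (i : V) : x Γ i ∈ P Γ i := mem_P.2 (x_mul_e Γ i)

lemma x_mem_Q (i : V) : x Γ i ∈ Q Γ i := mem_Q.2 (e_mul_x Γ i)

lemma a_mem_P (i j : V) (h : Γ.Adj j i) : a Γ j i h ∈ P Γ i := mem_P.2 (a_mul_e Γ j i h)

lemma a_mem_Q (i j : V) (h : Γ.Adj i j) : a Γ i j h ∈ Q Γ i := mem_Q.2 (e_mul_a Γ i j h)

variable {Γ} in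
/-- The element `p ⊗ q` of `Pᵢ ⊗_ℂ Qᵢ`. -/
noncomputable def tmul {i : V} (p q : ZigZag Γ) (hp : p ∈ P Γ i) (hq : q ∈ Q Γ i) :
    (PQ Γ i).carrier :=
  (⟨p, hp⟩ : P Γ i) ⊗ₜ[ℂ] (⟨q, hq⟩ : Q Γ i)

open Classical in
/-- The element `xᵢ ⊗ eᵢ + ∑ⱼ (j|i) ⊗ (i|j) + eᵢ ⊗ xᵢ` of `Pᵢ ⊗_ℂ Qᵢ`, where `j` runs over the
neighbours of `i`. -/
noncomputable def casimir (i : V) : (PQ Γ i).carrier :=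
  tmul (x Γ i) (e Γ i) (x_mem_P Γ i) (e_mem_Q Γ i) +
    ∑ j : V, (if h : Γ.Adj i j then
      tmul (a Γ j i h.symm) (a Γ i j h) (a_mem_P Γ i j h.symm) (a_mem_Q Γ i j h) else 0) +
    tmul (e Γ i) (x Γ i) (e_mem_P Γ i) (x_mem_Q Γ i)

variable {Γ}

lemma smul_tmul {i : V} (y p q : ZigZag Γ) (hp : p ∈ P Γ i) (hq : q ∈ Q Γ i) :
    y • tmul p q hp hq = tmul (y * p) q ((P Γ i).smul_mem y hp) hq := rfl

lemma op_smul_tmul' {i : V} (y p q : ZigZag Γ) (hp : p ∈ P Γ i) (hq : q ∈ Q Γ i) :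
    MulOpposite.op y • tmul p q hp hq =
      tmul p (q * y) hp ((Q Γ i).smul_mem (MulOpposite.op y) hq) := rfl

lemma tmul_congr {i : V} {p q p' q' : ZigZag Γ} (hp : p ∈ P Γ i) (hq : q ∈ Q Γ i) (h : p = p')
    (h' : q = q') : tmul p q hp hq = tmul p' q' (h ▸ hp) (h' ▸ hq) := by
  subst h h'; rfl

lemma tmul_zero_left {i : V} {p q : ZigZag Γ} (hp : p ∈ P Γ i) (hq : q ∈ Q Γ i) (h : p = 0) :
    tmul p q hp hq = 0 := by
  subst h
  exact TensorProduct.zero_tmul _ _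

lemma tmul_zero_right {i : V} {p q : ZigZag Γ} (hp : p ∈ P Γ i) (hq : q ∈ Q Γ i) (h : q = 0) :
    tmul p q hp hq = 0 := by
  subst h
  exact TensorProduct.tmul_zero _ _

lemma op_smul_add' {i : V} (y : ZigZag Γ) (s t : (PQ Γ i).carrier) :
    MulOpposite.op y • (s + t) = MulOpposite.op y • s + MulOpposite.op y • t := smul_add _ _ _

lemma e_mul_x_of_ne {i k : V} (h : k ≠ i) : e Γ k * x Γ i = 0 := by
  rw [← e_mul_x, ← mul_assoc, e_mul_e Γ h, zero_mul]

lemma x_mul_e_of_ne {i k : V} (h : i ≠ k) : x Γ i * e Γ k = 0 := by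
  rw [← x_mul_e, mul_assoc, e_mul_e Γ h, mul_zero]

lemma smul_casimir (i : V) (y : ZigZag Γ) :
    y • casimir Γ i = MulOpposite.op y • casimir Γ i := by
  classical
  induction y using ZigZag.induction with
  | he k =>
    simp only [casimir, smul_add, Finset.smul_sum]
    congr 1
    · congr 1
      · rw [smul_tmul, op_smul_tmul']
        by_cases h : k = i
        · subst h
          exact tmul_congr _ _ (e_mul_x Γ k) (e_mul_self Γ k).symm
        · rw [tmul_zero_left _ _ (e_mul_x_of_ne h),
            tmul_zero_right _ _ (e_mul_e Γ (Ne.symm h))]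
      · refine Finset.sum_congr rfl fun j _ => ?_
        by_cases hj : Γ.Adj i j
        · rw [dif_pos hj, smul_tmul, op_smul_tmul']
          by_cases h : k = j
          · subst h
            exact tmul_congr _ _ (e_mul_a Γ _ _ _) (a_mul_e Γ _ _ _).symm
          · rw [tmul_zero_left _ _ (e_mul_a_of_ne Γ _ h),
              tmul_zero_right _ _ (a_mul_e_of_ne Γ _ (Ne.symm h))]
        · rw [dif_neg hj, smul_zero, smul_zero]
    · rw [smul_tmul, op_smul_tmul']
      by_cases h : k = i
      · subst h
        exact tmul_congr _ _ (e_mul_self Γ k) (x_mul_e Γ k).symm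
      · rw [tmul_zero_left _ _ (e_mul_e Γ h),
          tmul_zero_right _ _ (x_mul_e_of_ne (Ne.symm h))]
  | ha k l hkl =>
    have h1 : a Γ k l hkl • tmul (x Γ i) (e Γ i) (x_mem_P Γ i) (e_mem_Q Γ i) = 0 := by
      rw [smul_tmul]
      exact tmul_zero_left _ _ (a_mul_x Γ _)
    have h2 : MulOpposite.op (a Γ k l hkl) • tmul (e Γ i) (x Γ i) (e_mem_P Γ i) (x_mem_Q Γ i) =
        0 := by
      rw [op_smul_tmul']
      exact tmul_zero_right _ _ (x_mul_a Γ _)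
    simp only [casimir, smul_add, Finset.smul_sum, h1, h2, zero_add, add_zero]
    rw [add_comm]
    have h3 : ∀ j, a Γ k l hkl • (if h : Γ.Adj i j then
        tmul (a Γ j i h.symm) (a Γ i j h) (a_mem_P Γ i j h.symm) (a_mem_Q Γ i j h) else 0) =
        if j = l then MulOpposite.op (a Γ k l hkl) •
          tmul (x Γ i) (e Γ i) (x_mem_P Γ i) (e_mem_Q Γ i) else 0 := by
      intro j
      by_cases hj : j = l
      · subst hj
        rw [if_pos rfl]
        split_ifs with h
        · rw [smul_tmul, op_smul_tmul']
          by_cases hk : k = i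
          · subst hk
            exact tmul_congr _ _ (a_mul_a Γ _ _ _) (e_mul_a Γ _ _ _).symm
          · rw [tmul_zero_left _ _ (a_mul_a_of_ne' Γ _ _ hk),
              tmul_zero_right _ _ (e_mul_a_of_ne Γ _ (Ne.symm hk))]
        · rw [smul_zero, op_smul_tmul']
          have hk : i ≠ k := fun hk => h (hk ▸ hkl)
          rw [tmul_zero_right _ _ (e_mul_a_of_ne Γ _ hk)]
      · rw [if_neg hj]
        split_ifs with h
        · rw [smul_tmul, tmul_zero_left _ _ (a_mul_a_of_ne Γ _ _ (Ne.symm hj))]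
        · rw [smul_zero]
    have h4 : ∀ j, MulOpposite.op (a Γ k l hkl) • (if h : Γ.Adj i j then
        tmul (a Γ j i h.symm) (a Γ i j h) (a_mem_P Γ i j h.symm) (a_mem_Q Γ i j h) else 0) =
        if j = k then a Γ k l hkl •
          tmul (e Γ i) (x Γ i) (e_mem_P Γ i) (x_mem_Q Γ i) else 0 := by
      intro j
      by_cases hj : j = k
      · subst hj
        rw [if_pos rfl]
        split_ifs with h
        · rw [smul_tmul, op_smul_tmul']
          by_cases hl : i = l
          · subst hl
            exact tmul_congr _ _ (a_mul_e Γ _ _ _).symm (a_mul_a Γ _ _ _)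
          · rw [tmul_zero_right _ _ (a_mul_a_of_ne' Γ _ _ hl),
              tmul_zero_left _ _ (a_mul_e_of_ne Γ _ (Ne.symm hl))]
        · rw [smul_zero, smul_tmul]
          have hl : l ≠ i := fun hl => h (hl ▸ hkl.symm)
          rw [tmul_zero_left _ _ (a_mul_e_of_ne Γ _ hl)]
      · rw [if_neg hj]
        split_ifs with h
        · rw [op_smul_tmul', tmul_zero_right _ _ (a_mul_a_of_ne Γ _ _ hj)]
        · rw [smul_zero]
    simp only [h3, h4, Finset.sum_ite_eq', Finset.mem_univ, if_true]
    rw [add_comm]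
  | hc c =>
    rw [Algebra.algebraMap_eq_smul_one, MulOpposite.op_smul, smul_assoc, smul_assoc, one_smul,
      MulOpposite.op_one, one_smul]
  | hadd y z hy hz => rw [add_smul, hy, hz, MulOpposite.op_add, add_smul]
  | hmul y z hy hz =>
    rw [mul_smul, hz, smul_comm, hy, MulOpposite.op_mul, mul_smul]

lemma x_mem (i : V) : x Γ i ∈ grading Γ 2 := by
  unfold x
  split_ifs with h
  · have h2 : a Γ i h.choose h.choose_spec * a Γ h.choose i h.choose_spec.symm ∈
        grading Γ (1 + 1) := SetLike.mul_mem_graded (a_mem _ _ _) (a_mem _ _ _)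
    rwa [one_add_one_eq_two] at h2
  · exact (grading Γ 2).zero_mem

lemma casimir_mem (i : V) : casimir Γ i ∈ (PQ Γ i).gr 2 := by
  have key : ∀ (m n : ℤ) (p q : ZigZag Γ) (hp : p ∈ P Γ i) (hq : q ∈ Q Γ i), m + n = 2 →
      p ∈ grading Γ m → q ∈ grading Γ n → tmul p q hp hq ∈ (PQ Γ i).gr 2 :=
    fun m n p q hp hq h hm hn => Submodule.subset_span ⟨m, n, h, ⟨p, hp⟩, hm, ⟨q, hq⟩, hn, rfl⟩
  unfold casimir
  refine ((PQ Γ i).gr 2).add_mem (((PQ Γ i).gr 2).add_mem ?_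
    (((PQ Γ i).gr 2).sum_mem fun j _ => ?_)) ?_
  · exact key 2 0 _ _ _ _ (by norm_num) (x_mem i) (e_mem i)
  · split_ifs with h
    · exact key 1 1 _ _ _ _ (by norm_num) (a_mem _ _ _) (a_mem _ _ _)
    · exact ((PQ Γ i).gr 2).zero_mem
  · exact key 0 2 _ _ _ _ (by norm_num) (e_mem i) (x_mem i)

variable (Γ)

/-- The map `g : A → Pᵢ ⊗_ℂ Qᵢ⟨-2⟩` of bimodules with
`g(1) = xᵢ ⊗ eᵢ + ∑ⱼ (j|i) ⊗ (i|j) + eᵢ ⊗ xᵢ`. -/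
noncomputable def g (i : V) :
    GrBimod.Hom (GrBimod.regular (grading Γ)) (GrBimod.shift (-2) (PQ Γ i)) where
  lin := LinearMap.toSpanSingleton (ZigZag Γ) (PQ Γ i).carrier (casimir Γ i)
  map_op_smul y z := by
    change (z * y) • casimir Γ i = MulOpposite.op y • z • casimir Γ i
    rw [mul_smul, smul_casimir, smul_comm]
  map_mem k y hy := by
    change y • casimir Γ i ∈ (PQ Γ i).gr (k - -2)
    rw [sub_neg_eq_add]
    exact (PQ Γ i).smul_mem hy (casimir_mem i)

/-- The category `C_Γ`, the homotopy category of bounded complexes of finitely generated projective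
graded left `A_Γ`-modules. -/
abbrev Cat : Type _ := ProjHomotopyCategory (grading Γ)

/-- `Pᵢ` as an object of `C_Γ`, concentrated in homological degree zero. -/
noncomputable def projObj (i : V) : Cat Γ :=
  ProjHomotopyCategory.single (projModule Γ i) ⟨inferInstance, inferInstance⟩

/-- The functor `Σᵢ ⊗_A -`, where `Σᵢ` is the complex of bimodules `f : Pᵢ ⊗_ℂ Qᵢ → A` with `A` in
homological degree zero. -/
noncomputable def twist (i : V) : Cat Γ ⥤ Cat Γ :=
  tensorComplexRight (f Γ i)

/-- The functor `Σᵢ⁻¹ ⊗_A -`, where `Σᵢ⁻¹` is the complex of bimodules `g : A → Pᵢ ⊗_ℂ Qᵢ⟨-2⟩` with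
`A` in homological degree zero. -/
noncomputable def twistInv (i : V) : Cat Γ ⥤ Cat Γ :=
  tensorComplexLeft (g Γ i)

end ZigZag

end SphericalTwists

/-! ### The Artin group and the Burau representation -/

section Burau

lemma reflection_inv_aux {K M : Type*} [Field K] [AddCommGroup M] [Module K M] (B : M →ₗ[K] K)
    (x : M) (q : K) (hq : q ≠ 0) (hx : B x = 1 + q ^ 2) :
    (LinearMap.id - B.smulRight x) ∘ₗ (LinearMap.id - (B.smulRight ((q ^ 2)⁻¹ • x) : M →ₗ[K] M)) =
      LinearMap.id ∧
    (LinearMap.id - B.smulRight ((q ^ 2)⁻¹ • x)) ∘ₗ (LinearMap.id - (B.smulRight x : M →ₗ[K] M)) =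
      LinearMap.id := by
  constructor <;> refine LinearMap.ext fun v => ?_ <;>
  simp only [LinearMap.comp_apply, LinearMap.sub_apply, LinearMap.id_apply,
    LinearMap.smulRight_apply, map_sub, map_smul, hx] <;>
  match_scalars <;> field_simp <;> ring

lemma reflection_braid_aux {K M : Type*} [Field K] [AddCommGroup M] [Module K M]
    (B B' : M →ₗ[K] K) (x x' : M) (q c : K) (hx : B x = 1 + q ^ 2) (hx' : B' x' = 1 + q ^ 2)
    (h : B x' = c) (h' : B' x = c) (hc : c * c = q ^ 2) (v : M) :
    (v - B v • x - B' (v - B v • x) • x') - B (v - B v • x - B' (v - B v • x) • x') • x =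
    (v - B' v • x' - B (v - B' v • x') • x) - B' (v - B' v • x' - B (v - B' v • x') • x) • x' := by
  simp only [map_sub, map_smul, hx, hx', h, h', smul_eq_mul]
  match_scalars
  · ring
  · linear_combination (-B v) * hc
  · linear_combination (B' v) * hc

lemma reflection_comm_aux {K M : Type*} [Field K] [AddCommGroup M] [Module K M]
    (B B' : M →ₗ[K] K) (x x' : M) (h : B x' = 0) (h' : B' x = 0) (v : M) :
    v - B v • x - B' (v - B v • x) • x' = v - B' v • x' - B (v - B' v • x') • x := by
  simp only [map_sub, map_smul, h, h', smul_zero, sub_zero]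
  abel

/-- The braid relations of `Γ`: `σᵢσⱼσᵢ = σⱼσᵢσⱼ` for adjacent vertices and `σᵢσⱼ = σⱼσᵢ` for the
other ones. -/
inductive BraidRel {V : Type*} (Γ : SimpleGraph V) : FreeGroup V → Prop
  | braid (i j : V) (h : Γ.Adj i j) : BraidRel Γ
      (FreeGroup.of i * FreeGroup.of j * FreeGroup.of i *
        (FreeGroup.of j * FreeGroup.of i * FreeGroup.of j)⁻¹)
  | comm (i j : V) (h : ¬ Γ.Adj i j) : BraidRel Γ
      (FreeGroup.of i * FreeGroup.of j * (FreeGroup.of j * FreeGroup.of i)⁻¹)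

/-- The Artin–Tits group `B(Γ)`. -/
abbrev ArtinGroup {V : Type*} (Γ : SimpleGraph V) : Type _ :=
  PresentedGroup {r | BraidRel Γ r}

variable {V : Type*} (Γ : SimpleGraph V)

/-- The generator `σᵢ`. -/
def ArtinGroup.σ (i : V) : ArtinGroup Γ := PresentedGroup.of i

/-- The `ℂ(q)`-vector space `V_q(Γ)` with basis the simple roots. -/
abbrev RootSpace (V : Type*) : Type _ := V →₀ RatFunc ℂ

/-- The simple root `αᵢ`. -/
noncomputable abbrev α (i : V) : RootSpace V := Finsupp.single i 1

/-- The element `εq` of `ℂ(q)`, for a sign `ε`. -/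
noncomputable def signedQ (ε : ℤˣ) : RatFunc ℂ := ((ε : ℤ) : RatFunc ℂ) * RatFunc.X

open Classical in
/-- The `q`-deformed pairing of two simple roots, with the sign `ε` for adjacent vertices. -/
noncomputable def pairing (ε : ℤˣ) (i j : V) : RatFunc ℂ :=
  if i = j then 1 + RatFunc.X ^ 2 else if Γ.Adj i j then signedQ ε else 0

/-- The linear form `⟨αᵢ, -⟩`. -/
noncomputable def pairingWith (ε : ℤˣ) (i : V) : RootSpace V →ₗ[RatFunc ℂ] RatFunc ℂ :=
  Finsupp.linearCombination _ (pairing Γ ε i)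

lemma pairingWith_α (ε : ℤˣ) (i j : V) : pairingWith Γ ε i (α j) = pairing Γ ε i j := by
  simp [pairingWith]

lemma signedQ_mul_self (ε : ℤˣ) : signedQ ε * signedQ ε = RatFunc.X ^ 2 := by
  rcases Int.units_eq_one_or ε with rfl | rfl <;> simp [signedQ, sq]

lemma signedQ_ne_zero (ε : ℤˣ) : signedQ ε ≠ 0 := by
  intro h
  have := signedQ_mul_self ε
  rw [h, zero_mul] at this
  exact pow_ne_zero 2 RatFunc.X_ne_zero this.symm

lemma pairing_self (ε : ℤˣ) (i : V) : pairing Γ ε i i = 1 + RatFunc.X ^ 2 := if_pos rfl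

/-- The reflection `v ↦ v - ⟨αᵢ, v⟩ αᵢ` of `V_q(Γ)`. -/
noncomputable def reflection (ε : ℤˣ) (i : V) : RootSpace V ≃ₗ[RatFunc ℂ] RootSpace V :=
  have h := reflection_inv_aux (pairingWith Γ ε i) (α i) RatFunc.X RatFunc.X_ne_zero
    ((pairingWith_α Γ ε i i).trans (pairing_self Γ ε i))
  LinearEquiv.ofLinearMap
    (LinearMap.id - (pairingWith Γ ε i).smulRight (α i))
    (LinearMap.id - (pairingWith Γ ε i).smulRight ((RatFunc.X ^ 2)⁻¹ • α i)) h.1 h.2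

lemma reflection_apply (ε : ℤˣ) (i : V) (v : RootSpace V) :
    reflection Γ ε i v = v - pairingWith Γ ε i v • α i := rfl

/-- The Burau representation: `σᵢ` acts by the reflection `v ↦ v - ⟨αᵢ, v⟩ αᵢ`. -/
noncomputable def burau (ε : ℤˣ) :
    ArtinGroup Γ →* (RootSpace V ≃ₗ[RatFunc ℂ] RootSpace V) :=
  PresentedGroup.toGroup (f := reflection Γ ε) <| by
    rintro _ (⟨i, j, h⟩ | ⟨i, j, h⟩)
    · have hij : pairing Γ ε i j = signedQ ε := by rw [pairing, if_neg h.ne, if_pos h]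
      have hji : pairing Γ ε j i = signedQ ε := by rw [pairing, if_neg h.ne', if_pos h.symm]
      simp only [map_mul, map_inv, FreeGroup.lift_apply_of]
      rw [mul_inv_eq_one]
      refine LinearEquiv.ext fun v => ?_
      exact reflection_braid_aux (pairingWith Γ ε i) (pairingWith Γ ε j) (α i) (α j) RatFunc.X
        (signedQ ε) ((pairingWith_α Γ ε i i).trans (pairing_self Γ ε i))
        ((pairingWith_α Γ ε j j).trans (pairing_self Γ ε j)) ((pairingWith_α Γ ε i j).trans hij)
        ((pairingWith_α Γ ε j i).trans hji) (signedQ_mul_self ε) v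
    · simp only [map_mul, map_inv, FreeGroup.lift_apply_of]
      rw [mul_inv_eq_one]
      by_cases hij : i = j
      · rw [hij]
      have h1 : pairing Γ ε i j = 0 := by rw [pairing, if_neg hij, if_neg h]
      have h2 : pairing Γ ε j i = 0 := by
        rw [pairing, if_neg (Ne.symm hij), if_neg fun h' => h h'.symm]
      refine LinearEquiv.ext fun v => ?_
      exact reflection_comm_aux (pairingWith Γ ε j) (pairingWith Γ ε i) (α j) (α i)
        ((pairingWith_α Γ ε j i).trans h2) ((pairingWith_α Γ ε i j).trans h1) v

lemma burau_σ_α (ε : ℤˣ) (i j : V) :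
    burau Γ ε (ArtinGroup.σ Γ i) (α j) = α j - pairing Γ ε i j • α i := by
  rw [burau, ArtinGroup.σ, PresentedGroup.toGroup.of, reflection_apply, pairingWith_α]

/-- The ring homomorphism `ℤ[T;T⁻¹] → ℂ(q)` sending `T` to `εq`. -/
noncomputable def laurentToRatFunc (ε : ℤˣ) : ℤ[T;T⁻¹] →+* RatFunc ℂ :=
  LaurentPolynomial.eval₂ (Int.castRingHom _) (Units.mk0 (signedQ ε) (signedQ_ne_zero ε))

end Burau

end KhovanovSeidel

open KhovanovSeidel

/-! The proof determines `K0` explicitly: it is free over `ℤ[T;T⁻¹]` on the classes `[Pᵢ]`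
(`projBasis`). The rest is a computation in this basis.

Since `Qᵢ ⊗_A Pⱼ = eᵢAeⱼ`, the module `(Pᵢ ⊗ Qᵢ) ⊗_A Pⱼ` is a sum of copies of `Pᵢ⟨d⟩`, one for each
path of length `d` from `i` to `j`. Its class is therefore `Cᵢⱼ[Pᵢ]`, where `C` is the graded Cartan
matrix, with entries `1 + T²`, `T` or `0` (`tensorK0_projClass`). Mapping cones become differences
in `K0`, so `Σᵢ` acts by `y ↦ y - Cᵢ(y)[Pᵢ]` and `Σᵢ⁻¹` by `y ↦ y - T⁻²Cᵢ(y)[Pᵢ]`. These maps are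
mutually inverse because `Cᵢ(Pᵢ) = 1 + T²`, and they satisfy the braid relations because `T · T =
T²` (`pseudoReflection_braid`); no homotopy equivalence between products of the complexes `Σᵢ` is
required. Under `T ↦ εq` the matrix `C` becomes the pairing of simple roots, so the generators act
as in the Burau representation, and generators suffice.

Generation of `K0`: brutal truncation reduces a bounded complex to its terms
(`K0.mem_of_single_mem`), and a nonzero graded projective module splits off some `Pⱼ⟨k⟩` generated
in its lowest degree `k` (`exists_split`), so that induction on the dimension applies.

Independence: the alternating trace on the spaces `eᵢMₖ` is additive and invariant under homotopy,
hence defines a functional on `K0`. On `∑ⱼ pⱼ[Pⱼ]` these functionals return the coefficients of `∑ⱼ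
pⱼCᵢⱼ`, and `C` has nonzero determinant since it is the identity at `T = 0`. The values of `C`
depend on the paths `eᵢ`, `(i|j)`, `xᵢ` being nonzero in the quotient algebra, which an explicit
representation shows; for `xᵢ` this is where the absence of isolated vertices enters. -/

namespace KhovanovSeidel

/-! ### Cyclic traces, Lefschetz numbers and Euler characteristics of bounded complexes. -/

section TraceFunctions

/-- An additive cyclic function on the endomorphisms of the objects with property `P`. -/
structure TraceFunction {C : Type*} [Category C] [Preadditive C] (P : ObjectProperty C)
    (G : Type*) [AddCommGroup G] where
  /-- the trace of an endomorphism -/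
  tr : ∀ X : C, (X ⟶ X) →+ G
  tr_comp : ∀ {X Y : C} (f : X ⟶ Y) (g : Y ⟶ X), P X → P Y → tr X (f ≫ g) = tr Y (g ≫ f)

namespace TraceFunction

variable {C : Type*} [Category C] [Preadditive C] {P : ObjectProperty C} {G : Type*}
  [AddCommGroup G] (τ : TraceFunction P G)

/-- The trace of the identity. -/
def dim (X : C) : G := τ.tr X (𝟙 X)

lemma dim_of_isZero {X : C} (h : IsZero X) : τ.dim X = 0 := by
  rw [dim, h.eq_of_src (𝟙 X) 0, map_zero]

lemma tr_of_isZero {X : C} (h : IsZero X) (f : X ⟶ X) : τ.tr X f = 0 := by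
  rw [h.eq_of_src f 0, map_zero]

lemma dim_of_iso {X Y : C} (e : X ≅ Y) (hX : P X) (hY : P Y) : τ.dim X = τ.dim Y := by
  rw [dim, dim, ← e.hom_inv_id, τ.tr_comp _ _ hX hY, e.inv_hom_id]

/-- Additivity splits the trace of `𝟙 M`, and cyclicity turns each `w i ≫ u i` into the identity of
`N i`. Orthogonality of the summands is not needed, so a direct sum decomposition does not have to
be verified in full. -/
lemma dim_eq_sum {ι : Type*} (s : Finset ι) {M : C} (N : ι → C) (u : ∀ i, N i ⟶ M)
    (w : ∀ i, M ⟶ N i) (huw : ∀ i ∈ s, u i ≫ w i = 𝟙 (N i)) (h : ∑ i ∈ s, w i ≫ u i = 𝟙 M)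
    (hM : P M) (hN : ∀ i, P (N i)) : τ.dim M = ∑ i ∈ s, τ.dim (N i) := by
  rw [dim, ← h, map_sum]
  exact Finset.sum_congr rfl fun i hi => by rw [τ.tr_comp _ _ hM (hN i), huw i hi, dim]

lemma dim_biprod [HasBinaryBiproducts C] {X Y : C} (hX : P X) (hY : P Y) (hXY : P (X ⊞ Y)) :
    τ.dim (X ⊞ Y) = τ.dim X + τ.dim Y := by
  rw [dim, ← biprod.total, map_add, τ.tr_comp _ _ hXY hX, τ.tr_comp _ _ hXY hY, biprod.inl_fst,
    biprod.inr_snd, dim, dim]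

/-- The Lefschetz number of an endomorphism of a complex. -/
noncomputable def lefschetz {X : CochainComplex C ℤ} (f : X ⟶ X) : G :=
  ∑ᶠ n : ℤ, n.negOnePow • τ.tr (X.X n) (f.f n)

/-- The Euler characteristic of a complex. -/
noncomputable def euler (X : CochainComplex C ℤ) : G :=
  ∑ᶠ n : ℤ, n.negOnePow • τ.dim (X.X n)

lemma lefschetz_id (X : CochainComplex C ℤ) : τ.lefschetz (𝟙 X) = τ.euler X := rfl

/-- A `finsum` with infinite support is zero by convention and is not additive; boundedness supplies
the finiteness needed to split one. -/
lemma finite_support {X : CochainComplex C ℤ}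
    (hb : ∃ a b : ℤ, ∀ n, n < a ∨ b < n → IsZero (X.X n)) (g : ℤ → G)
    (hg : ∀ n, IsZero (X.X n) → g n = 0) : (Function.support fun n => n.negOnePow • g n).Finite := by
  obtain ⟨a, b, hb⟩ := hb
  refine (Set.finite_Icc a b).subset fun n hn => ?_
  by_contra h
  refine hn ?_
  have : IsZero (X.X n) := hb n (by
    simp only [Set.mem_Icc] at h
    omega)
  simp [hg n this]

/-- The difference of `f` and `g` in degree `n` is `dh + hd`. By cyclicity the trace of one summand
in degree `n` is that of the other in degree `n - 1`, so the alternating sum telescopes to zero. -/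
lemma lefschetz_eq_of_homotopy {X : CochainComplex C ℤ} {f g : X ⟶ X} (h : Homotopy f g)
    (hb : ∃ a b : ℤ, ∀ n, n < a ∨ b < n → IsZero (X.X n)) (hP : ∀ n, P (X.X n)) :
    τ.lefschetz f = τ.lefschetz g := by
  let v : ℤ → G := fun n => τ.tr (X.X n) (X.d n (n + 1) ≫ h.hom (n + 1) n)
  have hv : ∀ n, τ.tr (X.X n) (f.f n) = v n + v (n - 1) + τ.tr (X.X n) (g.f n) := fun n => by
    have h1 : (ComplexShape.up ℤ).Rel n (n + 1) := rfl
    have h2 : (ComplexShape.up ℤ).Rel (n - 1) n := by simp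
    rw [h.comm n, map_add, map_add, dNext_eq _ h1, prevD_eq _ h2,
      τ.tr_comp (h.hom n (n - 1)) _ (hP _) (hP _)]
    have : ∀ m, m + 1 = n → τ.tr (X.X m) (X.d m n ≫ h.hom n m) = v m := by
      rintro m rfl
      rfl
    rw [this _ (sub_add_cancel n 1)]
  have hz : ∀ n, IsZero (X.X n) → v n = 0 := fun n hn => τ.tr_of_isZero hn _
  -- By cyclicity `v (n - 1)` is also the trace of an endomorphism of `X.X n`, so it vanishes with
  -- that object; `hv` already records this.
  have hz' : ∀ n, IsZero (X.X n) → v (n - 1) = 0 := fun n hn => by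
    have := hv n
    rw [τ.tr_of_isZero hn, τ.tr_of_isZero hn, hz n hn] at this
    simpa using this.symm
  have h1 : ∑ᶠ n : ℤ, n.negOnePow • v (n - 1) = -∑ᶠ n : ℤ, n.negOnePow • v n := by
    rw [← finsum_comp_equiv (Equiv.subRight (1 : ℤ)) (f := fun n => n.negOnePow • v n),
      ← finsum_neg_distrib]
    refine finsum_congr fun n => ?_
    simp [Int.negOnePow_sub]
  unfold lefschetz
  simp only [hv, smul_add]
  rw [finsum_add_distrib, finsum_add_distrib (finite_support hb _ hz) (finite_support hb _ hz'), h1,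
    add_neg_cancel, zero_add]
  · simp only [← smul_add]
    exact finite_support hb (fun n => v n + v (n - 1)) fun n hn => by
      rw [hz n hn, hz' n hn, add_zero]
  · exact finite_support hb _ fun n hn => τ.tr_of_isZero hn _

lemma lefschetz_comp {X Y : CochainComplex C ℤ} (f : X ⟶ Y) (g : Y ⟶ X) (hX : ∀ n, P (X.X n))
    (hY : ∀ n, P (Y.X n)) : τ.lefschetz (f ≫ g) = τ.lefschetz (g ≫ f) :=
  finsum_congr fun n => by
    rw [HomologicalComplex.comp_f, HomologicalComplex.comp_f, τ.tr_comp _ _ (hX n) (hY n)]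

/-- The identity of `X` is homotopic to `X ⟶ Y ⟶ X`, whose Lefschetz number equals that of `Y ⟶ X ⟶
Y`, which is homotopic to the identity of `Y`. -/
lemma euler_eq_of_homotopyEquiv {X Y : CochainComplex C ℤ} (e : HomotopyEquiv X Y)
    (hX : ∃ a b : ℤ, ∀ n, n < a ∨ b < n → IsZero (X.X n)) (hX' : ∀ n, P (X.X n))
    (hY : ∃ a b : ℤ, ∀ n, n < a ∨ b < n → IsZero (Y.X n)) (hY' : ∀ n, P (Y.X n)) :
    τ.euler X = τ.euler Y := by
  rw [← lefschetz_id, ← lefschetz_id, ← τ.lefschetz_eq_of_homotopy e.homotopyHomInvId hX hX',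
    ← τ.lefschetz_eq_of_homotopy e.homotopyInvHomId hY hY', τ.lefschetz_comp _ _ hX' hY']

/-- Only the terms of the cone matter, not its differential: degree `n` is `X.X (n + 1) ⊞ Y.X n`,
and the index shift reverses the sign of the contribution of `X`. The closure hypotheses on `P` are
there because cyclicity is available only for objects with property `P`. -/
lemma euler_mappingCone [HasBinaryBiproducts C] {X Y : CochainComplex C ℤ} (f : X ⟶ Y)
    (hP : ∀ A B, P A → P B → P (A ⊞ B)) (hi : ∀ A B, (A ≅ B) → P A → P B)
    (hX : ∃ a b : ℤ, ∀ n, n < a ∨ b < n → IsZero (X.X n)) (hX' : ∀ n, P (X.X n))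
    (hY : ∃ a b : ℤ, ∀ n, n < a ∨ b < n → IsZero (Y.X n)) (hY' : ∀ n, P (Y.X n)) :
    τ.euler Y = τ.euler X + τ.euler (CochainComplex.mappingCone f) := by
  have h1 : ∀ n, τ.dim ((CochainComplex.mappingCone f).X n) =
      τ.dim (X.X (n + 1)) + τ.dim (Y.X n) := fun n => by
    have e := HomologicalComplex.homotopyCofiber.XIsoBiprod f n (n + 1) rfl
    have h2 := hP _ _ (hX' (n + 1)) (hY' n)
    rw [← τ.dim_biprod (hX' _) (hY' _) h2]
    exact τ.dim_of_iso e (hi _ _ e.symm h2) h2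
  have h3 : ∑ᶠ n : ℤ, n.negOnePow • τ.dim (X.X (n + 1)) = -τ.euler X := by
    rw [euler, ← finsum_comp_equiv (Equiv.addRight (1 : ℤ))
      (f := fun n => n.negOnePow • τ.dim (X.X n)), ← finsum_neg_distrib]
    refine finsum_congr fun n => ?_
    simp [Int.negOnePow_add]
  rw [euler, euler, euler]
  simp only [h1, smul_add]
  rw [finsum_add_distrib, h3, euler]
  · abel
  · obtain ⟨a, b, h⟩ := hX
    refine (Set.finite_Icc (a - 1) (b - 1)).subset fun n hn => ?_
    by_contra h'
    refine hn ?_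
    have : IsZero (X.X (n + 1)) := h _ (by
      simp only [Set.mem_Icc] at h'
      omega)
    simp [τ.dim_of_isZero this]
  · exact finite_support hY _ fun n hn => τ.dim_of_isZero hn

end TraceFunction

end TraceFunctions

/-! ### Euler characteristics as homomorphisms on the Grothendieck group. -/

section EulerK0

variable {A : Type u} [Ring A] [Algebra ℂ A] {𝒜 : ℤ → Submodule ℂ A} {G : Type*} [AddCommGroup G]

/-- The homomorphism on the Grothendieck group given by the Euler characteristic. -/
noncomputable def TraceFunction.eulerK0 (τ : TraceFunction (GrMod.fgProj (𝒜 := 𝒜)) G) :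
    K0 (ProjHomotopyCategory 𝒜) →+ G :=
  K0.lift (fun X => τ.euler X.obj.as) fun T hT => by
    obtain ⟨f : T.obj₁.obj.as ⟶ T.obj₂.obj.as, hf⟩ :=
      (HomotopyCategory.quotient _ _).map_surjective T.mor₁.hom
    have hT' := (boundedProj 𝒜).ι.map_distinguished T hT
    -- The third vertex is only isomorphic, in the homotopy category, to the cone of a
    -- representative `f` of the first morphism. Homotopy invariance of the Euler characteristic
    -- bridges this.
    let e := Pretriangulated.Triangle.π₃.mapIso (Pretriangulated.isoTriangleOfIso₁₂ _ _ hT'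
        (HomotopyCategory.mappingCone_triangleh_distinguished f)
        (Iso.refl _) (Iso.refl _) ((Category.comp_id _).trans (hf.symm.trans (Category.id_comp _).symm)))
    have h₁ := T.obj₁.property
    have h₂ := T.obj₂.property
    have h₃ := T.obj₃.property
    have h := boundedProjComplexes_mappingCone f h₁ h₂
    rw [τ.euler_eq_of_homotopyEquiv (HomotopyCategory.homotopyEquivOfIso
      (C := T.obj₃.obj.as) (D := CochainComplex.mappingCone f) e) h₃.1 h₃.2 h.1 h.2]
    exact τ.euler_mappingCone f (fun _ _ => GrMod.fgProj_biprod) (fun _ _ e => GrMod.fgProj_of_iso e)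
      h₁.1 h₁.2 h₂.1 h₂.2

lemma TraceFunction.eulerK0_of (τ : TraceFunction (GrMod.fgProj (𝒜 := 𝒜)) G)
    (X : ProjHomotopyCategory 𝒜) : τ.eulerK0 (K0.of X) = τ.euler X.obj.as := K0.lift_of _ _ _

lemma TraceFunction.eulerK0_single (τ : TraceFunction (GrMod.fgProj (𝒜 := 𝒜)) G) (M : GrMod 𝒜)
    (hM : GrMod.fgProj M) :
    τ.eulerK0 (K0.of (ProjHomotopyCategory.single M hM)) = τ.dim M := by
  rw [eulerK0_of]
  change τ.euler ((HomologicalComplex.single (GrMod 𝒜) (ComplexShape.up ℤ) 0).obj M) = _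
  have h0 : ∀ n : ℤ, n ≠ 0 →
      IsZero (((HomologicalComplex.single (GrMod 𝒜) (ComplexShape.up ℤ) 0).obj M).X n) :=
    fun n hn => HomologicalComplex.isZero_single_obj_X _ _ _ _ hn
  rw [euler, finsum_eq_single _ 0 fun n hn => by rw [τ.dim_of_isZero (h0 n hn), smul_zero],
    Int.negOnePow_zero, one_smul]
  exact τ.dim_of_iso (HomologicalComplex.singleObjXSelf _ _ _)
    (GrMod.fgProj_of_iso (HomologicalComplex.singleObjXSelf _ _ _).symm hM) hM

end EulerK0

/-! ### Classes of complexes in `K0`: shifts, split sequences, brutal truncation. -/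

section Additivity

open Pretriangulated ZeroObject

lemma K0.of_isZero {C : Type*} [Category C] [HasZeroObject C] [HasShift C ℤ] [Preadditive C]
    [∀ n : ℤ, (CategoryTheory.shiftFunctor C n).Additive] [Pretriangulated C] {X : C}
    (h : IsZero X) : K0.of X = 0 := by
  have := K0.of_triangle _ (contractible_distinguished X)
  have h2 : K0.of (0 : C) = K0.of X := K0.of_iso ((isZero_zero C).iso h)
  simpa [h2] using this

/-- The rotation of the triangle `X → X → 0` is `X → 0 → X[1]`. -/
lemma K0.of_shift_one {C : Type*} [Category C] [HasZeroObject C] [HasShift C ℤ] [Preadditive C]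
    [∀ n : ℤ, (CategoryTheory.shiftFunctor C n).Additive] [Pretriangulated C] (X : C) :
    K0.of (X⟦(1 : ℤ)⟧) = -K0.of X := by
  have := K0.of_triangle _ (rot_of_distTriang _ (contractible_distinguished X))
  rw [eq_neg_iff_add_eq_zero, add_comm]
  exact this.symm.trans (K0.of_isZero (isZero_zero C))

lemma K0.of_shift {C : Type*} [Category C] [HasZeroObject C] [HasShift C ℤ] [Preadditive C]
    [∀ n : ℤ, (CategoryTheory.shiftFunctor C n).Additive] [Pretriangulated C] (n : ℤ) (X : C) :
    K0.of (X⟦n⟧) = n.negOnePow • K0.of X := by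
  have h : ∀ m : ℤ, K0.of (X⟦m + 1⟧) = -K0.of (X⟦m⟧) := fun m => by
    rw [← K0.of_shift_one]
    exact K0.of_iso ((shiftFunctorAdd C m 1).app X)
  induction n using Int.induction_on with
  | zero =>
    rw [Int.negOnePow_zero, one_smul]
    exact K0.of_iso ((shiftFunctorZero C ℤ).app X)
  | succ n ih => rw [h, ih, Int.negOnePow_succ, Units.neg_smul]
  | pred n ih =>
    have h' := h (-n - 1)
    rw [sub_add_cancel, ih] at h'
    rw [Int.negOnePow_sub, Int.negOnePow_one, mul_neg, mul_one, Units.neg_smul, h', neg_neg]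

variable {A : Type u} [Ring A] [Algebra ℂ A] {𝒜 : ℤ → Submodule ℂ A}

/-- Triangles are constructed in the full homotopy category, whereas `K0` is that of the
subcategory. The inclusion commutes with the shift only up to `commShiftIso`, so the third morphism
has to be corrected by this isomorphism before it is lifted. -/
lemma K0.of_ambient_triangle (T : Triangle (HomotopyCategory (GrMod 𝒜) (ComplexShape.up ℤ)))
    (hT : T ∈ distTriang _) (h₁ : boundedProj 𝒜 T.obj₁) (h₂ : boundedProj 𝒜 T.obj₂)
    (h₃ : boundedProj 𝒜 T.obj₃) :
    K0.of (⟨T.obj₂, h₂⟩ : ProjHomotopyCategory 𝒜) =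
      K0.of (⟨T.obj₁, h₁⟩ : ProjHomotopyCategory 𝒜) +
        K0.of (⟨T.obj₃, h₃⟩ : ProjHomotopyCategory 𝒜) := by
  let X₁ : ProjHomotopyCategory 𝒜 := ⟨T.obj₁, h₁⟩
  let X₂ : ProjHomotopyCategory 𝒜 := ⟨T.obj₂, h₂⟩
  let X₃ : ProjHomotopyCategory 𝒜 := ⟨T.obj₃, h₃⟩
  let t : X₃ ⟶ X₁⟦(1 : ℤ)⟧ := (boundedProj 𝒜).ι.preimage
    (T.mor₃ ≫ ((boundedProj 𝒜).ι.commShiftIso (1 : ℤ)).inv.app X₁)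
  have ht : (boundedProj 𝒜).ι.map t ≫ ((boundedProj 𝒜).ι.commShiftIso (1 : ℤ)).hom.app X₁ =
      T.mor₃ := by
    rw [Functor.map_preimage]
    exact (Category.assoc _ _ _).trans ((congrArg (T.mor₃ ≫ ·) (Iso.inv_hom_id_app ((boundedProj 𝒜).ι.commShiftIso (1 : ℤ)) X₁)).trans
      (Category.comp_id _))
  let T' : Triangle (ProjHomotopyCategory 𝒜) :=
    Triangle.mk (X := X₁) (Y := X₂) (Z := X₃) (ObjectProperty.homMk T.mor₁)
      (ObjectProperty.homMk T.mor₂) t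
  refine K0.of_triangle T' ?_
  refine isomorphic_distinguished T hT ((boundedProj 𝒜).ι.mapTriangle.obj T') ?_
  refine Triangle.isoMk _ _ (Iso.refl _) (Iso.refl _) (Iso.refl _) ?_ ?_ ?_
  · exact (Category.comp_id _).trans (Category.id_comp _).symm
  · exact (Category.comp_id _).trans (Category.id_comp _).symm
  · exact (congrArg₂ (· ≫ ·) ht (CategoryTheory.Functor.map_id _ _)).trans
      ((Category.comp_id _).trans (Category.id_comp _).symm)

/-- A bounded complex of finitely generated projective modules as an object of the homotopy
category. -/
noncomputable abbrev ofComplex (X : CochainComplex (GrMod 𝒜) ℤ) (h : boundedProjComplexes 𝒜 X) :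
    ProjHomotopyCategory 𝒜 := ⟨(HomotopyCategory.quotient _ _).obj X, h⟩

lemma K0.of_complex_iso {X Y : CochainComplex (GrMod 𝒜) ℤ} (e : X ≅ Y)
    (hX : boundedProjComplexes 𝒜 X) (hY : boundedProjComplexes 𝒜 Y) :
    K0.of (ofComplex X hX) = K0.of (ofComplex Y hY) :=
  K0.of_iso ((boundedProj 𝒜).fullyFaithfulι.preimageIso
    (X := ofComplex X hX) (Y := ofComplex Y hY) ((HomotopyCategory.quotient _ _).mapIso e))

lemma K0.of_mappingCone {X Y : CochainComplex (GrMod 𝒜) ℤ} (f : X ⟶ Y)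
    (hX : boundedProjComplexes 𝒜 X) (hY : boundedProjComplexes 𝒜 Y) :
    K0.of (ofComplex (CochainComplex.mappingCone f) (boundedProjComplexes_mappingCone f hX hY)) =
      K0.of (ofComplex Y hY) - K0.of (ofComplex X hX) := by
  rw [eq_sub_iff_add_eq, add_comm]
  exact (K0.of_ambient_triangle _ (HomotopyCategory.mappingCone_triangleh_distinguished f)
    hX hY (boundedProjComplexes_mappingCone f hX hY)).symm

lemma K0.of_degreewiseSplit (S : ShortComplex (CochainComplex (GrMod 𝒜) ℤ))
    (σ : ∀ n, (S.map (HomologicalComplex.eval (GrMod 𝒜) _ n)).Splitting)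
    (h₁ : boundedProjComplexes 𝒜 S.X₁) (h₂ : boundedProjComplexes 𝒜 S.X₂)
    (h₃ : boundedProjComplexes 𝒜 S.X₃) :
    K0.of (ofComplex S.X₂ h₂) = K0.of (ofComplex S.X₁ h₁) + K0.of (ofComplex S.X₃ h₃) :=
  K0.of_ambient_triangle (CochainComplex.trianglehOfDegreewiseSplit S σ)
    ((HomotopyCategory.distinguished_iff_iso_trianglehOfDegreewiseSplit _).2 ⟨S, σ, ⟨Iso.refl _⟩⟩)
    h₁ h₂ h₃

lemma boundedProjComplexes_single (b : ℤ) {M : GrMod 𝒜} (hM : GrMod.fgProj M) :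
    boundedProjComplexes 𝒜 ((HomologicalComplex.single (GrMod 𝒜) (ComplexShape.up ℤ) b).obj M) := by
  have h0 : ∀ n : ℤ, n ≠ b →
      IsZero (((HomologicalComplex.single (GrMod 𝒜) (ComplexShape.up ℤ) b).obj M).X n) :=
    fun n hn => HomologicalComplex.isZero_single_obj_X _ _ _ _ hn
  refine ⟨⟨b, b, fun n hn => h0 n (by omega)⟩, fun n => ?_⟩
  by_cases hn : n = b
  · subst hn
    exact GrMod.fgProj_of_iso (HomologicalComplex.singleObjXSelf _ _ _).symm hM
  · exact GrMod.fgProj_of_isZero (h0 n hn)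

lemma K0.of_complex_shift {X : CochainComplex (GrMod 𝒜) ℤ} (hX : boundedProjComplexes 𝒜 X) (n : ℤ) :
    K0.of (ofComplex _ (boundedProjComplexes_shift hX n)) =
      n.negOnePow • K0.of (ofComplex X hX) := by
  rw [← K0.of_shift]
  exact K0.of_iso ((boundedProj 𝒜).fullyFaithfulι.preimageIso
    (X := ofComplex _ (boundedProjComplexes_shift hX n)) (Y := (ofComplex X hX)⟦n⟧)
    (((HomotopyCategory.quotient _ _).commShiftIso n).app X ≪≫
      ((boundedProj 𝒜).ι.commShiftIso n).symm.app (ofComplex X hX)))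

/-- Shifting by `b` moves the module from degree `b` to degree `0` and multiplies the class by the
sign of `b`, which is its own inverse. -/
lemma K0.of_single_degree (b : ℤ) {M : GrMod 𝒜} (hM : GrMod.fgProj M) :
    K0.of (ofComplex _ (boundedProjComplexes_single b hM)) =
      b.negOnePow • K0.of (ProjHomotopyCategory.single M hM) := by
  have e := ((CochainComplex.singleFunctors (GrMod 𝒜)).shiftIso b 0 b (add_zero b)).app M
  have h := K0.of_complex_shift (boundedProjComplexes_single b hM) b
  rw [show K0.of (ProjHomotopyCategory.single M hM) = _ from
    (K0.of_complex_iso e (boundedProjComplexes_shift (boundedProjComplexes_single b hM) b)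
      (boundedProjComplexes_single 0 hM)).symm.trans h, smul_smul, Int.units_mul_self,
    one_smul]

lemma K0.of_single_biprod {N₁ N₂ : GrMod 𝒜} (b : BinaryBicone N₁ N₂) (hb : b.fst ≫ b.inl + b.snd ≫ b.inr = 𝟙 _) 
   (h₁ : GrMod.fgProj N₁) (h₂ : GrMod.fgProj N₂) (h : GrMod.fgProj b.pt) :
   K0.of (ProjHomotopyCategory.single b.pt h) = K0.of (ProjHomotopyCategory.single N₁ h₁) + 
    K0.of (ProjHomotopyCategory.single N₂ h₂) := by
  let F := HomologicalComplex.single (GrMod 𝒜) (ComplexShape.up ℤ) 0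
  let s : (ShortComplex.mk b.inl b.snd b.inl_snd).Splitting :=
    { r := b.fst, s := b.inr, f_r := b.inl_fst, s_g := b.inr_snd, id := hb }
  refine K0.of_degreewiseSplit ((ShortComplex.mk b.inl b.snd b.inl_snd).map F) (fun n => ?_)
    (boundedProjComplexes_single 0 h₁) (boundedProjComplexes_single 0 h)
    (boundedProjComplexes_single 0 h₂)
  exact (s.map F).map (HomologicalComplex.eval _ _ n)

/-- The objects of the brutal truncation in degrees `< b`. -/
noncomputable def truncX (X : CochainComplex (GrMod 𝒜) ℤ) (b n : ℤ) : GrMod 𝒜 :=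
  if n < b then X.X n else 0

lemma truncX_of_lt (X : CochainComplex (GrMod 𝒜) ℤ) {b n : ℤ} (h : n < b) : truncX X b n = X.X n :=
  if_pos h

lemma isZero_truncX (X : CochainComplex (GrMod 𝒜) ℤ) {b n : ℤ} (h : ¬ n < b) :
    IsZero (truncX X b n) := by
  rw [truncX, if_neg h]
  exact isZero_zero _

/-- The projection onto the brutal truncation. -/
noncomputable def truncπ (X : CochainComplex (GrMod 𝒜) ℤ) (b n : ℤ) : X.X n ⟶ truncX X b n :=
  if h : n < b then eqToHom (truncX_of_lt X h).symm else 0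

/-- The degreewise section of `truncπ`. -/
noncomputable def truncι (X : CochainComplex (GrMod 𝒜) ℤ) (b n : ℤ) : truncX X b n ⟶ X.X n :=
  if h : n < b then eqToHom (truncX_of_lt X h) else 0

lemma truncι_π (X : CochainComplex (GrMod 𝒜) ℤ) (b n : ℤ) : truncι X b n ≫ truncπ X b n = 𝟙 _ := by
  by_cases h : n < b
  · simp [truncι, truncπ, h]
  · exact (isZero_truncX X h).eq_of_src _ _

lemma truncπ_ι (X : CochainComplex (GrMod 𝒜) ℤ) {b n : ℤ} (h : n < b) :
    truncπ X b n ≫ truncι X b n = 𝟙 _ := by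
  simp [truncι, truncπ, h]

/-- The composite `truncπ ≫ truncι` is the identity in degrees `< b`, and in the remaining degrees
the target is zero. This yields both that the truncated differential squares to zero and that
`truncπ` is a chain map. -/
lemma truncπ_d (X : CochainComplex (GrMod 𝒜) ℤ) (b n : ℤ) :
    truncπ X b n ≫ truncι X b n ≫ X.d n (n + 1) ≫ truncπ X b (n + 1) =
      X.d n (n + 1) ≫ truncπ X b (n + 1) := by
  by_cases h : n < b
  · rw [← Category.assoc, truncπ_ι X h, Category.id_comp]
  · exact (isZero_truncX X (by omega)).eq_of_tgt _ _

/-- The brutal truncation of a complex in degrees `< b`. -/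
noncomputable def truncLT (X : CochainComplex (GrMod 𝒜) ℤ) (b : ℤ) : CochainComplex (GrMod 𝒜) ℤ :=
  CochainComplex.of (truncX X b) (fun n => truncι X b n ≫ X.d n (n + 1) ≫ truncπ X b (n + 1))
    fun n => by
      simp only [Category.assoc]
      rw [truncπ_d, X.d_comp_d_assoc, zero_comp, comp_zero]

/-- The projection onto the brutal truncation. -/
noncomputable def toTruncLT (X : CochainComplex (GrMod 𝒜) ℤ) (b : ℤ) : X ⟶ truncLT X b where
  f n := truncπ X b n
  comm' i j hij := by
    obtain rfl : i + 1 = j := hij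
    exact (congrArg (truncπ X b i ≫ ·) (CochainComplex.of_d _ _ _)).trans (truncπ_d X b i)

lemma boundedProjComplexes_truncLT {X : CochainComplex (GrMod 𝒜) ℤ} (hX : boundedProjComplexes 𝒜 X)
    (b : ℤ) : boundedProjComplexes 𝒜 (truncLT X b) := by
  have h : ∀ n, (truncLT X b).X n = X.X n ∨ IsZero ((truncLT X b).X n) := fun n => by
    by_cases h : n < b
    · exact .inl (truncX_of_lt X h)
    · exact .inr (isZero_truncX X h)
  obtain ⟨⟨a, c, hac⟩, hX⟩ := hX
  refine ⟨⟨a, c, fun n hn => ?_⟩, fun n => ?_⟩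
  · rcases h n with h | h
    · rw [h]; exact hac n hn
    · exact h
  · rcases h n with h | h
    · rw [h]; exact hX n
    · exact GrMod.fgProj_of_isZero h

/-- A complex which vanishes in degrees `> b` is an extension of its brutal truncation in degrees
`< b` by its component of degree `b`. -/
lemma K0.of_truncLT {X : CochainComplex (GrMod 𝒜) ℤ} (hX : boundedProjComplexes 𝒜 X) (b : ℤ)
    (hb : ∀ n, b < n → IsZero (X.X n)) :
    K0.of (ofComplex X hX) = b.negOnePow • K0.of (ProjHomotopyCategory.single (X.X b) (hX.2 b)) +
      K0.of (ofComplex _ (boundedProjComplexes_truncLT hX b)) := by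
  rw [← K0.of_single_degree]
  -- The top term is a subcomplex because the differential leaving it lands in zero.
  let i : (HomologicalComplex.single (GrMod 𝒜) (ComplexShape.up ℤ) b).obj (X.X b) ⟶ X :=
    HomologicalComplex.mkHomFromSingle (𝟙 _) fun k hk =>
      (hb k (by have : b + 1 = k := hk; omega)).eq_of_tgt _ _
  have hi : ∀ n, n ≠ b →
      IsZero (((HomologicalComplex.single (GrMod 𝒜) (ComplexShape.up ℤ) b).obj (X.X b)).X n) :=
    fun n hn => HomologicalComplex.isZero_single_obj_X _ _ _ _ hn
  have hib : i.f b = (HomologicalComplex.singleObjXSelf (ComplexShape.up ℤ) b (X.X b)).hom := by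
    simp [i]
  have w : i ≫ toTruncLT X b = 0 := by
    refine HomologicalComplex.hom_ext _ _ fun n => ?_
    by_cases hn : n = b
    · subst hn
      exact (isZero_truncX X (lt_irrefl n)).eq_of_tgt _ _
    · exact (hi n hn).eq_of_src _ _
  have hr : ∀ n, ∃ r, i.f n ≫ r = 𝟙 _ ∧ r ≫ i.f n + truncπ X b n ≫ truncι X b n = 𝟙 _ := fun n => by
    rcases lt_trichotomy n b with h | h | h
    · exact ⟨0, (hi n h.ne).eq_of_src _ _, by rw [zero_comp, zero_add, truncπ_ι X h]⟩
    · subst h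
      refine ⟨(HomologicalComplex.singleObjXSelf (ComplexShape.up ℤ) n (X.X n)).inv, ?_, ?_⟩
      · rw [hib, Iso.hom_inv_id]
      · rw [hib, Iso.inv_hom_id, (isZero_truncX X (lt_irrefl n)).eq_of_tgt (truncπ X n n) 0,
          zero_comp, add_zero]
    · exact ⟨0, (hi n h.ne').eq_of_src _ _, (hb n h).eq_of_src _ _⟩
  choose r hr₁ hr₂ using hr
  exact K0.of_degreewiseSplit (ShortComplex.mk i (toTruncLT X b) w)
    (fun n => { r := r n, s := truncι X b n, f_r := hr₁ n, s_g := truncι_π X b n, id := hr₂ n })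
    (boundedProjComplexes_single b (hX.2 b)) hX (boundedProjComplexes_truncLT hX b)

/-- Induction on the number `m` of degrees in the half-open interval `[a, a + m)` supporting the
complex, peeling off the top one. -/
lemma K0.of_complex_mem (H : AddSubgroup (K0 (ProjHomotopyCategory 𝒜)))
    (hH : ∀ (M : GrMod 𝒜) (hM : GrMod.fgProj M), K0.of (ProjHomotopyCategory.single M hM) ∈ H)
    (a : ℤ) (m : ℕ) : ∀ (X : CochainComplex (GrMod 𝒜) ℤ) (hX : boundedProjComplexes 𝒜 X),
    (∀ n, n < a ∨ a + m ≤ n → IsZero (X.X n)) → K0.of (ofComplex X hX) ∈ H := by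
  induction m with
  | zero =>
    intro X hX h
    have : IsZero X := by
      rw [IsZero.iff_id_eq_zero]
      ext n : 1
      exact (h n (by omega)).eq_of_src _ _
    rw [K0.of_isZero]
    · exact H.zero_mem
    · rw [IsZero.iff_id_eq_zero]
      refine ObjectProperty.hom_ext _ ?_
      exact ((HomotopyCategory.quotient _ _).map_isZero this).eq_of_src _ _
  | succ m ih =>
    intro X hX h
    -- For support in `[a, a + m + 1)` the top degree is `a + m`.
    rw [K0.of_truncLT hX (a + m) fun n hn => h n (by push_cast; omega)]
    refine H.add_mem ?_ (ih _ _ fun n hn => ?_)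
    · rcases Int.even_or_odd (a + m) with h' | h'
      · rw [Int.negOnePow_even _ h', one_smul]
        exact hH _ _
      · rw [Int.negOnePow_odd _ h', Units.neg_smul, one_smul]
        exact H.neg_mem (hH _ _)
    · by_cases h' : n < a + m
      · change IsZero (truncX X _ n)
        rw [truncX_of_lt X h']
        exact h n (by omega)
      · exact isZero_truncX X h'

/-- The Grothendieck group is generated by the classes of modules. -/
lemma K0.mem_of_single_mem (H : AddSubgroup (K0 (ProjHomotopyCategory 𝒜)))
    (hH : ∀ (M : GrMod 𝒜) (hM : GrMod.fgProj M), K0.of (ProjHomotopyCategory.single M hM) ∈ H)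
    (y : K0 (ProjHomotopyCategory 𝒜)) : y ∈ H := by
  obtain ⟨y, rfl⟩ := QuotientAddGroup.mk_surjective y
  induction y using FreeAbelianGroup.induction_on with
  | zero => exact H.zero_mem
  | of X =>
    obtain ⟨a, b, hab⟩ := X.property.1
    -- The interval `[a, b]` has `b + 1 - a` degrees; if this is negative, `toNat` gives `0` and the
    -- complex vanishes in every degree.
    exact K0.of_complex_mem H hH a (b + 1 - a).toNat X.obj.as X.property fun n hn =>
      hab n (by omega)
  | neg X h => exact H.neg_mem h
  | add x y hx hy => exact H.add_mem hx hy

end Additivity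

/-! ### The spaces `eᵢAeⱼ` and their bases of paths. -/

section Corners

namespace ZigZag

variable {V : Type u} [Fintype V] (Γ : SimpleGraph V)

open Classical in
/-- The action of `eₖ` on the representation with basis the paths ending at `p`. -/
noncomputable def vertexRep (p k : V) : Module.End ℂ (ℂ × (V → ℂ) × ℂ) where
  -- The coordinates of `m` are the coefficients of `eₚ`, of the paths `(k|p)` and of `xₚ`. The
  -- middle one is indexed by all vertices for simplicity; entries at non-neighbours of `p` are
  -- killed by every arrow of `Γ` and only add one-dimensional summands.
  toFun m := (if k = p then m.1 else 0, Pi.single k (m.2.1 k), if k = p then m.2.2 else 0)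
  map_add' m n := by
    refine Prod.ext ?_ (Prod.ext ?_ ?_)
    · dsimp; split_ifs <;> simp
    · exact Pi.single_add k _ _
    · dsimp; split_ifs <;> simp
  map_smul' c m := by
    refine Prod.ext ?_ (Prod.ext ?_ ?_)
    · dsimp; split_ifs <;> simp
    · exact Pi.single_smul k c _
    · dsimp; split_ifs <;> simp

open Classical in
/-- The action of `(k|l)` on the representation with basis the paths ending at `p`. -/
noncomputable def arrowRep (p k l : V) : Module.End ℂ (ℂ × (V → ℂ) × ℂ) where
  toFun m := (0, Pi.single k (if l = p then m.1 else 0), if k = p then m.2.1 l else 0)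
  map_add' m n := by
    refine Prod.ext ?_ (Prod.ext ?_ ?_)
    · simp
    · refine Eq.trans (congrArg (Pi.single k) ?_) (Pi.single_add k _ _)
      split_ifs <;> simp
    · dsimp; split_ifs <;> simp
  map_smul' c m := by
    refine Prod.ext ?_ (Prod.ext ?_ ?_)
    · simp
    · refine Eq.trans (congrArg (Pi.single k) ?_) (Pi.single_smul k c _)
      split_ifs <;> simp
    · dsimp; split_ifs <;> simp

lemma sum_vertexRep (p : V) : ∑ k, vertexRep p k = 1 := by
  classical
  refine LinearMap.ext fun m => ?_
  rw [LinearMap.sum_apply]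
  refine Prod.ext ?_ (Prod.ext ?_ ?_)
  · rw [Prod.fst_sum]
    simp [vertexRep]
  · rw [Prod.snd_sum, Prod.fst_sum]
    simp only [vertexRep, LinearMap.coe_mk, AddHom.coe_mk]
    exact Finset.univ_sum_single m.2.1
  · rw [Prod.snd_sum, Prod.snd_sum]
    simp [vertexRep]

/-- The representation of the zig-zag algebra with basis the paths ending at `p`. -/
noncomputable def rep (p : V) : ZigZag Γ →ₐ[ℂ] Module.End ℂ (ℂ × (V → ℂ) × ℂ) :=
  RingQuot.liftAlgHom ℂ ⟨FreeAlgebra.lift ℂ fun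
    | QuiverGen.vertex k => vertexRep p k
    | QuiverGen.arrow k l _ => arrowRep p k l, by
      classical
      intro y z h
      cases h with
      | sum_vertex => simp only [map_sum, FreeAlgebra.lift_ι_apply, map_one, sum_vertexRep]
      -- Each remaining relation is an identity between explicit vectors, settled in each coordinate
      -- by cases on equality of vertices.
      | _ =>
        simp only [map_mul, map_zero, FreeAlgebra.lift_ι_apply]
        refine LinearMap.ext fun m => ?_
        simp only [Module.End.mul_apply, vertexRep, arrowRep, LinearMap.coe_mk, AddHom.coe_mk,
          LinearMap.zero_apply]
        refine Prod.ext ?_ (Prod.ext ?_ ?_) <;> dsimp only [Prod.fst_zero, Prod.snd_zero] <;>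
          (try split_ifs) <;> simp_all⟩

lemma rep_a (p i j : V) (h : Γ.Adj i j) : rep Γ p (a Γ i j h) = arrowRep p i j := by
  rw [rep, a, mk]
  exact (RingQuot.liftAlgHom_mkAlgHom_apply _ _ _ _).trans (FreeAlgebra.lift_ι_apply _ _)

variable {Γ}

/-- In the representation on paths ending at `i`, the arrow `(j|i)` sends the vector of `eᵢ` to that
of `(j|i)`, which `(i|j)` sends to that of `xᵢ`. So the relations do not kill the loop, and its
factors are nonzero as well. -/
lemma x_ne_zero {i j : V} (h : Γ.Adj i j) : x Γ i ≠ 0 := by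
  intro hx
  have h1 : rep Γ i (a Γ i j h * a Γ j i h.symm) (1, 0, 0) = 0 := by
    rw [a_mul_a, hx, map_zero, LinearMap.zero_apply]
  rw [map_mul, rep_a, rep_a, Module.End.mul_apply] at h1
  have h2 := congrArg (fun m => m.2.2) h1
  simp [arrowRep] at h2

lemma a_ne_zero {i j : V} (h : Γ.Adj i j) : a Γ i j h ≠ 0 := fun h' =>
  x_ne_zero h (by rw [← a_mul_a Γ i j h, h', zero_mul])

lemma e_ne_zero {i j : V} (h : Γ.Adj i j) : e Γ i ≠ 0 := fun h' =>
  x_ne_zero h (by rw [← e_mul_x, h', zero_mul])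

variable (Γ)

open Classical in
/-- The degrees of the paths from `i` to `j`. -/
noncomputable def degs (i j : V) : Finset ℤ := if i = j then {0, 2} else if Γ.Adj i j then {1} else ∅

open Classical in
/-- The path of degree `d` from `i` to `j`, if there is one. -/
noncomputable def path (i j : V) (d : ℤ) : ZigZag Γ :=
  if i = j then if d = 0 then e Γ i else if d = 2 then x Γ i else 0
  else if h : Γ.Adj i j then if d = 1 then a Γ i j h else 0 else 0

variable {Γ}

lemma path_eq_zero {i j : V} {d : ℤ} (h : d ∉ degs Γ i j) : path Γ i j d = 0 := by
  unfold degs at h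
  unfold path
  split_ifs at h ⊢ <;> simp_all

/-- At an isolated vertex `x` takes its default value `0` although `degs` still contains `2`; hence
the hypothesis that every vertex has a neighbour. -/
lemma path_ne_zero (hΓ : ∀ i, ∃ j, Γ.Adj i j) {i j : V} {d : ℤ} (h : d ∈ degs Γ i j) :
    path Γ i j d ≠ 0 := by
  obtain ⟨k, hk⟩ := hΓ i
  have h1 := x_ne_zero hk
  have h2 := e_ne_zero hk
  have h3 := fun h => a_ne_zero (Γ := Γ) (i := i) (j := j) h
  unfold degs at h
  unfold path
  split_ifs at h ⊢ <;> simp_all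

lemma e_mul_path (i j : V) (d : ℤ) : e Γ i * path Γ i j d = path Γ i j d := by
  unfold path
  split_ifs
  · exact e_mul_self Γ i
  · exact e_mul_x Γ i
  · exact mul_zero _
  · exact e_mul_a Γ i j _
  · exact mul_zero _
  · exact mul_zero _

lemma path_mul_e (i j : V) (d : ℤ) : path Γ i j d * e Γ j = path Γ i j d := by
  unfold path
  split_ifs with h
  · rw [h]; exact e_mul_self Γ j
  · rw [h]; exact x_mul_e Γ j
  · exact zero_mul _
  · exact a_mul_e Γ i j _
  · exact zero_mul _
  · exact zero_mul _

lemma path_mem (i j : V) (d : ℤ) : path Γ i j d ∈ grading Γ d := by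
  unfold path
  split_ifs with h h0 h2 h1 h0
  · rw [h0]; exact e_mem i
  · rw [h2]; exact x_mem i
  · exact Submodule.zero_mem _
  · rw [h0]; exact a_mem i j _
  · exact Submodule.zero_mem _
  · exact Submodule.zero_mem _

/-- A path of length at most two either fails to run from `i` to `j`, does not compose, is a
straight path `k → l → o` with `k ≠ o`, or is one of `eᵢ`, `(i|j)`, `xᵢ`. Longer ones vanish. -/
lemma corner_of_paths (i j : V) {n : ℕ} {y : ZigZag Γ} (hy : y ∈ paths Γ n) :
    e Γ i * y * e Γ j = path Γ i j n ∨ e Γ i * y * e Γ j = 0 := by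
  match n, hy with
  | 0, ⟨k, hk⟩ =>
    subst hk
    by_cases hik : i = k
    · subst hik
      by_cases hij : i = j
      · subst hij
        left
        simp [path, e_mul_self]
      · right
        rw [e_mul_self, e_mul_e Γ hij]
    · right
      rw [e_mul_e Γ hik, zero_mul]
  | 1, ⟨k, l, h, _, ⟨m, rfl⟩, hk⟩ =>
    subst hk
    by_cases hik : i = k
    · subst hik
      by_cases hlm : l = m
      · subst hlm
        by_cases hlj : l = j
        · subst hlj
          left
          rw [a_mul_e, e_mul_a, a_mul_e]
          simp [path, h, h.ne]
        · right
          rw [a_mul_e, e_mul_a, a_mul_e_of_ne Γ h hlj]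
      · right
        rw [a_mul_e_of_ne Γ h hlm, mul_zero, zero_mul]
    · right
      rw [← mul_assoc, e_mul_a_of_ne Γ h hik, zero_mul, zero_mul]
  | 2, ⟨k, l, h, _, ⟨m, o, h', _, ⟨q, rfl⟩, rfl⟩, hk⟩ =>
    subst hk
    by_cases hoq : o = q
    · subst hoq
      rw [a_mul_e]
      by_cases hlm : l = m
      · subst hlm
        by_cases hko : k = o
        · subst hko
          rw [a_mul_a]
          by_cases hik : i = k
          · subst hik
            by_cases hij : i = j
            · subst hij
              left
              rw [e_mul_x, x_mul_e]
              simp [path]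
            · right
              rw [e_mul_x, x_mul_e_of_ne hij]
          · right
            rw [e_mul_x_of_ne hik, zero_mul]
        · right
          rw [a_mul_a_of_ne' Γ h h' hko, mul_zero, zero_mul]
      · right
        rw [a_mul_a_of_ne Γ h h' hlm, mul_zero, zero_mul]
    · right
      rw [a_mul_e_of_ne Γ h' hoq, mul_zero, mul_zero, zero_mul]
  | n + 3, hy =>
    right
    rw [paths_eq_zero hy, mul_zero, zero_mul]

/-- The space `eᵢ A_d eⱼ` is spanned by the path of degree `d` from `i` to `j`. -/
lemma exists_corner_eq_smul (i j : V) {d : ℤ} {y : ZigZag Γ} (hy : y ∈ grading Γ d) :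
    ∃ c : ℂ, e Γ i * y * e Γ j = c • path Γ i j d := by
  unfold grading at hy
  induction hy using Submodule.span_induction with
  | zero => exact ⟨0, by simp⟩
  | add y z _ _ hy hz =>
    obtain ⟨b, hb⟩ := hy
    obtain ⟨c, hc⟩ := hz
    exact ⟨b + c, by rw [mul_add, add_mul, hb, hc, add_smul]⟩
  | smul b y _ hy =>
    obtain ⟨c, hc⟩ := hy
    exact ⟨b * c, by rw [mul_smul_comm, smul_mul_assoc, hc, mul_smul]⟩
  | mem y hy =>
    obtain ⟨n, rfl, hy⟩ := hy
    rcases corner_of_paths i j hy with h | h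
    · exact ⟨1, by rw [h, one_smul]⟩
    · exact ⟨0, by rw [h, zero_smul]⟩

lemma grading_eq_zero_of_neg {d : ℤ} (hd : d < 0) {y : ZigZag Γ} (hy : y ∈ grading Γ d) : y = 0 := by
  unfold grading at hy
  induction hy using Submodule.span_induction with
  | zero => rfl
  | add y z _ _ hy hz => rw [hy, hz, add_zero]
  | smul b y _ hy => rw [hy, smul_zero]
  | mem y hy =>
    obtain ⟨n, hn, hy⟩ := hy
    omega

/-- The coefficient of the path of degree `d` from `i` to `j`. -/
lemma exists_coeff (hΓ : ∀ i, ∃ j, Γ.Adj i j) (i j : V) : ∃ φ : ℤ → ZigZag Γ →ₗ[ℂ] ℂ,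
    (∀ d k, ∀ y ∈ grading Γ k, k ≠ d → φ d y = 0) ∧
    (∀ d ∈ degs Γ i j, φ d (path Γ i j d) = 1) ∧
    ∀ y, e Γ i * y * e Γ j = y → ∑ d ∈ degs Γ i j, φ d y • path Γ i j d = y := by
  -- A linear functional detects the nonzero path and can be rescaled to take the value `1` there.
  -- Precomposing with the projection to degree `d` below makes it homogeneous.
  have h : ∀ d, ∃ ψ : ZigZag Γ →ₗ[ℂ] ℂ, d ∈ degs Γ i j → ψ (path Γ i j d) = 1 := fun d => by
    by_cases hd : d ∈ degs Γ i j
    · obtain ⟨ψ, hψ⟩ := not_forall.1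
        (mt (Module.forall_dual_apply_eq_zero_iff ℂ _).1 (path_ne_zero hΓ hd))
      exact ⟨(ψ (path Γ i j d))⁻¹ • ψ, fun _ => inv_mul_cancel₀ hψ⟩
    · exact ⟨0, fun h => absurd h hd⟩
  choose ψ hψ using h
  refine ⟨fun d => ψ d ∘ₗ proj (grading Γ) isInternal_grading d, fun d k y hy hk => ?_,
    fun d hd => ?_, fun y hy => ?_⟩
  · rw [LinearMap.comp_apply, proj_of_mem _ _ hy, if_neg hk.symm, map_zero]
  · rw [LinearMap.comp_apply, proj_of_mem _ _ (path_mem i j d), if_pos rfl, hψ d hd]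
  · have h1 : ∀ d, ∃ c : ℂ, proj (grading Γ) isInternal_grading d y = c • path Γ i j d := fun d => by
      obtain ⟨c, hc⟩ := exists_corner_eq_smul i j (proj_mem (grading Γ) isInternal_grading d y)
      exact ⟨c, by rw [← hc, ← proj_e_mul, ← proj_mul_e, hy]⟩
    obtain ⟨s, hs⟩ := exists_sum_proj isInternal_grading y
    conv_rhs => rw [← hs (s ∪ degs Γ i j) Finset.subset_union_left]
    -- The element is the sum of its homogeneous parts; those outside `degs` are multiples of a zero
    -- path and drop out.
    rw [← Finset.sum_subset Finset.subset_union_right]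
    · refine Finset.sum_congr rfl fun d hd => ?_
      obtain ⟨c, hc⟩ := h1 d
      rw [LinearMap.comp_apply, hc, map_smul, hψ d hd, smul_eq_mul, mul_one]
    · intro d _ hd
      obtain ⟨c, hc⟩ := h1 d
      rw [hc, path_eq_zero hd, smul_zero]

end ZigZag

end Corners

/-! ### Homogeneous parts of linear maps and splittings of graded modules. -/

section DegreePart

variable {A : Type u} [Ring A] [Algebra ℂ A] {𝒜 : ℤ → Submodule ℂ A}

lemma induction_homogeneous {M : Type*} [AddCommGroup M] [Module ℂ M] {gr : ℤ → Submodule ℂ M}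
    (h : DirectSum.IsInternal gr) {p : M → Prop} (zero : p 0)
    (add : ∀ x y, p x → p y → p (x + y)) (mem : ∀ k, ∀ x ∈ gr k, p x) (x : M) : p x := by
  have hx : x ∈ ⨆ k, gr k := by rw [iSup_eq_top_of_isInternal h]; trivial
  induction hx using Submodule.iSup_induction' with
  | zero => exact zero
  | add x y _ _ hx hy => exact add x y hx hy
  | mem k x hx => exact mem k x hx

lemma proj_comm_of_map_mem {M N : Type*} [AddCommGroup M] [Module ℂ M] [AddCommGroup N] [Module ℂ N]
    {gr : ℤ → Submodule ℂ M} (h : DirectSum.IsInternal gr) {gr' : ℤ → Submodule ℂ N}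
    (h' : DirectSum.IsInternal gr') (f : M →ₗ[ℂ] N) (hf : ∀ k, ∀ m ∈ gr k, f m ∈ gr' k) (n : ℤ)
    (m : M) : proj gr' h' n (f m) = f (proj gr h n m) := by
  induction m using induction_homogeneous h with
  | zero => simp
  | add x y hx hy => simp only [map_add, hx, hy]
  | mem k x hx =>
    rw [proj_of_mem _ _ hx, proj_of_mem _ _ (hf k x hx)]
    split_ifs <;> simp

lemma proj_smul_right [GradedAlgebra 𝒜] (M : GrMod 𝒜) (n : ℤ) (a : A) {l : ℤ} {m : M.carrier}
    (hm : m ∈ M.gr l) : proj M.gr M.isInternal n (a • m) =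
      proj 𝒜 (DirectSum.Decomposition.isInternal 𝒜) (n - l) a • m := by
  induction a using induction_homogeneous (DirectSum.Decomposition.isInternal 𝒜) with
  | zero => simp
  | add x y hx hy => rw [add_smul, map_add, map_add, add_smul, hx, hy]
  | mem k a ha =>
    rw [proj_of_mem _ _ (M.smul_mem ha hm), proj_of_mem _ _ ha]
    by_cases h : n = k + l
    · rw [if_pos h, if_pos (by omega)]
    · rw [if_neg h, if_neg (by omega), zero_smul]

/-- The degree-preserving part of a linear map between graded modules. -/
lemma exists_degreePart [GradedAlgebra 𝒜] (M N : GrMod 𝒜) (f : M.carrier →ₗ[A] N.carrier) :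
    ∃ g : M ⟶ N, ∀ k, ∀ m ∈ M.gr k, GrMod.Hom.lin g m = proj N.gr N.isInternal k (f m) := by
  -- On `Mₖ` the map `f` is followed by the projection to degree `k`. This is `A`-linear because a
  -- homogeneous scalar raises the degrees of `m` and of `f m` by the same amount.
  let g : M.carrier →ₗ[ℂ] N.carrier :=
    DirectSum.toModule ℂ ℤ N.carrier (fun k => proj N.gr N.isInternal k ∘ₗ f.restrictScalars ℂ ∘ₗ
      (M.gr k).subtype) ∘ₗ (components M.isInternal).toLinearMap
  have hg : ∀ k, ∀ m ∈ M.gr k, g m = proj N.gr N.isInternal k (f m) := fun k m hm => by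
    simp [g, components_of_mem M.isInternal hm]
  have hg' : ∀ (a : A) (m : M.carrier), g (a • m) = a • g m := fun a m => by
    induction a using induction_homogeneous (DirectSum.Decomposition.isInternal 𝒜) with
    | zero => simp
    | add x y hx hy => rw [add_smul, map_add, hx, hy, add_smul]
    | mem k a ha =>
      induction m using induction_homogeneous M.isInternal with
      | zero => simp
      | add x y hx hy => rw [smul_add, map_add, hx, hy, map_add, smul_add]
      | mem l m hm =>
        rw [hg _ _ (M.smul_mem ha hm), hg _ _ hm, map_smul, GrBimod.proj_smul N ha,
          add_sub_cancel_left]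
  refine ⟨GrMod.ofLin { g with map_smul' := hg' } fun k m hm => ?_, hg⟩
  change g m ∈ _
  rw [hg k m hm]
  exact proj_mem _ _ _ _

/-- The kernel of a morphism of graded modules. -/
noncomputable def GrMod.ker {M N : GrMod 𝒜} (f : M ⟶ N) : GrMod 𝒜 where
  carrier := LinearMap.ker (GrMod.Hom.lin f)
  gr k := (M.gr k).comap ((LinearMap.ker (GrMod.Hom.lin f)).subtype.restrictScalars ℂ)
  isInternal := isInternal_comap M.isInternal
    ((LinearMap.ker (GrMod.Hom.lin f)).subtype.restrictScalars ℂ) Subtype.val_injective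
    fun n y => ⟨⟨proj M.gr M.isInternal n y.1, by
      have h := proj_comm_of_map_mem M.isInternal N.isInternal
        ((GrMod.Hom.lin f).restrictScalars ℂ) (fun k m hm => GrMod.Hom.map_mem f hm) n y.1
      refine LinearMap.mem_ker.2 (h.symm.trans ?_)
      rw [LinearMap.restrictScalars_apply, LinearMap.mem_ker.1 y.2, map_zero]⟩, rfl⟩
  smul_mem := fun ha hm => M.smul_mem ha hm

/-- The decomposition given by a split monomorphism. -/
noncomputable def GrMod.splitBicone {P M : GrMod 𝒜} (i : P ⟶ M) (r : M ⟶ P) (h : i ≫ r = 𝟙 P) :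
    BinaryBicone P (GrMod.ker r) where
  pt := M
  inl := i
  fst := r
  inr := GrMod.ofLin (M := GrMod.ker r) (LinearMap.ker (GrMod.Hom.lin r)).subtype fun _ _ hm => hm
  snd := GrMod.ofLin (N := GrMod.ker r)
    ((LinearMap.id - GrMod.Hom.lin i ∘ₗ GrMod.Hom.lin r).codRestrict _ fun m => by
      have h' := LinearMap.congr_fun (congrArg GrMod.Hom.lin h) (GrMod.Hom.lin r m)
      rw [LinearMap.mem_ker, LinearMap.sub_apply, map_sub, sub_eq_zero]
      exact h'.symm) fun k m hm => (M.gr k).sub_mem hm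
        (GrMod.Hom.map_mem i (GrMod.Hom.map_mem r hm))
  inl_fst := h
  inl_snd := GrMod.hom_ext (LinearMap.ext fun m => Subtype.ext (by
    have h' := LinearMap.congr_fun (congrArg GrMod.Hom.lin h) m
    change GrMod.Hom.lin i m - GrMod.Hom.lin i (GrMod.Hom.lin r (GrMod.Hom.lin i m)) = 0
    rw [sub_eq_zero]
    exact congrArg _ h'.symm))
  inr_fst := GrMod.hom_ext (LinearMap.ext fun m => m.2)
  inr_snd := GrMod.hom_ext (LinearMap.ext fun m => Subtype.ext (by
    change m.1 - GrMod.Hom.lin i (GrMod.Hom.lin r m.1) = m.1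
    rw [LinearMap.mem_ker.1 m.2, map_zero, sub_zero]))

lemma GrMod.splitBicone_total {P M : GrMod 𝒜} (i : P ⟶ M) (r : M ⟶ P) (h : i ≫ r = 𝟙 P) :
    (splitBicone i r h).fst ≫ (splitBicone i r h).inl +
      (splitBicone i r h).snd ≫ (splitBicone i r h).inr = 𝟙 M :=
  GrMod.hom_ext (LinearMap.ext fun m : M.carrier => by
    change GrMod.Hom.lin i (GrMod.Hom.lin r m) + (m - GrMod.Hom.lin i (GrMod.Hom.lin r m)) = m
    rw [add_sub_cancel])

lemma GrMod.fgProj_of_bicone {P N : GrMod 𝒜} (b : BinaryBicone P N) (h : GrMod.fgProj b.pt) :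
    GrMod.fgProj N := by
  have := h.1
  have := h.2
  have h1 : Hom.lin b.snd ∘ₗ Hom.lin b.inr = LinearMap.id := congrArg Hom.lin b.inr_snd
  exact ⟨Module.Finite.of_surjective (Hom.lin b.snd)
    (fun x => ⟨Hom.lin b.inr x, LinearMap.congr_fun h1 x⟩),
    Module.Projective.of_split (Hom.lin b.inr) (Hom.lin b.snd) h1⟩

end DegreePart

/-! ### The classes `[Pᵢ]` generate the Grothendieck group. -/

namespace ZigZag

variable {V : Type u} [Fintype V] {Γ : SimpleGraph V}

/-- The degree zero part of `A` is spanned by the orthogonal idempotents, so `eⱼA₀` is the line of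
`eⱼ`. That `eⱼAeⱼ` is thus local with residue field `ℂ` is what makes the splitting in
`exists_split` possible. -/
lemma proj_zero_e_mul (j : V) (y : ZigZag Γ) (hy : e Γ j * y = y) :
    ∃ c : ℂ, proj (grading Γ) isInternal_grading 0 y = c • e Γ j := by
  have h : ∀ z ∈ grading Γ 0, ∃ c : ℂ, e Γ j * z = c • e Γ j := fun z hz => by
    unfold grading at hz
    induction hz using Submodule.span_induction with
    | zero => exact ⟨0, by simp⟩
    | add y z _ _ hy hz =>
      obtain ⟨b, hb⟩ := hy
      obtain ⟨c, hc⟩ := hz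
      exact ⟨b + c, by rw [mul_add, hb, hc, add_smul]⟩
    | smul b y _ hy =>
      obtain ⟨c, hc⟩ := hy
      exact ⟨b * c, by rw [mul_smul_comm, hc, mul_smul]⟩
    | mem y hy =>
      obtain ⟨n, hn, hy⟩ := hy
      obtain rfl : n = 0 := by exact_mod_cast hn
      obtain ⟨k, rfl⟩ := hy
      by_cases hk : j = k
      · subst hk
        exact ⟨1, by rw [e_mul_self, one_smul]⟩
      · exact ⟨0, by rw [e_mul_e Γ hk, zero_smul]⟩
  obtain ⟨c, hc⟩ := h _ (proj_mem (grading Γ) isInternal_grading 0 y)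
  exact ⟨c, by rw [← hc, ← proj_e_mul, hy]⟩

/-- The morphism `Pⱼ⟨k⟩ → M` sending `eⱼ` to an element of `eⱼ Mₖ`. -/
noncomputable def homOfMem {M : GrMod (grading Γ)} {k : ℤ} (j : V) {m : M.carrier}
    (hm : m ∈ M.gr k) : GrMod.shift k (projModule Γ j) ⟶ M :=
  GrMod.ofLin (M := GrMod.shift k (projModule Γ j))
    ((LinearMap.toSpanSingleton (ZigZag Γ) M.carrier m) ∘ₗ (P Γ j).subtype) fun l y hy => by
      have h := M.smul_mem (show y.1 ∈ grading Γ (l - k) from hy) hm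
      rwa [sub_add_cancel] at h

/-- The lowest degree part of a projective module splits off a summand. -/
lemma exists_split (M : GrMod (grading Γ)) (hM : GrMod.fgProj M) {k : ℤ} {j : V} {m : M.carrier}
    (hm : m ∈ M.gr k) (hm0 : m ≠ 0) (hj : e Γ j • m = m)
    (hk : ∀ l, l < k → ∀ y ∈ M.gr l, y = 0) :
    ∃ (i : GrMod.shift k (projModule Γ j) ⟶ M) (r : M ⟶ GrMod.shift k (projModule Γ j)),
      i ≫ r = 𝟙 _ ∧ GrMod.Hom.lin r m ≠ 0 := by
  have := hM.1
  have := hM.2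
  obtain ⟨n, p, s, -, -, hps⟩ := Module.Finite.exists_comp_eq_id_of_projective (ZigZag Γ) M.carrier
  -- A graded Nakayama argument. The element `m` is `∑ s(m)ₜ p(eₜ)`; if no coefficient had a part of
  -- degree zero, nothing would remain in degree `k`, since `M` starts in degree `k` and `A` has no
  -- negative degrees.
  have h1 : ∃ t, proj (grading Γ) isInternal_grading 0 (s m t) ≠ 0 := by
    by_contra! h
    refine hm0 ?_
    have h2 : m = ∑ t, s m t • p (Pi.single t 1) := by
      conv_lhs => rw [← show p (s m) = m from LinearMap.congr_fun hps m, pi_eq_sum_univ' (s m)]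
      simp [map_sum]
    have h3 : ∀ (a : ZigZag Γ) (y : M.carrier), proj (grading Γ) isInternal_grading 0 a = 0 →
        proj M.gr M.isInternal k (a • y) = 0 := fun a y ha => by
      induction y using induction_homogeneous M.isInternal with
      | zero => simp
      | add x y hx hy => rw [smul_add, map_add, hx, hy, add_zero]
      | mem l y hy =>
        rcases lt_trichotomy l k with hl | hl | hl
        · rw [hk l hl y hy, smul_zero, map_zero]
        · subst hl
          rw [proj_smul_right M _ a hy, sub_self, ha, zero_smul]
        · rw [proj_smul_right M _ a hy,
            grading_eq_zero_of_neg (by omega) (proj_mem (grading Γ) _ (k - l) a), zero_smul]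
    have h4 : proj M.gr M.isInternal k m = m := by rw [proj_of_mem _ _ hm, if_pos rfl]
    rw [← h4, h2, map_sum]
    exact Finset.sum_eq_zero fun t _ => h3 _ _ (h t)
  obtain ⟨t, ht⟩ := h1
  -- The `t`-th coordinate in the free module followed by right multiplication by `eⱼ`. Its
  -- degree-preserving part `g` sends `m` to a nonzero multiple `c` of `eⱼ`.
  let f : M.carrier →ₗ[ZigZag Γ] P Γ j :=
    (LinearMap.toSpanSingleton (ZigZag Γ) (P Γ j) ⟨e Γ j, e_mem_P Γ j⟩) ∘ₗ LinearMap.proj t ∘ₗ s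
  obtain ⟨g, hg⟩ := exists_degreePart M (GrMod.shift k (projModule Γ j)) f
  have hst : e Γ j * s m t = s m t := by
    conv_rhs => rw [← hj, map_smul]
    rfl
  obtain ⟨c, hc⟩ := proj_zero_e_mul j _ hst
  have hc0 : c ≠ 0 := fun h => ht (by rw [hc, h, zero_smul])
  have hgm : GrMod.Hom.lin g m = c • (⟨e Γ j, e_mem_P Γ j⟩ : P Γ j) := by
    rw [hg k m hm]
    refine Subtype.ext ?_
    have h5 := proj_comm_of_map_mem (GrMod.shift k (projModule Γ j)).isInternal
      (isInternal_reindex isInternal_grading k) ((P Γ j).subtype.restrictScalars ℂ)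
      (fun l y hy => hy) k (f m)
    have h6 : ∀ y, proj _ (isInternal_reindex isInternal_grading k) k y =
        proj (grading Γ) isInternal_grading 0 y := fun y => by
      induction y using induction_homogeneous isInternal_grading with
      | zero => simp
      | add x y hx hy => rw [map_add, map_add, hx, hy]
      | mem l y hy =>
        rw [proj_of_mem _ _ hy, proj_of_mem (k := l + k) _ _ (by simpa using hy)]
        congr 1
        exact propext (by omega)
    refine h5.symm.trans ((h6 _).trans ?_)
    change proj (grading Γ) isInternal_grading 0 (s m t * e Γ j) = c • e Γ j
    rw [proj_mul_e, hc, smul_mul_assoc, e_mul_self]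
  -- The inclusion sends `eⱼ` to `m`; dividing `g` by `c` gives a retraction of it.
  refine ⟨homOfMem j hm, g ≫ GrMod.ofLin (M := GrMod.shift k (projModule Γ j))
    (N := GrMod.shift k (projModule Γ j)) (c⁻¹ • LinearMap.id)
    fun l y hy => Submodule.smul_mem _ _ hy, ?_, fun h => hm0 ?_⟩
  · refine GrMod.hom_ext (LinearMap.ext fun y => ?_)
    change c⁻¹ • GrMod.Hom.lin g (y.1 • m) = y
    rw [map_smul, hgm, smul_comm, inv_smul_smul₀ hc0]
    exact Subtype.ext (mem_P.1 y.2)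
  · change c⁻¹ • GrMod.Hom.lin g m = 0 at h
    rw [hgm, inv_smul_smul₀ hc0] at h
    rw [← hj, show e Γ j = 0 from congrArg Subtype.val h, zero_smul]

instance finite_of_fgProj (M : GrMod (grading Γ)) [Module.Finite (ZigZag Γ) M.carrier] :
    Module.Finite ℂ M.carrier := Module.Finite.trans (ZigZag Γ) M.carrier

/-- The class of `Pᵢ`. -/
noncomputable abbrev projClass (Γ : SimpleGraph V) (i : V) : K0 (Cat Γ) := K0.of (projObj Γ i)

lemma T_smul_projClass (k : ℤ) (j : V)
    (h : GrMod.fgProj (GrMod.shift k (projModule Γ j))) :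
    K0.of (ProjHomotopyCategory.single (GrMod.shift k (projModule Γ j)) h) =
      (LaurentPolynomial.T k : ℤ[T;T⁻¹]) • projClass Γ j := by
  rw [T_smul_of]
  exact K0.of_complex_iso ((HomologicalComplex.singleMapHomologicalComplex
    (GrMod.shiftFunctor (𝒜 := grading Γ) k) (ComplexShape.up ℤ) 0).symm.app (projModule Γ j)) _ _

/-- Finite dimension leaves finitely many nonzero degrees, hence a lowest one. As the `eⱼ` sum to
`1`, some `eⱼ` acts nontrivially on a given nonzero vector there. -/
lemma exists_lowest {M : GrMod (grading Γ)} [Module.Finite ℂ M.carrier] [Nontrivial M.carrier] :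
    ∃ (k : ℤ) (j : V) (m : M.carrier), m ∈ M.gr k ∧ m ≠ 0 ∧ e Γ j • m = m ∧
      ∀ l, l < k → ∀ y ∈ M.gr l, y = 0 := by
  have hind := ((DirectSum.isInternal_submodule_iff_iSupIndep_and_iSup_eq_top M.gr).1 M.isInternal).1
  have hfin : {k | M.gr k ≠ ⊥}.Finite := WellFoundedGT.finite_ne_bot_of_iSupIndep hind
  have hne : {k | M.gr k ≠ ⊥}.Nonempty := by
    by_contra h
    rw [Set.not_nonempty_iff_eq_empty, Set.eq_empty_iff_forall_notMem] at h
    simp only [Set.mem_ofPred_eq, not_not] at h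
    have h1 := iSup_eq_top_of_isInternal M.isInternal
    simp only [h, iSup_bot] at h1
    exact bot_ne_top h1
  obtain ⟨k, hk, hmin⟩ := Set.exists_min_image _ id hfin hne
  obtain ⟨m, hm, hm0⟩ := Submodule.exists_mem_ne_zero_of_ne_bot hk
  have h2 : ∃ j, e Γ j • m ≠ 0 := by
    by_contra! h
    refine hm0 ?_
    rw [← one_smul (ZigZag Γ) m, ← sum_e, Finset.sum_smul]
    exact Finset.sum_eq_zero fun j _ => h j
  obtain ⟨j, hj⟩ := h2
  refine ⟨k, j, e Γ j • m, ?_, hj, ?_, fun l hl y hy => ?_⟩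
  · have := M.smul_mem (e_mem j) hm
    rwa [zero_add] at this
  · rw [← mul_smul, e_mul_self]
  · by_contra h0
    exact absurd (hmin l fun h => h0 (by rw [h] at hy; exact hy)) (by simpa using hl)

/-- The class of a graded projective module is a combination of the classes of the `Pᵢ`. -/
lemma single_mem_span (n : ℕ) : ∀ (M : GrMod (grading Γ)) (hM : GrMod.fgProj M),
    Module.finrank ℂ M.carrier ≤ n → K0.of (ProjHomotopyCategory.single M hM) ∈
      Submodule.span ℤ[T;T⁻¹] (Set.range (projClass Γ)) := by
  have hz : ∀ (M : GrMod (grading Γ)) (hM : GrMod.fgProj M), Subsingleton M.carrier →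
      K0.of (ProjHomotopyCategory.single M hM) = 0 := fun M hM h => by
    refine K0.of_isZero ?_
    rw [IsZero.iff_id_eq_zero]
    refine ObjectProperty.hom_ext _ ?_
    exact ((HomotopyCategory.quotient _ _).map_isZero ((HomologicalComplex.single _ _ _).map_isZero
      ((GrMod.isZero_iff M).2 h))).eq_of_src _ _
  induction n with
  | zero =>
    intro M hM hn
    have := hM.1
    rw [hz M hM (Module.finrank_zero_iff.1 (Nat.le_zero.1 hn))]
    exact Submodule.zero_mem _
  | succ n ih =>
    intro M hM hn
    have := hM.1
    rcases subsingleton_or_nontrivial M.carrier with h | h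
    · rw [hz M hM h]
      exact Submodule.zero_mem _
    obtain ⟨k, j, m, hm, hm0, hj, hk⟩ := exists_lowest (M := M)
    obtain ⟨i, r, hir, hr⟩ := exists_split M hM hm hm0 hj hk
    have hP : GrMod.fgProj (GrMod.shift k (projModule Γ j)) :=
      ⟨inferInstanceAs (Module.Finite (ZigZag Γ) (P Γ j)),
        inferInstanceAs (Module.Projective (ZigZag Γ) (P Γ j))⟩
    have hN := GrMod.fgProj_of_bicone (GrMod.splitBicone i r hir) hM
    rw [show K0.of (ProjHomotopyCategory.single M hM) = _ from K0.of_single_biprod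
      (GrMod.splitBicone i r hir) (GrMod.splitBicone_total i r hir) hP hN hM]
    refine Submodule.add_mem _ ?_ (ih _ hN ?_)
    · rw [T_smul_projClass]
      exact Submodule.smul_mem _ _ (Submodule.subset_span ⟨j, rfl⟩)
    -- The retraction does not kill `m`, so the complement `ker r` has strictly smaller dimension
    -- and the induction hypothesis applies.
    · have h1 : LinearMap.ker (GrMod.Hom.lin r) ≠ ⊤ := fun h1 => hr <|
        LinearMap.mem_ker.1 (h1 ▸ Submodule.mem_top)
      have h2 : ((LinearMap.ker (GrMod.Hom.lin r)).restrictScalars ℂ) ≠ ⊤ := by simpa using h1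
      have := Submodule.finrank_lt h2
      change Module.finrank ℂ ((LinearMap.ker (GrMod.Hom.lin r)).restrictScalars ℂ) ≤ n
      omega

lemma span_projClass : Submodule.span ℤ[T;T⁻¹] (Set.range (projClass Γ)) = ⊤ := by
  rw [eq_top_iff]
  exact fun y _ => K0.mem_of_single_mem (Submodule.span ℤ[T;T⁻¹] (Set.range (projClass Γ))).toAddSubgroup
    (fun M hM => single_mem_span _ M hM le_rfl) y

end ZigZag

lemma proj_reindex {M : Type*} [AddCommGroup M] [Module ℂ M] {gr : ℤ → Submodule ℂ M}
    (h : DirectSum.IsInternal gr) (n k : ℤ) :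
    proj (fun k => gr (k - n)) (isInternal_reindex h n) k = proj gr h (k - n) := by
  refine LinearMap.ext fun y => ?_
  induction y using induction_homogeneous h with
  | zero => simp
  | add x y hx hy => rw [map_add, map_add, hx, hy]
  | mem l y hy =>
    rw [proj_of_mem _ _ hy, proj_of_mem (k := l + n) _ _ (by simpa using hy)]
    congr 1
    exact propext (by omega)

/-- Additive maps that commute with the shift of the grading are linear. -/
lemma K0.map_smul_of_shift {A : Type u} [Ring A] [Algebra ℂ A] {𝒜 : ℤ → Submodule ℂ A}
    {N : Type*} [AddCommGroup N] [Module ℤ[T;T⁻¹] N] (f : K0 (ProjHomotopyCategory 𝒜) →+ N)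
    (hf : ∀ n X, f (K0.of ((gradingShift n).obj X)) =
      (LaurentPolynomial.T n : ℤ[T;T⁻¹]) • f (K0.of X))
    (p : ℤ[T;T⁻¹]) (y : K0 (ProjHomotopyCategory 𝒜)) : f (p • y) = p • f y := by
  induction p using LaurentPolynomial.induction_on' with
  | add p q hp hq => rw [add_smul, map_add, hp, hq, add_smul]
  | C_mul_T n a =>
    have h : f.comp (DistribSMul.toAddMonoidHom _ (LaurentPolynomial.T n : ℤ[T;T⁻¹])) =
        (DistribSMul.toAddMonoidHom _ (LaurentPolynomial.T n : ℤ[T;T⁻¹])).comp f :=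
      K0.hom_ext fun X => by
        change f ((LaurentPolynomial.T n : ℤ[T;T⁻¹]) • K0.of X) = _
        rw [T_smul_of, hf]
        rfl
    have h' : f ((LaurentPolynomial.T n : ℤ[T;T⁻¹]) • y) =
      (LaurentPolynomial.T n : ℤ[T;T⁻¹]) • f y := DFunLike.congr_fun h y
    have ha : (LaurentPolynomial.C a : ℤ[T;T⁻¹]) = (a : ℤ[T;T⁻¹]) :=
      eq_intCast (LaurentPolynomial.C : ℤ →+* ℤ[T;T⁻¹]) a
    rw [ha, mul_smul, mul_smul, Int.cast_smul_eq_zsmul, Int.cast_smul_eq_zsmul, map_zsmul, h']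

/-! ### Corner traces, the Cartan matrix and the basis of the Grothendieck group. -/

namespace ZigZag

variable {V : Type u} [Fintype V] {Γ : SimpleGraph V}

/-- The projection of a graded module onto `eᵢ Mₖ`. -/
noncomputable def corner (i : V) (k : ℤ) (M : GrMod (grading Γ)) : M.carrier →ₗ[ℂ] M.carrier :=
  Algebra.lsmul ℂ ℂ M.carrier (e Γ i) ∘ₗ proj M.gr M.isInternal k

lemma corner_apply (i : V) (k : ℤ) (M : GrMod (grading Γ)) (m : M.carrier) :
    corner i k M m = e Γ i • proj M.gr M.isInternal k m := rfl

/-- Morphisms are `A`-linear and preserve degrees, so they commute with both factors of `corner`.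
Naturality is what lets `cornerTrace` inherit cyclicity from the ordinary trace. -/
lemma corner_naturality (i : V) (k : ℤ) {M N : GrMod (grading Γ)} (f : M ⟶ N) :
    corner i k N ∘ₗ (GrMod.Hom.lin f).restrictScalars ℂ =
      (GrMod.Hom.lin f).restrictScalars ℂ ∘ₗ corner i k M := by
  refine LinearMap.ext fun m => ?_
  have h := proj_comm_of_map_mem M.isInternal N.isInternal ((GrMod.Hom.lin f).restrictScalars ℂ)
    (fun k m hm => GrMod.Hom.map_mem f hm) k m
  rw [LinearMap.comp_apply, LinearMap.comp_apply, corner_apply, corner_apply, h]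
  exact (map_smul (GrMod.Hom.lin f) _ _).symm

/-- The trace of an endomorphism on `eᵢ Mₖ`. -/
noncomputable def cornerTrace (Γ : SimpleGraph V) (i : V) (k : ℤ) :
    TraceFunction (GrMod.fgProj (𝒜 := grading Γ)) ℂ where
  tr M :=
    { toFun := fun f => LinearMap.trace ℂ M.carrier
        ((GrMod.Hom.lin f).restrictScalars ℂ ∘ₗ corner i k M)
      map_zero' := map_zero _
      map_add' := fun f g => map_add (LinearMap.trace ℂ M.carrier)
        ((GrMod.Hom.lin f).restrictScalars ℂ ∘ₗ corner i k M)
        ((GrMod.Hom.lin g).restrictScalars ℂ ∘ₗ corner i k M) }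
  -- `LinearMap.trace` is zero by convention without a finite basis, so finite generation over the
  -- finite-dimensional algebra is used for cyclicity.
  tr_comp {M N} f g hM hN := by
    have := hM.1
    have := hN.1
    change LinearMap.trace ℂ M.carrier ((GrMod.Hom.lin g).restrictScalars ℂ ∘ₗ
      ((GrMod.Hom.lin f).restrictScalars ℂ ∘ₗ corner i k M)) =
      LinearMap.trace ℂ N.carrier ((GrMod.Hom.lin f).restrictScalars ℂ ∘ₗ
      ((GrMod.Hom.lin g).restrictScalars ℂ ∘ₗ corner i k N))
    rw [LinearMap.trace_comp_comm', ← corner_naturality i k g]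
    rfl

lemma cornerTrace_dim (i : V) (k : ℤ) (M : GrMod (grading Γ)) :
    (cornerTrace Γ i k).dim M = LinearMap.trace ℂ M.carrier (corner i k M) := rfl

lemma cornerTrace_dim_shift (i : V) (k n : ℤ) (M : GrMod (grading Γ)) :
    (cornerTrace Γ i k).dim (GrMod.shift n M) = (cornerTrace Γ i (k - n)).dim M := by
  rw [cornerTrace_dim, cornerTrace_dim]
  have : corner i k (GrMod.shift n M) = corner i (k - n) M :=
    LinearMap.ext fun m => congrArg (e Γ i • ·)
      (LinearMap.congr_fun (proj_reindex M.isInternal n k) m)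
  exact congrArg (LinearMap.trace ℂ M.carrier) this

lemma val_corner (i j : V) (k : ℤ) (y : P Γ j) : (corner i k (projModule Γ j) y).1 =
    e Γ i * proj (grading Γ) isInternal_grading k y.1 * e Γ j := by
  have h := proj_comm_of_map_mem (isInternal_gradingP Γ j) isInternal_grading
    ((P Γ j).subtype.restrictScalars ℂ) (fun l y hy => hy) k y
  change e Γ i * (proj (gradingP Γ j) (isInternal_gradingP Γ j) k y).1 = _
  rw [mul_assoc, ← proj_mul_e, mem_P.1 y.2]
  exact congrArg (e Γ i * ·) h.symm

-- The corner map on `Pⱼ` is the projection onto the line of the path of degree `k` from `i` to `j`,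
-- if there is one, and zero otherwise; the trace of a projection is its rank.
open Classical in
lemma cornerTrace_dim_projModule (hΓ : ∀ i, ∃ j, Γ.Adj i j) (i j : V) (k : ℤ) :
    (cornerTrace Γ i k).dim (projModule Γ j) = if k ∈ degs Γ i j then 1 else 0 := by
  rw [cornerTrace_dim]
  have h1 : ∀ y : P Γ j, ∃ c : ℂ, (corner i k (projModule Γ j) y).1 = c • path Γ i j k := fun y => by
    rw [val_corner]
    exact exists_corner_eq_smul i j (proj_mem _ _ _ _)
  split_ifs with hk
  · let z : P Γ j := ⟨path Γ i j k, mem_P.2 (path_mul_e i j k)⟩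
    have hz : z ≠ 0 := fun h => path_ne_zero hΓ hk (congrArg Subtype.val h)
    have hp : LinearMap.IsProj (Submodule.span ℂ {z}) (corner i k (projModule Γ j)) :=
      { map_mem := fun y => by
          obtain ⟨c, hc⟩ := h1 y
          exact Submodule.mem_span_singleton.2 ⟨c, Subtype.ext hc.symm⟩
        map_id := fun y hy => by
          obtain ⟨c, rfl⟩ := Submodule.mem_span_singleton.1 hy
          rw [map_smul]
          congr 1
          refine Subtype.ext ?_
          rw [val_corner, proj_of_mem _ _ (path_mem i j k), if_pos rfl, e_mul_path, path_mul_e] }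
    rw [hp.trace, finrank_span_singleton hz, Nat.cast_one]
  · have : corner i k (projModule Γ j) = 0 := LinearMap.ext fun y => by
      obtain ⟨c, hc⟩ := h1 y
      rw [path_eq_zero hk, smul_zero] at hc
      exact Subtype.ext hc
    rw [this, map_zero]

lemma cornerTrace_euler_T_smul (i : V) (k n : ℤ) (y : K0 (Cat Γ)) :
    (cornerTrace Γ i k).eulerK0 ((LaurentPolynomial.T n : ℤ[T;T⁻¹]) • y) =
      (cornerTrace Γ i (k - n)).eulerK0 y := by
  have h : (cornerTrace Γ i k).eulerK0.comp (DistribSMul.toAddMonoidHom (K0 (Cat Γ))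
      (LaurentPolynomial.T n : ℤ[T;T⁻¹])) = (cornerTrace Γ i (k - n)).eulerK0 :=
    K0.hom_ext fun X => by
      change (cornerTrace Γ i k).eulerK0 ((LaurentPolynomial.T n : ℤ[T;T⁻¹]) • K0.of X) = _
      rw [T_smul_of, TraceFunction.eulerK0_of, TraceFunction.eulerK0_of]
      exact finsum_congr fun m => congrArg (m.negOnePow • ·) (cornerTrace_dim_shift i k n _)
  exact DFunLike.congr_fun h y

/-- The graded dimension of `eᵢ A eⱼ`. -/
noncomputable def cartan (Γ : SimpleGraph V) (i j : V) : ℤ[T;T⁻¹] :=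
  ∑ d ∈ degs Γ i j, LaurentPolynomial.T d

/-- As `k` varies, these functionals record the graded dimension of `eᵢ` applied to a class, and
multiplication by `T` translates `k`. All coefficients of `p * cartan Γ i j` can thus be recovered.
-/
lemma cornerTrace_euler_smul_projClass (hΓ : ∀ i, ∃ j, Γ.Adj i j) (i j : V) (k : ℤ)
    (p : ℤ[T;T⁻¹]) : (cornerTrace Γ i k).eulerK0 (p • projClass Γ j) =
      ((p * cartan Γ i j).coeff k : ℤ) := by
  classical
  induction p using LaurentPolynomial.induction_on' with
  | add p q hp hq => rw [add_smul, map_add, hp, hq, add_mul]; simp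
  | C_mul_T n a =>
    have ha : (LaurentPolynomial.C a : ℤ[T;T⁻¹]) = (a : ℤ[T;T⁻¹]) :=
      eq_intCast (LaurentPolynomial.C : ℤ →+* ℤ[T;T⁻¹]) a
    rw [mul_smul, ha, Int.cast_smul_eq_zsmul, map_zsmul, cornerTrace_euler_T_smul,
      show (cornerTrace Γ i (k - n)).eulerK0 (projClass Γ j) = _ from
        TraceFunction.eulerK0_single _ _ _, cornerTrace_dim_projModule hΓ, ← ha, cartan,
      Finset.mul_sum]
    have hs : ∀ d : ℤ, LaurentPolynomial.C a * LaurentPolynomial.T n * LaurentPolynomial.T d =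
        (AddMonoidAlgebra.single (n + d) a : ℤ[T;T⁻¹]) := fun d => by
      rw [mul_assoc, ← LaurentPolynomial.T_add, LaurentPolynomial.single_eq_C_mul_T]
    simp only [hs]
    rw [AddMonoidAlgebra.coeff_sum, Finsupp.finsetSum_apply]
    simp only [AddMonoidAlgebra.coeff_single, Finsupp.single_apply]
    have h : ∀ d : ℤ, n + d = k ↔ k - n = d := fun d => by omega
    simp only [h, Finset.sum_ite_eq]
    split_ifs <;> simp

/-- All entries are polynomials in `T`, and the only paths of length zero are the constant ones.
Hence the matrix is the identity at `T = 0` and its determinant takes the value `1` there. -/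
lemma det_cartan_ne_zero [DecidableEq V] : (Matrix.of (cartan Γ)).det ≠ 0 := by
  let M : Matrix V V (Polynomial ℤ) :=
    Matrix.of fun i j => ∑ d ∈ degs Γ i j, Polynomial.X ^ d.toNat
  have h1 : Matrix.of (cartan Γ) = M.map Polynomial.toLaurent := by
    ext1 i j
    simp only [M, Matrix.map_apply, Matrix.of_apply, cartan, map_sum, map_pow,
      Polynomial.toLaurent_X, LaurentPolynomial.T_pow]
    refine Finset.sum_congr rfl fun d hd => ?_
    have : 0 ≤ d := by
      unfold degs at hd
      split_ifs at hd <;> simp at hd <;> omega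
    congr 1
    omega
  have h2 : M.map (Polynomial.evalRingHom 0) = 1 := by
    ext1 i j
    simp only [M, Matrix.map_apply, Matrix.of_apply, map_sum, degs]
    split_ifs with h h'
    · subst h
      simp
    · simp [h]
    · simp [h]
  have h3 := RingHom.map_det Polynomial.toLaurent M
  have h4 := RingHom.map_det (Polynomial.evalRingHom (0 : ℤ)) M
  rw [RingHom.mapMatrix_apply] at h3 h4
  rw [h2, Matrix.det_one] at h4
  rw [h1, ← h3]
  intro h5
  rw [map_eq_zero_iff _ Polynomial.toLaurent_injective] at h5
  rw [h5, map_zero] at h4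
  exact zero_ne_one h4

/-- The classes in the Grothendieck group are determined by the traces. -/
lemma coeff_eq_zero_of_euler (hΓ : ∀ i, ∃ j, Γ.Adj i j) (p : V → ℤ[T;T⁻¹])
    (h : ∀ i k, (cornerTrace Γ i k).eulerK0 (∑ j, p j • projClass Γ j) = 0) : p = 0 := by
  classical
  refine Matrix.eq_zero_of_mulVec_eq_zero (det_cartan_ne_zero (Γ := Γ)) ?_
  funext i
  refine AddMonoidAlgebra.ext (Finsupp.ext fun k => ?_)
  have h' := h i k
  simp only [map_sum, cornerTrace_euler_smul_projClass hΓ] at h'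
  rw [← Int.cast_sum, Int.cast_eq_zero] at h'
  rw [Matrix.mulVec, dotProduct, AddMonoidAlgebra.coeff_sum, Finsupp.finsetSum_apply]
  simp only [mul_comm (p _)] at h'
  exact h'

lemma linearIndependent_projClass (hΓ : ∀ i, ∃ j, Γ.Adj i j) :
    LinearIndependent ℤ[T;T⁻¹] (projClass Γ) := by
  rw [Fintype.linearIndependent_iff]
  intro p hp j
  exact congrFun (coeff_eq_zero_of_euler hΓ p fun i k => by rw [hp, map_zero]) j

/-- The classes of the `Pᵢ` form a basis of the Grothendieck group. -/
noncomputable def projBasis (hΓ : ∀ i, ∃ j, Γ.Adj i j) : Module.Basis V ℤ[T;T⁻¹] (K0 (Cat Γ)) :=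
  Module.Basis.mk (linearIndependent_projClass hΓ) span_projClass.ge

lemma projBasis_apply (hΓ : ∀ i, ∃ j, Γ.Adj i j) (i : V) : projBasis hΓ i = projClass Γ i :=
  Module.Basis.mk_apply _ _ _

/-- The traces jointly separate the points of `K0`, so an identity of classes can be checked by
counting dimensions. -/
lemma eq_of_euler (hΓ : ∀ i, ∃ j, Γ.Adj i j) {y z : K0 (Cat Γ)}
    (h : ∀ i k, (cornerTrace Γ i k).eulerK0 y = (cornerTrace Γ i k).eulerK0 z) : y = z := by
  rw [← sub_eq_zero, ← (projBasis hΓ).repr.map_eq_zero_iff]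
  refine DFunLike.coe_injective (coeff_eq_zero_of_euler hΓ _ fun i k => ?_)
  have := (projBasis hΓ).sum_repr (y - z)
  simp only [projBasis_apply] at this
  rw [this, map_sub, h, sub_self]

end ZigZag

/-! ### Tensor products with bimodules and two-term complexes on the Grothendieck group. -/

section TensorShift

variable {A : Type u} [Ring A] [Algebra ℂ A] {𝒜 : ℤ → Submodule ℂ A}

lemma tensorGr_shift_left {M B N : Type*} [AddCommGroup M] [Module ℂ M] [AddCommGroup B] [Module ℂ B]
    [AddCommGroup N] [Module ℂ N] (grB : ℤ → Submodule ℂ B) (grM : ℤ → Submodule ℂ M)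
    (π : B ⊗[ℂ] M →ₗ[ℂ] N) (n k : ℤ) :
    tensorGr (fun k => grB (k - n)) grM π k = tensorGr grB grM π (k - n) := by
  unfold tensorGr
  congr 1
  ext x
  constructor
  · rintro ⟨i, j, h, b, hb, m, hm, rfl⟩
    exact ⟨i - n, j, by omega, b, hb, m, hm, rfl⟩
  · rintro ⟨i, j, h, b, hb, m, hm, rfl⟩
    exact ⟨i + n, j, by omega, b, by simpa using hb, m, hm, rfl⟩

lemma tensorGr_shift_right {M B N : Type*} [AddCommGroup M] [Module ℂ M] [AddCommGroup B]
    [Module ℂ B] [AddCommGroup N] [Module ℂ N] (grB : ℤ → Submodule ℂ B) (grM : ℤ → Submodule ℂ M)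
    (π : B ⊗[ℂ] M →ₗ[ℂ] N) (n k : ℤ) :
    tensorGr grB (fun k => grM (k - n)) π k = tensorGr grB grM π (k - n) := by
  unfold tensorGr
  congr 1
  ext x
  constructor
  · rintro ⟨i, j, h, b, hb, m, hm, rfl⟩
    exact ⟨i, j - n, by omega, b, hb, m, hm, rfl⟩
  · rintro ⟨i, j, h, b, hb, m, hm, rfl⟩
    exact ⟨i, j + n, by omega, b, hb, m, by simpa using hm, rfl⟩

lemma GrMod.lin_sum {M N : GrMod 𝒜} {ι : Type*} (s : Finset ι) (f : ι → (M ⟶ N)) :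
    GrMod.Hom.lin (∑ i ∈ s, f i) = ∑ i ∈ s, GrMod.Hom.lin (f i) := by
  classical
  induction s using Finset.induction_on with
  | empty => rfl
  | insert i s hi ih => rw [Finset.sum_insert hi, Finset.sum_insert hi, lin_add, ih]

variable [GradedAlgebra 𝒜]

/-- An isomorphism of graded modules from a linear equivalence. -/
def GrMod.isoOfEquiv {M N : GrMod 𝒜} (e : M.carrier ≃ₗ[A] N.carrier)
    (h : ∀ k, ∀ m ∈ M.gr k, e m ∈ N.gr k) (h' : ∀ k, ∀ m ∈ N.gr k, e.symm m ∈ M.gr k) : M ≅ N where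
  hom := GrMod.ofLin e.toLinearMap h
  inv := GrMod.ofLin e.symm.toLinearMap h'
  hom_inv_id := GrMod.hom_ext (LinearMap.ext fun m => e.symm_apply_apply m)
  inv_hom_id := GrMod.hom_ext (LinearMap.ext fun m => e.apply_symm_apply m)

namespace GrBimod

/-- `B ⊗ (M⟨n⟩) ≅ (B ⊗ M)⟨n⟩`. -/
noncomputable def tensorShiftIso (B : GrBimod 𝒜) (n : ℤ) :
    GrMod.shiftFunctor n ⋙ B.tensor ≅ B.tensor ⋙ GrMod.shiftFunctor n :=
  NatIso.ofComponents (fun M => GrMod.isoOfEquiv (M := B.tensorObj (GrMod.shift n M))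
    (N := GrMod.shift n (B.tensorObj M)) (LinearEquiv.refl A (B.Tensor M))
    (fun k _ hm => (tensorGr_shift_right B.gr M.gr _ n k).le hm)
    (fun k _ hm => (tensorGr_shift_right B.gr M.gr _ n k).ge hm))
    fun _ => GrMod.hom_ext (LinearMap.ext fun _ => rfl)

/-- `B⟨n⟩ ⊗ M ≅ (B ⊗ M)⟨n⟩`. -/
noncomputable def shiftTensorIso (B : GrBimod 𝒜) (n : ℤ) :
    (GrBimod.shift n B).tensor ≅ B.tensor ⋙ GrMod.shiftFunctor n :=
  NatIso.ofComponents (fun M => GrMod.isoOfEquiv (M := (GrBimod.shift n B).tensorObj M)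
    (N := GrMod.shift n (B.tensorObj M)) (LinearEquiv.refl A (B.Tensor M))
    (fun k _ hm => (tensorGr_shift_left B.gr M.gr _ n k).le hm)
    (fun k _ hm => (tensorGr_shift_left B.gr M.gr _ n k).ge hm))
    fun _ => GrMod.hom_ext (LinearMap.ext fun _ => rfl)

/-- `A ⊗_A M ≃ M`. -/
noncomputable def regularTensorEquiv (M : GrMod 𝒜) :
    (regular 𝒜).Tensor M ≃ₗ[A] M.carrier :=
  LinearEquiv.ofLinearMap
    (tensorLift (B := regular 𝒜) (M := M) (TensorProduct.AlgebraTensorModule.lift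
      (LinearMap.toSpanSingleton A (M.carrier →ₗ[ℂ] M.carrier) LinearMap.id))
      fun b a m => mul_smul b a m)
    { toFun := fun m => (regular 𝒜).toTensor M ((1 : A) ⊗ₜ m)
      map_add' := fun m n => by rw [TensorProduct.tmul_add, map_add]
      map_smul' := fun a m => by
        rw [← toTensor_op_smul, RingHom.id_apply, ← map_smul, TensorProduct.smul_tmul']
        congr 2
        change (1 : A) * a = a * 1
        rw [one_mul, mul_one] }
    (LinearMap.ext fun m => one_smul A m)
    (tensor_hom_ext fun b m => by
      change (regular 𝒜).toTensor M ((1 : A) ⊗ₜ[ℂ] ((b : A) • m)) =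
        (regular 𝒜).toTensor M ((b : A) ⊗ₜ[ℂ] m)
      rw [← toTensor_op_smul]
      congr 2
      exact one_mul b)

/-- `A ⊗_A M ≅ M`. -/
noncomputable def regularTensorIso : (regular 𝒜).tensor ≅ 𝟭 (GrMod 𝒜) :=
  NatIso.ofComponents (fun M => GrMod.isoOfEquiv (M := (regular 𝒜).tensorObj M) (N := M)
    (regularTensorEquiv M)
    (fun k m hm => by
      change m ∈ tensorGr _ _ _ _ at hm
      unfold tensorGr at hm
      induction hm using Submodule.span_induction with
      | zero => rw [map_zero]; exact Submodule.zero_mem _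
      | add x y _ _ hx hy => rw [map_add]; exact Submodule.add_mem _ hx hy
      | smul c x _ hx =>
        rw [show regularTensorEquiv M (c • x) = c • regularTensorEquiv M x from
          LinearMap.map_smul_of_tower (regularTensorEquiv M).toLinearMap c x]
        exact Submodule.smul_mem _ c hx
      | mem x hx =>
        obtain ⟨i, j, rfl, b, hb, m, hm, rfl⟩ := hx
        exact M.smul_mem hb hm)
    (fun k m hm => Submodule.subset_span ⟨0, k, zero_add k, (1 : A), SetLike.GradedOne.one_mem, m, hm,
      rfl⟩))
    fun f => GrMod.hom_ext <| tensor_hom_ext fun b m => (map_smul (GrMod.Hom.lin f) (b : A) m).symm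

variable (B : GrBimod 𝒜) [Module.Finite A B.carrier] [Module.Projective A B.carrier]

/-- The functor `B ⊗_A -` on the homotopy category. -/
noncomputable def tensorCat : ProjHomotopyCategory 𝒜 ⥤ ProjHomotopyCategory 𝒜 :=
  (boundedProj 𝒜).lift
    ((boundedProj 𝒜).ι ⋙ B.tensor.mapHomotopyCategory (ComplexShape.up ℤ))
    fun X => by
      obtain ⟨⟨a, b, hab⟩, hX⟩ := X.property
      exact ⟨⟨a, b, fun k hk => B.tensor.map_isZero (hab k hk)⟩, fun k => B.fgProj_tensor (hX k)⟩

noncomputable instance : B.tensorCat.CommShift ℤ := by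
  unfold tensorCat; infer_instance

instance : B.tensorCat.IsTriangulated := by
  unfold tensorCat; infer_instance

/-- The endomorphism `[X] ↦ [B ⊗_A X]` of the Grothendieck group. -/
noncomputable def tensorK0 :
    K0 (ProjHomotopyCategory 𝒜) →ₗ[ℤ[T;T⁻¹]] K0 (ProjHomotopyCategory 𝒜) :=
  { K0.map B.tensorCat with
    map_smul' := K0.map_smul_of_shift (K0.map B.tensorCat) fun n X => by
      rw [K0.map_of, K0.map_of, T_smul_of]
      exact K0.of_complex_iso
        ((NatIso.mapHomologicalComplex (B.tensorShiftIso n) (ComplexShape.up ℤ)).app X.obj.as) _ _ }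

lemma tensorK0_of (X : ProjHomotopyCategory 𝒜) :
    B.tensorK0 (K0.of X) = K0.of (B.tensorCat.obj X) := K0.map_of _ X

lemma tensorK0_single (M : GrMod 𝒜) (hM : GrMod.fgProj M) :
    B.tensorK0 (K0.of (ProjHomotopyCategory.single M hM)) =
      K0.of (ProjHomotopyCategory.single (B.tensor.obj M) (B.fgProj_tensor hM)) := by
  rw [tensorK0_of]
  exact K0.of_complex_iso ((HomologicalComplex.singleMapHomologicalComplex
    B.tensor (ComplexShape.up ℤ) 0).app M) _ _

lemma tensorK0_shift (n : ℤ) (y : K0 (ProjHomotopyCategory 𝒜)) :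
    (GrBimod.shift n B).tensorK0 y = (LaurentPolynomial.T n : ℤ[T;T⁻¹]) • B.tensorK0 y := by
  have h : (GrBimod.shift n B).tensorK0.toAddMonoidHom =
      ((LaurentPolynomial.T n : ℤ[T;T⁻¹]) • B.tensorK0).toAddMonoidHom := K0.hom_ext fun X => by
    change (GrBimod.shift n B).tensorK0 (K0.of X) =
      (LaurentPolynomial.T n : ℤ[T;T⁻¹]) • B.tensorK0 (K0.of X)
    rw [tensorK0_of, tensorK0_of, T_smul_of]
    exact K0.of_complex_iso
      ((NatIso.mapHomologicalComplex (B.shiftTensorIso n) (ComplexShape.up ℤ)).app X.obj.as) _ _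
  exact DFunLike.congr_fun h y

lemma k0_regular [Module.Finite A (regular 𝒜).carrier] [Module.Projective A (regular 𝒜).carrier]
    (X : ProjHomotopyCategory 𝒜) : K0.of ((regular 𝒜).tensorCat.obj X) = K0.of X :=
  K0.of_complex_iso
    ((NatIso.mapHomologicalComplex (regularTensorIso (𝒜 := 𝒜)) (ComplexShape.up ℤ)).app X.obj.as ≪≫
      (Functor.mapHomologicalComplexIdIso (GrMod 𝒜) (ComplexShape.up ℤ)).app X.obj.as) _ _

variable {B} {B' : GrBimod 𝒜} [Module.Finite A B'.carrier] [Module.Projective A B'.carrier]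

lemma k0_tensorComplexRight (φ : Hom B B') (X : ProjHomotopyCategory 𝒜) :
    K0.of ((tensorComplexRight φ).obj X) =
      K0.of (B'.tensorCat.obj X) - K0.of (B.tensorCat.obj X) :=
  K0.of_mappingCone ((NatTrans.mapHomologicalComplex (tensorNat φ) (ComplexShape.up ℤ)).app X.obj.as)
    (B.tensorCat.obj X).property (B'.tensorCat.obj X).property

/-- Placing `B` in degree `0` shifts the cone by `-1`, which reverses the sign of its class. -/
lemma k0_tensorComplexLeft (φ : Hom B B') (X : ProjHomotopyCategory 𝒜) :
    K0.of ((tensorComplexLeft φ).obj X) =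
      K0.of (B.tensorCat.obj X) - K0.of (B'.tensorCat.obj X) := by
  have h : K0.of ((tensorComplexLeft φ).obj X) = _ :=
    K0.of_shift (-1) ((tensorComplexRight φ).obj X)
  rw [h, k0_tensorComplexRight, Int.negOnePow_neg, Int.negOnePow_one, Units.neg_smul, one_smul,
    neg_sub]

end GrBimod

end TensorShift

/-! ### The class of `(Pᵢ ⊗ Qᵢ) ⊗_A Pⱼ`. -/

namespace ZigZag

variable {V : Type u} [Fintype V] {Γ : SimpleGraph V}

lemma k0_twist (i : V) (X : Cat Γ) :
    K0.of ((twist Γ i).obj X) = K0.of X - (PQ Γ i).tensorK0 (K0.of X) := by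
  rw [twist, GrBimod.k0_tensorComplexRight, GrBimod.k0_regular, GrBimod.tensorK0_of]

lemma k0_twistInv (i : V) (X : Cat Γ) :
    K0.of ((twistInv Γ i).obj X) = K0.of X -
      (LaurentPolynomial.T (-2) : ℤ[T;T⁻¹]) • (PQ Γ i).tensorK0 (K0.of X) := by
  rw [twistInv, GrBimod.k0_tensorComplexLeft, GrBimod.k0_regular, ← GrBimod.tensorK0_shift,
    GrBimod.tensorK0_of]

/-- The map `p ↦ (p ⊗ eᵢ) ⊗ z` from `Pᵢ⟨d⟩` to `(Pᵢ ⊗ Qᵢ) ⊗_A Pⱼ`, for `z` of degree `d`. -/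
noncomputable def tensorIncl {i j : V} {d : ℤ} (z : P Γ j) (hz : z ∈ gradingP Γ j d) :
    GrMod.shift d (projModule Γ i) ⟶ (PQ Γ i).tensor.obj (projModule Γ j) :=
  GrMod.ofLin (M := GrMod.shift d (projModule Γ i)) (N := (PQ Γ i).tensorObj (projModule Γ j))
    ((PQ Γ i).toTensor (projModule Γ j) ∘ₗ
      (TensorProduct.AlgebraTensorModule.mk ℂ (ZigZag Γ) (P Γ i ⊗[ℂ] Q Γ i) (P Γ j)).flip z ∘ₗ
      (TensorProduct.AlgebraTensorModule.mk ℂ (ZigZag Γ) (P Γ i) (Q Γ i)).flip ⟨e Γ i, e_mem_Q Γ i⟩)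
    fun k p hp => Submodule.subset_span ⟨k - d, d, sub_add_cancel k d,
      p ⊗ₜ (⟨e Γ i, e_mem_Q Γ i⟩ : Q Γ i), Submodule.subset_span
        ⟨k - d, 0, add_zero _, p, hp, ⟨e Γ i, e_mem_Q Γ i⟩, e_mem i, rfl⟩, z, hz, rfl⟩

/-- The map `(p ⊗ q) ⊗ y ↦ φ(qy) p` on the tensor product over `ℂ`. -/
noncomputable def coeffLin (i j : V) (φ : ZigZag Γ →ₗ[ℂ] ℂ) :
    (P Γ i ⊗[ℂ] Q Γ i) ⊗[ℂ] P Γ j →ₗ[ZigZag Γ] P Γ i :=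
  TensorProduct.AlgebraTensorModule.lift (TensorProduct.AlgebraTensorModule.lift
    { toFun := fun p =>
        { toFun := fun q =>
            { toFun := fun y => φ (q.1 * y.1) • p
              map_add' := fun y y' => by
                rw [Submodule.coe_add, mul_add, map_add, add_smul]
              map_smul' := fun c y => by
                rw [Submodule.coe_smul_of_tower, mul_smul_comm, map_smul, smul_assoc,
                  RingHom.id_apply] }
          map_add' := fun q q' => LinearMap.ext fun y => by
            change φ ((q.1 + q'.1) * y.1) • p = φ (q.1 * y.1) • p + φ (q'.1 * y.1) • p
            rw [add_mul, map_add, add_smul]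
          map_smul' := fun c q => LinearMap.ext fun y => by
            change φ ((c • q.1) * y.1) • p = c • φ (q.1 * y.1) • p
            rw [smul_mul_assoc, map_smul, smul_assoc] }
      map_add' := fun p p' => LinearMap.ext fun q => LinearMap.ext fun y => smul_add _ _ _
      map_smul' := fun a p => LinearMap.ext fun q => LinearMap.ext fun y => smul_comm _ _ _ })

lemma coeffLin_tmul (i j : V) (φ : ZigZag Γ →ₗ[ℂ] ℂ) (p : P Γ i) (q : Q Γ i) (y : P Γ j) :
    coeffLin i j φ ((p ⊗ₜ[ℂ] q) ⊗ₜ[ℂ] y) = φ (q.1 * y.1) • p := rfl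

lemma coeffLin_balanced (i j : V) (φ : ZigZag Γ →ₗ[ℂ] ℂ) (b : P Γ i ⊗[ℂ] Q Γ i) (a : ZigZag Γ)
    (y : P Γ j) : coeffLin i j φ ((MulOpposite.op a • b) ⊗ₜ[ℂ] y) =
      coeffLin i j φ (b ⊗ₜ[ℂ] (a • y)) := by
  induction b using TensorProduct.induction_on with
  | zero => rw [smul_zero, TensorProduct.zero_tmul, TensorProduct.zero_tmul]
  | add s t hs ht =>
    rw [smul_add, TensorProduct.add_tmul, map_add, hs, ht, TensorProduct.add_tmul, map_add]
  | tmul p q =>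
    rw [op_smul_tmul, coeffLin_tmul, coeffLin_tmul]
    exact congrArg (fun z => φ z • p) (mul_assoc q.1 a y.1)

/-- The map `(p ⊗ q) ⊗ y ↦ φ(qy) p`. -/
noncomputable def tensorCoeffLin (i j : V) (φ : ZigZag Γ →ₗ[ℂ] ℂ) :
    (PQ Γ i).Tensor (projModule Γ j) →ₗ[ZigZag Γ] P Γ i :=
  GrBimod.tensorLift (B := PQ Γ i) (M := projModule Γ j) (coeffLin i j φ) (coeffLin_balanced i j φ)

/-- The map `(p ⊗ q) ⊗ y ↦ φ(qy) p` to `Pᵢ⟨d⟩`, for `φ` of degree `d`. -/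
noncomputable def tensorCoeff (i j : V) {d : ℤ} (φ : ZigZag Γ →ₗ[ℂ] ℂ)
    (hφ : ∀ k, ∀ y ∈ grading Γ k, k ≠ d → φ y = 0) :
    (PQ Γ i).tensor.obj (projModule Γ j) ⟶ GrMod.shift d (projModule Γ i) :=
  GrMod.ofLin (M := (PQ Γ i).tensorObj (projModule Γ j)) (N := GrMod.shift d (projModule Γ i))
    (tensorCoeffLin i j φ) fun k x hx => by
      change x ∈ tensorGr _ _ _ _ at hx
      unfold tensorGr at hx
      induction hx using Submodule.span_induction with
      | zero => rw [map_zero]; exact Submodule.zero_mem _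
      | add x y _ _ hx hy => rw [map_add]; exact Submodule.add_mem _ hx hy
      | smul c x _ hx => rw [LinearMap.map_smul_of_tower]; exact Submodule.smul_mem _ c hx
      | mem x hx =>
        obtain ⟨s, l, rfl, b, hb, y, hy, rfl⟩ := hx
        change b ∈ tensorGr _ _ _ _ at hb
        unfold tensorGr at hb
        induction hb using Submodule.span_induction with
        | zero => rw [TensorProduct.zero_tmul, map_zero, map_zero]; exact Submodule.zero_mem _
        | add b b' _ _ hb hb' =>
          rw [TensorProduct.add_tmul, map_add, map_add]
          exact Submodule.add_mem _ hb hb'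
        | smul c b _ hb =>
          rw [← TensorProduct.smul_tmul', map_smul, LinearMap.map_smul_of_tower]
          exact Submodule.smul_mem _ c hb
        | mem b hb =>
          obtain ⟨m, n, rfl, p, hp, q, hq, rfl⟩ := hb
          change φ (q.1 * y.1) • p ∈ gradingP Γ i (m + n + l - d)
          -- The coefficient `φ(qy)` survives only for `deg q + deg y = d`, and then the degree in
          -- `Pᵢ⟨d⟩` is correct.
          by_cases h : n + l = d
          · rw [show m + n + l - d = m by omega]
            exact Submodule.smul_mem _ _ hp
          · have h0 : φ (q.1 * y.1) = 0 := hφ (n + l) _ (SetLike.mul_mem_graded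
              (show q.1 ∈ grading Γ n from hq) (show y.1 ∈ grading Γ l from hy)) h
            rw [h0, zero_smul]
            exact Submodule.zero_mem _

/-- `(Pᵢ ⊗ Qᵢ) ⊗_A Pⱼ` is a sum of copies of `Pᵢ`, one for every path from `i` to `j`. -/
lemma tensorK0_projClass (hΓ : ∀ i, ∃ j, Γ.Adj i j) (i j : V) :
    (PQ Γ i).tensorK0 (projClass Γ j) = cartan Γ i j • projClass Γ i := by
  obtain ⟨φ, hφ₁, hφ₂, hφ₃⟩ := exists_coeff hΓ i j
  refine eq_of_euler hΓ fun k l => ?_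
  have hP : ∀ d, GrMod.fgProj (GrMod.shift d (projModule Γ i)) := fun d =>
    ⟨inferInstanceAs (Module.Finite (ZigZag Γ) (P Γ i)),
      inferInstanceAs (Module.Projective (ZigZag Γ) (P Γ i))⟩
  have hQ : GrMod.fgProj (projModule Γ j) := ⟨inferInstance, inferInstance⟩
  let z : ℤ → P Γ j := fun d => ⟨path Γ i j d, mem_P.2 (path_mul_e i j d)⟩
  have hz : ∀ d, z d ∈ gradingP Γ j d := fun d => path_mem i j d
  rw [show (PQ Γ i).tensorK0 (projClass Γ j) = _ from GrBimod.tensorK0_single _ _ hQ,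
    TraceFunction.eulerK0_single, cartan, Finset.sum_smul, map_sum,
    -- The copy of `Pᵢ` indexed by `d` is included by tensoring with the path of degree `d`, and the
    -- map back extracts the coefficient of that path.
    (cornerTrace Γ k l).dim_eq_sum (degs Γ i j) (fun d => GrMod.shift d (projModule Γ i))
      (fun d => tensorIncl (z d) (hz d)) (fun d => tensorCoeff i j (φ d) (hφ₁ d)) ?_ ?_
      (GrBimod.fgProj_tensor _ hQ) hP]
  · refine Finset.sum_congr rfl fun d _ => ?_
    rw [← T_smul_projClass d i (hP d), TraceFunction.eulerK0_single]
  · intro d hd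
    refine GrMod.hom_ext (LinearMap.ext fun p => ?_)
    change φ d (e Γ i * path Γ i j d) • p = p
    rw [e_mul_path, hφ₂ d hd, one_smul]
  · refine GrMod.hom_ext (GrBimod.tensor_hom_ext (B := PQ Γ i) (M := projModule Γ j) fun b y => ?_)
    have hlin : ∀ x, GrMod.Hom.lin (∑ d ∈ degs Γ i j, tensorCoeff i j (φ d) (hφ₁ d) ≫
        tensorIncl (z d) (hz d)) x = ∑ d ∈ degs Γ i j,
          (PQ Γ i).toTensor (projModule Γ j) ((tensorCoeffLin i j (φ d) x ⊗ₜ[ℂ]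
            (⟨e Γ i, e_mem_Q Γ i⟩ : Q Γ i)) ⊗ₜ[ℂ] z d) := fun x => by
      rw [GrMod.lin_sum, LinearMap.sum_apply]
      rfl
    refine (hlin _).trans ?_
    change _ = (PQ Γ i).toTensor (projModule Γ j) (b ⊗ₜ y)
    clear hlin
    induction b using TensorProduct.induction_on with
    | zero => simp
    | add s t hs ht =>
      simp only [TensorProduct.add_tmul, map_add, Finset.sum_add_distrib, hs, ht]
    | tmul p q =>
      -- The product `qy` lies in `eᵢAeⱼ` and is therefore expanded in paths. Moving `q` across the
      -- tensor sign turns `(p ⊗ q) ⊗ y` into `(p ⊗ eᵢ) ⊗ qy`, to which the expansion applies.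
      have h1 : ∑ d ∈ degs Γ i j, φ d (q.1 * y.1) • z d = q.1 • y := Subtype.ext (by
        have h2 := hφ₃ (q.1 * y.1) (by
          rw [← mul_assoc, mem_Q.1 q.2, mul_assoc, mem_P.1 y.2])
        rw [AddSubmonoidClass.coe_finsetSum]
        exact h2)
      have h3 : p ⊗ₜ[ℂ] q = MulOpposite.op q.1 • (p ⊗ₜ[ℂ] (⟨e Γ i, e_mem_Q Γ i⟩ : Q Γ i)) := by
        rw [op_smul_tmul]
        congr 1
        exact Subtype.ext (mem_Q.1 q.2).symm
      have h4 : (PQ Γ i).toTensor (projModule Γ j) ((p ⊗ₜ[ℂ] q) ⊗ₜ[ℂ] y) =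
          ∑ d ∈ degs Γ i j, (PQ Γ i).toTensor (projModule Γ j)
            ((p ⊗ₜ[ℂ] (⟨e Γ i, e_mem_Q Γ i⟩ : Q Γ i)) ⊗ₜ[ℂ] (φ d (q.1 * y.1) • z d)) := by
        rw [h3]
        refine (GrBimod.toTensor_op_smul _ (projModule Γ j) _ _ _).trans ?_
        rw [← h1]
        exact (congrArg _ (TensorProduct.tmul_sum _ _ _)).trans (map_sum _ _ _)
      refine Eq.trans (Finset.sum_congr rfl fun d _ => ?_) h4.symm
      rw [TensorProduct.tmul_smul, TensorProduct.smul_tmul', TensorProduct.smul_tmul']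
      rfl

end ZigZag

/-! ### Rank-one reflections over a commutative ring and their braid relations. -/

section PseudoReflections

variable {R M : Type*} [CommRing R] [AddCommGroup M] [Module R M]

/-- The map `v ↦ v - B(v) x`, for `B(x) = 1 + c` with `c` a unit. -/
def pseudoReflection (B : M →ₗ[R] R) (x : M) (c d : R) (hcd : c * d = 1) (hx : B x = 1 + c) :
    M ≃ₗ[R] M :=
  LinearEquiv.ofLinearMap (LinearMap.id - B.smulRight x) (LinearMap.id - B.smulRight (d • x))
    (LinearMap.ext fun v => by
      simp only [LinearMap.comp_apply, LinearMap.sub_apply, LinearMap.id_apply,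
        LinearMap.smulRight_apply, map_sub, map_smul, hx]
      match_scalars
      · ring
      · linear_combination (B v) * hcd)
    (LinearMap.ext fun v => by
      simp only [LinearMap.comp_apply, LinearMap.sub_apply, LinearMap.id_apply,
        LinearMap.smulRight_apply, map_sub, map_smul, hx]
      match_scalars
      · ring
      · linear_combination (B v) * hcd)

lemma pseudoReflection_apply (B : M →ₗ[R] R) (x : M) (c d : R) (hcd : c * d = 1)
    (hx : B x = 1 + c) (v : M) : pseudoReflection B x c d hcd hx v = v - B v • x := rfl

/-- Expanding both sides, the coefficients of `x` and `x'` differ by multiples of `t * t - c`. For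
the Cartan matrix this is `T · T = T²`. -/
lemma pseudoReflection_braid {B B' : M →ₗ[R] R} {x x' : M} {c d t : R} (hcd : c * d = 1)
    (hx : B x = 1 + c) (hx' : B' x' = 1 + c) (h : B x' = t) (h' : B' x = t) (ht : t * t = c) :
    pseudoReflection B x c d hcd hx * pseudoReflection B' x' c d hcd hx' *
        pseudoReflection B x c d hcd hx =
      pseudoReflection B' x' c d hcd hx' * pseudoReflection B x c d hcd hx *
        pseudoReflection B' x' c d hcd hx' := by
  refine LinearEquiv.ext fun v => ?_
  simp only [LinearEquiv.mul_apply, pseudoReflection_apply, map_sub, map_smul, hx, hx', h, h']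
  match_scalars
  · ring
  · linear_combination (-B v) * ht
  · linear_combination (B' v) * ht

lemma pseudoReflection_comm {B B' : M →ₗ[R] R} {x x' : M} {c d : R} (hcd : c * d = 1)
    (hx : B x = 1 + c) (hx' : B' x' = 1 + c) (h : B x' = 0) (h' : B' x = 0) :
    pseudoReflection B x c d hcd hx * pseudoReflection B' x' c d hcd hx' =
      pseudoReflection B' x' c d hcd hx' * pseudoReflection B x c d hcd hx := by
  refine LinearEquiv.ext fun v => ?_
  simp only [LinearEquiv.mul_apply, pseudoReflection_apply, map_sub, map_smul, h, h', zero_smul,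
    sub_zero]
  abel

end PseudoReflections

/-! ### The action on the Grothendieck group and its comparison with the Burau representation. -/

namespace ZigZag

variable {V : Type u} {Γ : SimpleGraph V}

lemma cartan_self (i : V) : cartan Γ i i = 1 + LaurentPolynomial.T 2 := by
  simp [cartan, degs]

lemma cartan_of_adj {i j : V} (h : Γ.Adj i j) : cartan Γ i j = LaurentPolynomial.T 1 := by
  simp [cartan, degs, h, h.ne]

lemma cartan_of_not_adj {i j : V} (hij : i ≠ j) (h : ¬ Γ.Adj i j) : cartan Γ i j = 0 := by
  simp [cartan, degs, h, hij]

lemma laurentToRatFunc_cartan (ε : ℤˣ) (i j : V) :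
    laurentToRatFunc ε (cartan Γ i j) = pairing Γ ε i j := by
  unfold pairing
  split_ifs with hij h
  · rw [hij, cartan_self, map_add, map_one, laurentToRatFunc, LaurentPolynomial.eval₂_T]
    -- The sign disappears on the diagonal because `(εq)² = q²`, so both values of `ε` are treated
    -- together.
    rw [← signedQ_mul_self ε]
    norm_cast
    simp [sq]
  · rw [cartan_of_adj h, laurentToRatFunc, LaurentPolynomial.eval₂_T, zpow_one, Units.val_mk0]
  · rw [cartan_of_not_adj hij h, map_zero]

variable [Fintype V] (hΓ : ∀ i, ∃ j, Γ.Adj i j)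

/-- The functional on the Grothendieck group with `[Pⱼ] ↦ dim eᵢ A eⱼ`. -/
noncomputable def cartanForm (i : V) : K0 (Cat Γ) →ₗ[ℤ[T;T⁻¹]] ℤ[T;T⁻¹] :=
  (projBasis hΓ).constr ℤ (cartan Γ i)

lemma cartanForm_projClass (i j : V) : cartanForm hΓ i (projClass Γ j) = cartan Γ i j := by
  rw [← projBasis_apply hΓ, cartanForm, Module.Basis.constr_basis]

lemma tensorK0_eq (i : V) (y : K0 (Cat Γ)) :
    (PQ Γ i).tensorK0 y = cartanForm hΓ i y • projClass Γ i := by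
  have : (PQ Γ i).tensorK0 = (cartanForm hΓ i).smulRight (projClass Γ i) :=
    (projBasis hΓ).ext fun j => by
      rw [projBasis_apply, tensorK0_projClass hΓ, LinearMap.smulRight_apply, cartanForm_projClass]
  exact LinearMap.congr_fun this y

lemma T_two_mul_T : (LaurentPolynomial.T 2 * LaurentPolynomial.T (-2) : ℤ[T;T⁻¹]) = 1 := by
  rw [← LaurentPolynomial.T_add]
  rfl

/-- The automorphism of the Grothendieck group given by `Σᵢ`. -/
noncomputable def k0Reflection (i : V) : K0 (Cat Γ) ≃ₗ[ℤ[T;T⁻¹]] K0 (Cat Γ) :=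
  pseudoReflection (cartanForm hΓ i) (projClass Γ i) (LaurentPolynomial.T 2)
    (LaurentPolynomial.T (-2)) T_two_mul_T ((cartanForm_projClass hΓ i i).trans (cartan_self i))

/-- The action of the Artin group on the Grothendieck group. -/
noncomputable def k0Action : ArtinGroup Γ →* (K0 (Cat Γ) ≃ₗ[ℤ[T;T⁻¹]] K0 (Cat Γ)) :=
  PresentedGroup.toGroup (f := k0Reflection hΓ) <| by
    rintro _ (⟨i, j, h⟩ | ⟨i, j, h⟩) <;>
      simp only [map_mul, map_inv, FreeGroup.lift_apply_of] <;> rw [mul_inv_eq_one]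
    · exact pseudoReflection_braid (t := LaurentPolynomial.T 1) _ _ _
        ((cartanForm_projClass hΓ i j).trans (cartan_of_adj h))
        ((cartanForm_projClass hΓ j i).trans (cartan_of_adj h.symm))
        (by rw [← LaurentPolynomial.T_add]; rfl)
    · by_cases hij : i = j
      · rw [hij]
      · exact pseudoReflection_comm _ _ _
          ((cartanForm_projClass hΓ i j).trans (cartan_of_not_adj hij h))
          ((cartanForm_projClass hΓ j i).trans
            (cartan_of_not_adj (Ne.symm hij) fun h' => h h'.symm))

lemma k0Action_σ (i : V) : k0Action hΓ (ArtinGroup.σ Γ i) = k0Reflection hΓ i := by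
  rw [k0Action, ArtinGroup.σ, PresentedGroup.toGroup.of]

lemma k0Action_σ_of (i : V) (X : Cat Γ) :
    k0Action hΓ (ArtinGroup.σ Γ i) (K0.of X) = K0.of ((twist Γ i).obj X) := by
  rw [k0Action_σ, k0_twist, tensorK0_eq hΓ]
  rfl

/-- `pseudoReflection` carries the explicit inverse `v ↦ v - B(v)(d • x)` with `d = T⁻²`; this is
the factor produced by the shift `⟨-2⟩` in `Σᵢ⁻¹`, so the two sides agree by `rfl` after rewriting.
-/
lemma k0Action_σ_inv_of (i : V) (X : Cat Γ) :
    k0Action hΓ (ArtinGroup.σ Γ i)⁻¹ (K0.of X) = K0.of ((twistInv Γ i).obj X) := by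
  rw [map_inv, k0Action_σ, k0_twistInv, tensorK0_eq hΓ, smul_comm]
  rfl

lemma k0Action_σ_projClass (i j : V) : k0Action hΓ (ArtinGroup.σ Γ i) (projClass Γ j) =
    projClass Γ j - cartan Γ i j • projClass Γ i := by
  rw [k0Action_σ, ← cartanForm_projClass hΓ i j]
  rfl

section Comparison

variable {K : Type*} [Field K] [Algebra ℤ[T;T⁻¹] K]

/-- The comparison of the extension of scalars of the Grothendieck group with the free module. -/
noncomputable def k0BaseChange : K ⊗[ℤ[T;T⁻¹]] K0 (Cat Γ) ≃ₗ[K] V →₀ K :=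
  ((projBasis hΓ).baseChange K).repr

lemma k0BaseChange_projClass (i : V) :
    k0BaseChange (K := K) hΓ (1 ⊗ₜ projClass Γ i) = Finsupp.single i 1 := by
  rw [← projBasis_apply hΓ, ← Module.Basis.baseChange_apply, k0BaseChange, Module.Basis.repr_self]

/-- Two actions of the Artin group which are intertwined for the generators are intertwined. -/
lemma k0BaseChange_equivariant (ρ : ArtinGroup Γ →* ((V →₀ K) ≃ₗ[K] (V →₀ K)))
    (hρ : ∀ i j, ρ (ArtinGroup.σ Γ i) (Finsupp.single j 1) =
      Finsupp.single j 1 - algebraMap ℤ[T;T⁻¹] K (cartan Γ i j) • Finsupp.single i 1)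
    (g : ArtinGroup Γ) (y : K ⊗[ℤ[T;T⁻¹]] K0 (Cat Γ)) :
    k0BaseChange hΓ ((k0Action hΓ g).toLinearMap.baseChange K y) = ρ g (k0BaseChange hΓ y) := by
  -- The elements whose actions are intertwined form a subgroup, so it is enough that it contains
  -- the generators.
  let S : Subgroup (ArtinGroup Γ) :=
    { carrier := {g | ∀ y : K ⊗[ℤ[T;T⁻¹]] K0 (Cat Γ),
        k0BaseChange hΓ ((k0Action hΓ g).toLinearMap.baseChange K y) = ρ g (k0BaseChange hΓ y)}
      one_mem' := fun y => by
        rw [map_one, map_one]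
        exact congrArg _ (LinearMap.congr_fun LinearMap.baseChange_id y)
      mul_mem' := fun {g h} hg hh y => by
        rw [map_mul, map_mul, LinearEquiv.mul_apply, ← hh, ← hg]
        exact congrArg _ (LinearMap.congr_fun (LinearMap.baseChange_comp _ _) y)
      inv_mem' := fun {g} hg y => by
        -- Closure under inverses: the identity for `g` at the vector `g⁻¹y` computes the image of
        -- `y`, and `ρ g⁻¹` is then applied.
        have h := hg ((k0Action hΓ g⁻¹).toLinearMap.baseChange K y)
        rw [← LinearMap.comp_apply, ← LinearMap.baseChange_comp,
          show (k0Action hΓ g).toLinearMap ∘ₗ (k0Action hΓ g⁻¹).toLinearMap = LinearMap.id from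
            LinearMap.ext fun z => by
              change (k0Action hΓ g * k0Action hΓ g⁻¹) z = z
              rw [← map_mul, mul_inv_cancel, map_one]
              rfl, LinearMap.baseChange_id, LinearMap.id_apply] at h
        rw [h, ← LinearEquiv.mul_apply, ← map_mul, inv_mul_cancel, map_one]
        rfl }
  have hS : S = ⊤ := by
    rw [eq_top_iff, ← PresentedGroup.closure_range_of, Subgroup.closure_le]
    rintro _ ⟨i, rfl⟩ y
    -- For a generator both sides are `K`-linear, so they are compared on the basis `1 ⊗ [Pⱼ]`,
    -- where `hρ` applies.
    have : (k0BaseChange hΓ).toLinearMap ∘ₗ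
        (k0Action hΓ (ArtinGroup.σ Γ i)).toLinearMap.baseChange K =
        (ρ (ArtinGroup.σ Γ i)).toLinearMap ∘ₗ (k0BaseChange hΓ).toLinearMap :=
      ((projBasis hΓ).baseChange K).ext fun j => by
        rw [Module.Basis.baseChange_apply, projBasis_apply]
        change k0BaseChange hΓ ((1 : K) ⊗ₜ k0Action hΓ (ArtinGroup.σ Γ i) (projClass Γ j)) =
          ρ (ArtinGroup.σ Γ i) (k0BaseChange hΓ (1 ⊗ₜ projClass Γ j))
        rw [k0Action_σ_projClass, k0BaseChange_projClass, hρ, TensorProduct.tmul_sub, map_sub,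
          TensorProduct.tmul_smul, ← algebraMap_smul K (cartan Γ i j), map_smul,
          k0BaseChange_projClass, k0BaseChange_projClass]
    exact LinearMap.congr_fun this y
  exact (hS ▸ Subgroup.mem_top g : g ∈ S) y

end Comparison

end ZigZag

end KhovanovSeidel

theorem mainTheorem2 {V : Type u} [Fintype V] (Γ : SimpleGraph V) (hΓ : ∀ i, ∃ j, Γ.Adj i j) :
    ∃ κ : ArtinGroup Γ →* (K0 (ZigZag.Cat Γ) ≃ₗ[ℤ[T;T⁻¹]] K0 (ZigZag.Cat Γ)),
      (∀ i X, κ (ArtinGroup.σ Γ i) (K0.of X) = K0.of ((ZigZag.twist Γ i).obj X)) ∧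
      (∀ i X, κ (ArtinGroup.σ Γ i)⁻¹ (K0.of X) = K0.of ((ZigZag.twistInv Γ i).obj X)) ∧
      ∀ ε : ℤˣ,
        letI : Algebra ℤ[T;T⁻¹] (RatFunc ℂ) := (laurentToRatFunc ε).toAlgebra
        ∃ Φ : RatFunc ℂ ⊗[ℤ[T;T⁻¹]] K0 (ZigZag.Cat Γ) ≃ₗ[RatFunc ℂ] RootSpace V,
          (∀ i, Φ (1 ⊗ₜ K0.of (ZigZag.projObj Γ i)) = α i) ∧
          (∀ g y, Φ ((κ g).toLinearMap.baseChange (RatFunc ℂ) y) = burau Γ ε g (Φ y)) ∧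
          ∀ i j, Φ (1 ⊗ₜ κ (ArtinGroup.σ Γ i) (K0.of (ZigZag.projObj Γ j))) =
            α j - pairing Γ ε i j • α i := by
  refine ⟨ZigZag.k0Action hΓ, ZigZag.k0Action_σ_of hΓ, ZigZag.k0Action_σ_inv_of hΓ, fun ε => ?_⟩
  let : Algebra ℤ[T;T⁻¹] (RatFunc ℂ) := (laurentToRatFunc ε).toAlgebra
  have h := ZigZag.k0BaseChange_equivariant hΓ (burau Γ ε) fun i j => by
    rw [burau_σ_α, ← ZigZag.laurentToRatFunc_cartan]
    rfl
  refine ⟨ZigZag.k0BaseChange hΓ, ZigZag.k0BaseChange_projClass hΓ, h, fun i j => ?_⟩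
  rw [← burau_σ_α]
  -- The last claim is equivariance evaluated at `1 ⊗ [Pⱼ]`.
  exact (h (ArtinGroup.σ Γ i) (1 ⊗ₜ ZigZag.projClass Γ j)).trans
    (congrArg _ (ZigZag.k0BaseChange_projClass hΓ j))
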